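/- Let $t=2t'+1$ be an odd positive integer. **Conventions.** For a usual partition $\lambda$ let $\mathcal H(\lambda)$ be the multiset of its hook lengths, $\mathcal H_t(\lambda)$ the sub-multiset of hook lengths divisible by $t$, $H(\lambda)=\prod_{h\in\mathcal H(\lambda)}h$ and $H_t(\lambda)=\prod_{h\in\mathcal H_t(\lambda)}h$. For a strict partition $\bar\lambda=(\bar\lambda_1>\dots>\bar\lambda_\ell>0)$ put $\ell(\bar\lambda)=\ell$, $|\bar\lambda|=\sum_i\bar\lambda_i$ and $\bar\lambda_i=0$ for $i>\ell$. Its shifted Young diagram has the boxes $(i,j)$ with $i+1\le j\le i+\bar\lambda_i$; the hook length of the box $(i,j)$ is the number of boxes of the shifted diagram to its right in row $i$, plus the number of boxes below it in column $j$, plus $1$, plus $\bar\lambda_j$; and $H(\bar\lambda)$ is the product of all these hook lengths. The doubled distinct partition $\bar\lambda\bar\lambda$ is the usual partition whose Young diagram is obtained by adding $\bar\lambda_i$ boxes to the $i$-th column of the shifted Young diagram of $\bar\lambda$ for $1\le i\le\ell$; $\mathcal{DD}$ is the set of all doubled distinct partitions. Encode a partition $\lambda$ by the bi-infinite word $(a_p)_{p\in\mathbb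 Z}$ of its boundary, read from the bottom left to the top right, with $0$ for a vertical and $1$ for a horizontal edge, indexed so that $\#\{p\le -1: a_p=1\}=\#\{p\ge 0: a_p=0\}$ (that is, $a_p=0$ exactly for $p\in\{\lambda_i-i: i\ge 1\}$). The $t$-quotient component $\lambda^k$ ($0\le k\le t-1$) is the partition encoded, up to a shift of the index, by the subsequence $(a_{tp+k})_{p}$. The $t$-core $\lambda_{t\text{-core}}$ is the partition encoded by the word obtained when each subsequence $(a_{tp+k})_p$ is replaced by the sorted word $\cdots000111\cdots$ with the same charge $\#\{p\ge 0:\text{letter }0\}-\#\{p\le -1:\text{letter }1\}$. A partition is a $t$-core if it has no hook length equal to $t$. If $\lambda\in\mathcal{DD}$ then $\lambda^0\in\mathcal{DD}$, and $\bar\lambda^0$ denotes the strict partition with $\lambda^0=\bar\lambda^0\bar\lambda^0$. For $\lambda,\mu\in\mathcal{DD}$ write $\lambda\ge_t\mu$ if $\lambda_{t\text{-core}}=\mu_{t\text{-core}}$, $\bar\lambda^0\supseteq\bar\mu^0$, and $\lambda^i\supseteq\mu^i$ for $1\le i\le t'$; in that case let $|\lambda/\mu|=|\lambda|-|\mu|$.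 For $\lambda\in\mathcal{DD}$ define $$G_\lambda=\frac{2^{\,n-\ell(\bar\lambda^0)}}{t^{n}\,H(\bar\lambda^0)\prod_{i=1}^{t'}H(\lambda^i)},\qquad n=|\bar\lambda^0|+\sum_{i=1}^{t'}|\lambda^i|,$$ and for a function $g$ on $\mathcal{DD}$ define $$D_t\,g(\lambda)=\sum_{\lambda^+\in\mathcal{DD},\ \lambda^+\ge_t\lambda,\ |\lambda^+/\lambda|=2t} g(\lambda^+)\;-\;g(\lambda).$$ **Statement.** 1. For every $\lambda\in\mathcal{DD}$, $D_t(G_\lambda)=0$; in other words $G_\lambda=\sum_{\lambda^+\ge_t\lambda,\ |\lambda^+/\lambda|=2t}G_{\lambda^+}$. 2. For every $t$-core $\mu\in\mathcal{DD}$ and every integer $n\ge 0$, $$\sum_{\lambda\in\mathcal{DD},\ \lambda\ge_t\mu,\ |\lambda/\mu|=2nt}\frac{(2t)^n\,n!}{H_t(\lambda)}=1 .$$ 3. (Pétréolle's formula) For every integer $n\ge 0$, $$\sum_{\lambda\in\mathcal{DD},\ |\lambda|=2nt,\ \#\mathcal H_t(\lambda)=2n}\frac{1}{H_t(\lambda)}=\frac{1}{(2t)^n\,n!}.$$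 -/

import Mathlib

open scoped BigOperators

/-! ## Usual partitions

A usual partition is identified with its Young diagram; Mathlib's `YoungDiagram` has rows and
columns numbered from `0`. -/

/-- The hook length of the box `c = (i, j)`: the boxes to its right, the boxes below it, and the
box itself. (Only used for boxes of the diagram.) -/
def YoungDiagram.hookLen (μ : YoungDiagram) (c : ℕ × ℕ) : ℕ :=
  (μ.rowLen c.1 - (c.2 + 1)) + (μ.colLen c.2 - (c.1 + 1)) + 1

/-- The multiset `𝓗(μ)` of hook lengths. -/
def YoungDiagram.hooks (μ : YoungDiagram) : Multiset ℕ :=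
  μ.cells.val.map μ.hookLen

/-- `H(μ)`, the product of all hook lengths. -/
def YoungDiagram.hookProd (μ : YoungDiagram) : ℕ :=
  μ.hooks.prod

/-- The multiset `𝓗_t(μ)` of hook lengths that are multiples of `t`. -/
def YoungDiagram.hooksMod (t : ℕ) (μ : YoungDiagram) : Multiset ℕ :=
  μ.hooks.filter (fun h => t ∣ h)

/-- `H_t(μ)`, the product of the hook lengths that are multiples of `t`. -/
def YoungDiagram.hookProdMod (t : ℕ) (μ : YoungDiagram) : ℕ :=
  (μ.hooksMod t).prod

/-- A `t`-core is a partition without a hook length equal to `t`. -/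
def YoungDiagram.IsCore (t : ℕ) (μ : YoungDiagram) : Prop :=
  t ∉ μ.hooks

/-! ## Strict partitions -/

/-- A strict partition: a finite strictly decreasing sequence of positive integers. -/
@[ext]
structure StrictPartition where
  parts : List ℕ
  sorted : parts.SortedGT
  pos : ∀ x ∈ parts, 0 < x

namespace StrictPartition

/-- The `i`-th part (numbered from `0`), with the convention that it is `0` past the length. -/
def part (s : StrictPartition) (i : ℕ) : ℕ := s.parts.getD i 0

/-- The length `ℓ(s)`. -/
def length (s : StrictPartition) : ℕ := s.parts.length

/-- The size `|s|`. -/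
def size (s : StrictPartition) : ℕ := s.parts.sum

/-- Containment of strict partitions: `s ⊇ r` reads `s.Contains r`. -/
def Contains (s r : StrictPartition) : Prop := ∀ i, r.part i ≤ s.part i

/-- The shifted Young diagram: with rows and columns numbered from `0`, row `i` occupies the
columns `i + 1, …, i + s.part i`. -/
def shiftedCells (s : StrictPartition) : Finset (ℕ × ℕ) :=
  (Finset.range s.length).biUnion fun i =>
    (Finset.Icc (i + 1) (i + s.part i)).image fun j => (i, j)

/-- The hook length of the box `c = (i, j)` of the shifted diagram: the boxes to its right, the
boxes below it, the box itself, plus the `j`-th part. -/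
def hookLen (s : StrictPartition) (c : ℕ × ℕ) : ℕ :=
  (s.shiftedCells.filter fun d => d.1 = c.1 ∧ c.2 < d.2).card +
    (s.shiftedCells.filter fun d => c.1 < d.1 ∧ d.2 = c.2).card + 1 + s.part c.2

/-- `H(s)`, the product of all hook lengths of the strict partition. -/
def hookProd (s : StrictPartition) : ℕ :=
  ∏ c ∈ s.shiftedCells, s.hookLen c

/-- The boxes added to the shifted diagram to form the doubled distinct partition: `s.part j`
boxes are put at the bottom of column `j`, which has the `j` boxes of the rows `0, …, j - 1`
for every `j < s.length`. -/
def addedCells (s : StrictPartition) : Finset (ℕ × ℕ) :=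
  (Finset.range s.length).biUnion fun j =>
    (Finset.Ico j (j + s.part j)).image fun i => (i, j)

theorem part_eq_zero (s : StrictPartition) {i : ℕ} (h : s.length ≤ i) : s.part i = 0 := by
  simp only [part, length] at *
  exact List.getD_eq_default _ _ h

theorem part_lt (s : StrictPartition) {i j : ℕ} (hij : i < j) (hj : 0 < s.part j) :
    s.part j < s.part i := by
  have hjl : j < s.parts.length := by
    by_contra hcon
    have := s.part_eq_zero (i := j) (not_lt.mp hcon)
    omega
  have := s.sorted.pairwise
  rw [List.pairwise_iff_getElem] at this
  have h := this i j (hij.trans hjl) hjl hij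
  rwa [part, part, List.getD_eq_getElem _ _ hjl, List.getD_eq_getElem _ _ (hij.trans hjl)]

theorem part_add_le (s : StrictPartition) {i j : ℕ} (hij : i ≤ j) (hj : 0 < s.part j) :
    j + s.part j ≤ i + s.part i := by
  induction j, hij using Nat.le_induction with
  | base => exact le_rfl
  | succ k hk ih =>
    have h : s.part (k + 1) < s.part k := s.part_lt (Nat.lt_succ_self k) hj
    have := ih (by omega)
    omega

theorem mem_shiftedCells (s : StrictPartition) {i j : ℕ} :
    (i, j) ∈ s.shiftedCells ↔ i < j ∧ j ≤ i + s.part i := by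
  simp only [shiftedCells, Finset.mem_biUnion, Finset.mem_range, Finset.mem_image,
    Finset.mem_Icc, Prod.mk.injEq]
  constructor
  · rintro ⟨a, -, b, ⟨h1, h2⟩, rfl, rfl⟩
    exact ⟨h1, h2⟩
  · rintro ⟨h1, h2⟩
    refine ⟨i, ?_, j, ⟨h1, h2⟩, rfl, rfl⟩
    by_contra hcon
    have := s.part_eq_zero (not_lt.mp hcon)
    omega

theorem mem_addedCells (s : StrictPartition) {i j : ℕ} :
    (i, j) ∈ s.addedCells ↔ j ≤ i ∧ i < j + s.part j := by
  simp only [addedCells, Finset.mem_biUnion, Finset.mem_range, Finset.mem_image,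
    Finset.mem_Ico, Prod.mk.injEq]
  constructor
  · rintro ⟨a, -, b, ⟨h1, h2⟩, rfl, rfl⟩
    exact ⟨h1, h2⟩
  · rintro ⟨h1, h2⟩
    refine ⟨j, ?_, i, ⟨h1, h2⟩, rfl, rfl⟩
    by_contra hcon
    have := s.part_eq_zero (not_lt.mp hcon)
    omega

/-- The doubled distinct partition of `s`. -/
def double (s : StrictPartition) : YoungDiagram where
  cells := s.shiftedCells ∪ s.addedCells
  isLowerSet := by
    rintro ⟨i, j⟩ ⟨i', j'⟩ ⟨hi, hj⟩ h
    simp only [Finset.coe_union, Set.mem_union, Finset.mem_coe, mem_shiftedCells,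
      mem_addedCells] at h ⊢
    simp only at hi hj
    rcases h with ⟨h1, h2⟩ | ⟨h1, h2⟩
    · by_cases hc : i' < j'
      · have := s.part_add_le hi (by omega)
        exact Or.inl ⟨hc, by omega⟩
      · have := s.part_add_le (i := j') (j := i) (by omega) (by omega)
        exact Or.inr ⟨by omega, by omega⟩
    · by_cases hc : i' < j'
      · have := s.part_add_le (i := i') (j := j) (by omega) (by omega)
        exact Or.inl ⟨hc, by omega⟩
      · have := s.part_add_le hj (by omega)
        exact Or.inr ⟨by omega, by omega⟩

end StrictPartition

/-- The strict partition of which a doubled distinct partition is the double (see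
`StrictPartition.halve_double`): its parts are the numbers of boxes to the right of the diagonal
boxes. -/
def YoungDiagram.halve (μ : YoungDiagram) : StrictPartition where
  parts := ((List.range (μ.colLen 0)).map fun i => μ.rowLen i - (i + 1)).filter (0 < ·)
  sorted := by
    apply List.Pairwise.sortedGT
    rw [List.pairwise_filter, List.pairwise_map]
    refine List.pairwise_lt_range.imp ?_
    intro a b hab ha hb
    have := μ.rowLen_anti a b hab.le
    simp only [decide_eq_true_eq] at ha hb
    omega
  pos := by
    intro x hx
    simpa using (List.mem_filter.mp hx).2

theorem StrictPartition.halve_double (s : StrictPartition) : s.double.halve = s := by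
  have hrow : ∀ i, s.double.rowLen i - (i + 1) = s.part i := by
    intro i
    have key : ∀ j, i < j → (j < s.double.rowLen i ↔ j ≤ i + s.part i) := by
      intro j hj
      rw [← YoungDiagram.mem_iff_lt_rowLen, ← YoungDiagram.mem_cells]
      simp only [StrictPartition.double, Finset.mem_union, s.mem_shiftedCells,
        s.mem_addedCells]
      omega
    have h1 := key (i + s.part i + 1) (by omega)
    rcases Nat.eq_zero_or_pos (s.part i) with h | h
    · omega
    · have h2 := key (i + s.part i) (by omega)
      omega
  have hcol : s.length ≤ s.double.colLen 0 := by
    rcases Nat.eq_zero_or_pos s.length with h | h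
    · omega
    · have : (s.length - 1, 0) ∈ s.double := by
        rw [← YoungDiagram.mem_cells]
        have hp : 0 < s.part (s.length - 1) := by
          have hl : s.length - 1 < s.parts.length := by
            have : s.length = s.parts.length := rfl
            omega
          rw [StrictPartition.part, List.getD_eq_getElem _ _ hl]
          exact s.pos _ (List.getElem_mem hl)
        have := s.part_add_le (Nat.zero_le (s.length - 1)) hp
        simp only [StrictPartition.double, Finset.mem_union, s.mem_addedCells]
        omega
      have := YoungDiagram.mem_iff_lt_colLen.mp this
      omega
  apply StrictPartition.ext
  simp only [YoungDiagram.halve, hrow]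
  obtain ⟨m, hm⟩ := Nat.exists_eq_add_of_le hcol
  rw [hm, List.range_add, List.map_append, List.filter_append]
  have e1 : (List.range s.length).map (fun i => s.part i) = s.parts := by
    apply List.ext_getElem
    · simp [StrictPartition.length]
    · intro i h1 h2
      simp [StrictPartition.part, List.getElem?_eq_getElem h2]
  rw [e1, List.filter_eq_self.mpr, List.filter_eq_nil_iff.mpr, List.append_nil]
  · intro a ha
    simp only [List.map_map, List.mem_map, Function.comp_apply] at ha
    obtain ⟨b, -, rfl⟩ := ha
    simp [s.part_eq_zero]
  · intro a ha
    simpa using s.pos a ha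

/-! ## Edge words and the Littlewood decomposition -/

/-- A bi-infinite binary sequence beginning with infinitely many `0`s and ending with infinitely
many `1`s, given by the set of positions of its letters `0`. -/
structure EdgeWord where
  zeros : Set ℤ
  begins : ∃ N : ℤ, ∀ p < N, p ∈ zeros
  ends : ∃ N : ℤ, ∀ p ≥ N, p ∉ zeros

/-- The canonical edge word of a partition. The boundary of the diagram is read from the bottom
left to the top right, a vertical edge as `0` and a horizontal edge as `1`, and the position of
an edge is the content `j - i` of its starting point (row line `i`, column line `j`), so that the
edges starting on the main diagonal or above have positions `≥ 0`. The vertical edge that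
closes row `i` starts at row line `i + 1` and column line `μ.rowLen i`. -/
def YoungDiagram.edgeWord (μ : YoungDiagram) : EdgeWord where
  zeros := {p | ∃ i : ℕ, p = (μ.rowLen i : ℤ) - (i + 1)}
  begins := by
    refine ⟨-(μ.colLen 0 : ℤ), fun p hp => ⟨(-p - 1).toNat, ?_⟩⟩
    have h : μ.rowLen (-p - 1).toNat = 0 := by
      by_contra hcon
      have h1 := YoungDiagram.mem_iff_lt_rowLen.mpr (Nat.pos_of_ne_zero hcon)
      have h2 := YoungDiagram.mem_iff_lt_colLen.mp h1
      omega
    rw [h]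
    omega
  ends := by
    refine ⟨(μ.rowLen 0 : ℤ), ?_⟩
    rintro p hp ⟨i, rfl⟩
    have := μ.rowLen_anti 0 i (Nat.zero_le i)
    omega

namespace EdgeWord

/-- The number of letters `1` to the left of position `q`. -/
noncomputable def onesBefore (w : EdgeWord) (q : ℤ) : ℕ :=
  {p : ℤ | p < q ∧ p ∉ w.zeros}.ncard

/-- The positions of the letters `0` with more than `j` letters `1` to their left, that is, the
vertical edges closing the rows that meet column `j`. -/
def longRows (w : EdgeWord) (j : ℕ) : Set ℤ :=
  {q : ℤ | q ∈ w.zeros ∧ j < w.onesBefore q}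

theorem exists_bounds (w : EdgeWord) : ∃ a b : ℤ, (∀ j, w.longRows j ⊆ Set.Ico a b) ∧
    ∀ q ∈ w.zeros, w.onesBefore q ≤ (b - a).toNat := by
  obtain ⟨a, ha⟩ := w.begins
  obtain ⟨b, hb⟩ := w.ends
  have hlt : ∀ q ∈ w.zeros, q < b := fun q hq => by
    by_contra hcon
    exact hb q (not_lt.mp hcon) hq
  refine ⟨a, b, fun j q hq => ⟨?_, hlt q hq.1⟩, fun q hq => ?_⟩
  · by_contra hcon
    have h0 : {p : ℤ | p < q ∧ p ∉ w.zeros} = ∅ := by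
      ext p
      simp only [Set.mem_ofPred_eq, Set.mem_empty_iff_false, iff_false, not_and, not_not]
      intro hp
      exact ha p (by omega)
    have := hq.2
    simp [onesBefore, h0] at this
  · have hsub : {p : ℤ | p < q ∧ p ∉ w.zeros} ⊆ (Finset.Ico a b : Finset ℤ) := by
      rintro p ⟨h1, h2⟩
      simp only [Finset.coe_Ico, Set.mem_Ico]
      refine ⟨?_, h1.trans (hlt q hq)⟩
      by_contra hcon
      exact h2 (ha p (by omega))
    have := Set.ncard_le_ncard hsub (Finset.finite_toSet _)
    rwa [Set.ncard_coe_finset, Int.card_Ico] at this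

theorem longRows_finite (w : EdgeWord) (j : ℕ) : (w.longRows j).Finite := by
  obtain ⟨a, b, h, -⟩ := w.exists_bounds
  exact (Set.finite_Ico a b).subset (h j)

theorem longRows_anti (w : EdgeWord) {j j' : ℕ} (h : j ≤ j') : w.longRows j' ⊆ w.longRows j :=
  fun _ hq => ⟨hq.1, h.trans_lt hq.2⟩

theorem cells_finite (w : EdgeWord) :
    {c : ℕ × ℕ | c.1 < (w.longRows c.2).ncard}.Finite := by
  obtain ⟨a, b, -, h⟩ := w.exists_bounds
  refine ((Finset.range (w.longRows 0).ncard ×ˢ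
    Finset.range (b - a).toNat).finite_toSet).subset ?_
  rintro ⟨i, j⟩ hc
  simp only [Set.mem_ofPred_eq] at hc
  simp only [Finset.coe_product, Set.mem_prod, Finset.coe_range, Set.mem_Iio]
  refine ⟨hc.trans_le
    (Set.ncard_le_ncard (w.longRows_anti (Nat.zero_le j)) (w.longRows_finite 0)), ?_⟩
  have hne : (w.longRows j).Nonempty := by
    rw [Set.nonempty_iff_ne_empty]
    intro h0
    simp [h0] at hc
  obtain ⟨q, hq⟩ := hne
  exact hq.2.trans_le (h q hq.1)

/-- The partition encoded by an edge word: its rows correspond to the letters `0`, and the row of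
a letter `0` has as many boxes as there are letters `1` to the left of it. So column `j` has as
many boxes as there are letters `0` with more than `j` letters `1` to their left. Shifting
the word does not change the partition. -/
noncomputable def diagram (w : EdgeWord) : YoungDiagram where
  cells := w.cells_finite.toFinset
  isLowerSet := by
    rintro ⟨i, j⟩ ⟨i', j'⟩ ⟨hi, hj⟩ h
    simp only [Set.Finite.coe_toFinset, Set.mem_ofPred_eq] at h ⊢
    simp only at hi hj
    exact hi.trans_lt (h.trans_le
      (Set.ncard_le_ncard (w.longRows_anti hj) (w.longRows_finite j')))

/-- The subsequence `(a_{tp + k})_p` of the word `(a_p)_p`. -/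
def residue (w : EdgeWord) (t : ℕ) [NeZero t] (k : ℤ) : EdgeWord where
  zeros := {p | (t : ℤ) * p + k ∈ w.zeros}
  begins := by
    obtain ⟨a, ha⟩ := w.begins
    have ht : (1 : ℤ) ≤ t := by exact_mod_cast NeZero.one_le
    refine ⟨-|a| - |k|, fun p hp => ha _ ?_⟩
    have h1 := abs_nonneg a
    have h2 := abs_nonneg k
    have h3 := neg_abs_le a
    have h4 := le_abs_self k
    nlinarith
  ends := by
    obtain ⟨b, hb⟩ := w.ends
    have ht : (1 : ℤ) ≤ t := by exact_mod_cast NeZero.one_le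
    refine ⟨|b| + |k|, fun p hp => hb _ ?_⟩
    have h1 := abs_nonneg b
    have h2 := abs_nonneg k
    have h3 := le_abs_self b
    have h4 := neg_abs_le k
    nlinarith

/-- The charge `#{p ≥ 0, a_p = 0} - #{p ≤ -1, a_p = 1}` of a word (it is `0` for the canonical
word of a partition). -/
noncomputable def charge (w : EdgeWord) : ℤ :=
  ({p : ℤ | 0 ≤ p ∧ p ∈ w.zeros}.ncard : ℤ) - ({p : ℤ | p < 0 ∧ p ∉ w.zeros}.ncard : ℤ)

/-- The word of the `t`-core: each of the `t` subsequences `(a_{tp + k})_p` is sorted, that is,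
replaced by the word `…000111…` with the same charge. -/
noncomputable def coreWord (w : EdgeWord) (t : ℕ) [NeZero t] : EdgeWord where
  zeros := {p | p / (t : ℤ) < (w.residue t (p % (t : ℤ))).charge}
  begins := by
    have ht : (0 : ℤ) < t := by exact_mod_cast Nat.pos_of_ne_zero (NeZero.ne t)
    obtain ⟨M, hM⟩ := ((Finset.Ico (0 : ℤ) t).image
      fun k => (w.residue t k).charge).bddBelow
    refine ⟨(t : ℤ) * M, fun p hp => ?_⟩
    have h1 : M ≤ (w.residue t (p % (t : ℤ))).charge := hM (by
      simp only [Finset.coe_image, Set.mem_image, Finset.coe_Ico, Set.mem_Ico]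
      exact ⟨p % t, ⟨Int.emod_nonneg _ ht.ne', Int.emod_lt_of_pos _ ht⟩, rfl⟩)
    have h2 : p / (t : ℤ) < M := Int.ediv_lt_of_lt_mul ht (by linarith [mul_comm (t : ℤ) M])
    exact h2.trans_le h1
  ends := by
    have ht : (0 : ℤ) < t := by exact_mod_cast Nat.pos_of_ne_zero (NeZero.ne t)
    obtain ⟨M, hM⟩ := ((Finset.Ico (0 : ℤ) t).image
      fun k => (w.residue t k).charge).bddAbove
    refine ⟨(t : ℤ) * M, fun p hp => ?_⟩
    have h1 : (w.residue t (p % (t : ℤ))).charge ≤ M := hM (by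
      simp only [Finset.coe_image, Set.mem_image, Finset.coe_Ico, Set.mem_Ico]
      exact ⟨p % t, ⟨Int.emod_nonneg _ ht.ne', Int.emod_lt_of_pos _ ht⟩, rfl⟩)
    have h2 : M ≤ p / (t : ℤ) := Int.le_ediv_of_mul_le ht (by linarith [mul_comm (t : ℤ) M])
    simp only [Set.mem_ofPred_eq, not_lt]
    exact h1.trans h2

end EdgeWord

/-- The `t`-core of a partition in its Littlewood decomposition. -/
noncomputable def YoungDiagram.littlewoodCore (t : ℕ) [NeZero t] (μ : YoungDiagram) :
    YoungDiagram :=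
  (μ.edgeWord.coreWord t).diagram

/-- The component `μ^k`, `0 ≤ k ≤ t - 1`, of the `t`-quotient of a partition. -/
noncomputable def YoungDiagram.littlewoodQuotient (t : ℕ) [NeZero t] (μ : YoungDiagram)
    (k : ℕ) : YoungDiagram :=
  (μ.edgeWord.residue t k).diagram

/-! ## Doubled distinct partitions -/

/-- The set `𝓓𝓓` of doubled distinct partitions. -/
def DoubledDistinct : Type :=
  {μ : YoungDiagram // ∃ s : StrictPartition, s.double = μ}

namespace DoubledDistinct

/-- The underlying usual partition. -/
def diagram (lam : DoubledDistinct) : YoungDiagram := lam.1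

theorem finite_card_eq (n : ℕ) : {lam : DoubledDistinct | lam.diagram.card = n}.Finite := by
  have hfin : {μ : YoungDiagram | μ.card = n}.Finite := by
    apply Set.Finite.of_finite_image (f := YoungDiagram.cells)
    · refine ((Finset.range n ×ˢ Finset.range n).powerset.finite_toSet).subset ?_
      rintro _ ⟨μ, hμ, rfl⟩
      simp only [Finset.coe_powerset, Set.mem_preimage, Set.mem_powerset_iff, Finset.coe_subset]
      rintro ⟨i, j⟩ hc
      have hc' : (i, j) ∈ μ := hc
      have hμ' : μ.cells.card = n := hμ
      have h1 : μ.rowLen i ≤ n := by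
        rw [YoungDiagram.rowLen_eq_card, ← hμ']
        exact Finset.card_le_card (Finset.filter_subset _ _)
      have h2 : μ.colLen j ≤ n := by
        rw [YoungDiagram.colLen_eq_card, ← hμ']
        exact Finset.card_le_card (Finset.filter_subset _ _)
      have h3 := YoungDiagram.mem_iff_lt_rowLen.mp hc'
      have h4 := YoungDiagram.mem_iff_lt_colLen.mp hc'
      simp only [Finset.mem_product, Finset.mem_range]
      omega
    · intro a _ b _ h
      exact YoungDiagram.ext h
  exact hfin.preimage (Subtype.val_injective.injOn)

/-- The finite set of doubled distinct partitions of size `n`. -/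
noncomputable def ofSize (n : ℕ) : Finset DoubledDistinct :=
  (finite_card_eq n).toFinset

/-- The strict partition `λ̄⁰` with `λ⁰ = λ̄⁰λ̄⁰`, where `λ⁰` is the component with index `0` of
the `t`-quotient of `λ`. -/
noncomputable def bar0 (t : ℕ) [NeZero t] (lam : DoubledDistinct) : StrictPartition :=
  (lam.diagram.littlewoodQuotient t 0).halve

/-- The relation `λ ≥_t μ` for odd `t = 2 t' + 1`: same `t`-core, `λ̄⁰ ⊇ μ̄⁰`, and `λ^i ⊇ μ^i` for
`1 ≤ i ≤ t'`. -/
def GeT (t : ℕ) [NeZero t] (lam mu : DoubledDistinct) : Prop :=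
  lam.diagram.littlewoodCore t = mu.diagram.littlewoodCore t ∧
    (lam.bar0 t).Contains (mu.bar0 t) ∧
    ∀ i ∈ Finset.Icc 1 (t / 2),
      mu.diagram.littlewoodQuotient t i ≤ lam.diagram.littlewoodQuotient t i

/-- `n = |λ̄⁰| + ∑_{i = 1}^{t'} |λ^i|`. -/
noncomputable def weight (t : ℕ) [NeZero t] (lam : DoubledDistinct) : ℕ :=
  (lam.bar0 t).size + ∑ i ∈ Finset.Icc 1 (t / 2), (lam.diagram.littlewoodQuotient t i).card

/-- `G_λ = 2 ^ (n - ℓ(λ̄⁰)) / (t ^ n * H(λ̄⁰) * ∏_{i = 1}^{t'} H(λ^i))`. -/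
noncomputable def G (t : ℕ) [NeZero t] (lam : DoubledDistinct) : ℚ :=
  (2 : ℚ) ^ ((lam.weight t : ℤ) - ((lam.bar0 t).length : ℤ)) /
    ((t : ℚ) ^ lam.weight t * ((lam.bar0 t).hookProd : ℚ) *
      ∏ i ∈ Finset.Icc 1 (t / 2), ((lam.diagram.littlewoodQuotient t i).hookProd : ℚ))

open Classical in
/-- The finite set of the doubled distinct `λ ≥_t μ` with `|λ/μ| = |λ| - |μ| = 2nt`. -/
noncomputable def above (t : ℕ) [NeZero t] (mu : DoubledDistinct) (n : ℕ) :
    Finset DoubledDistinct :=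
  (ofSize (mu.diagram.card + 2 * n * t)).filter fun lam => lam.GeT t mu

/-- The `t`-difference operator: `D_t g(λ)` is the sum of `g(λ⁺)` over the doubled distinct
`λ⁺ ≥_t λ` with `|λ⁺/λ| = 2t`, minus `g(λ)`. -/
noncomputable def diffOp (t : ℕ) [NeZero t] (g : DoubledDistinct → ℚ)
    (lam : DoubledDistinct) : ℚ :=
  (∑ nu ∈ lam.above t 1, g nu) - g lam

end DoubledDistinct

/-!
# Hook lengths of doubled distinct partitions and their Littlewood decomposition

All partitions are handled through their edge words. For a word `w`, the point of the boundary at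
which the edge `q` starts has the coordinates `(w.zerosFrom q, w.onesBefore q)`, whose difference
is `q` minus the charge (`EdgeWord.onesBefore_sub_zerosFrom`). Hence the boxes of the diagram are
the inversions of the word, pairs of a letter `1` at `p` and a letter `0` at `q > p`, and the hook
length is `q - p` (`EdgeWord.cells_diagram`, `EdgeWord.hookLen_box`). Three consequences carry the
combinatorics.

* Hook lengths divisible by `t` come from inversions inside one residue class modulo `t`, so the
  product of these hook lengths is a product over the `t`-quotient
  (`EdgeWord.hookProdMod_diagram`). Comparing sums of positions of letters `0` gives `|λ| = |core|
  + t ∑ |λ^k|` (`EdgeWord.card_diagram_eq`).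
* The words of doubled distinct partitions are those for which `p` and `-p` carry different
  letters whenever `p ≠ 0`, with a letter `1` at `0` (`EdgeWord.IsDouble`). The residue `0` of
  such a word is of the same kind and the residues `k` and `t - k` are conjugate. Thus a doubled
  distinct partition is the same as its core together with a strict partition and `t'` arbitrary
  partitions (`DoubledDistinct.eq_of_components`, `DoubledDistinct.exists_of_components`).
* Sorting the inversions by their letter `0` gives the classical product formulas for `1 / H` in
  terms of beta numbers and, for strict partitions, of parts (`YoungDiagram.one_div_hookProd`,
  `StrictPartition.one_div_hookProd`). An inversion of a doubled distinct partition lies right of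
  the diagonal exactly if `p + q > 0`, which gives `H(ss) = 2 ^ ℓ(s) H(s) ^ 2`
  (`StrictPartition.hookProd_double`).

With the product formulas, the sums of `1 / H` over the partitions with one box more or one box
less are sums of residues of a rational function `∏ (z - y_i) / (z - x_i)`, evaluated by partial
fractions. This gives four branching rules, `sum_isCover_up` and `sum_isCover_down` for
`YoungDiagram` and for `StrictPartition`. A step up in the order `≥_t` adds a box to exactly one
component. Its contribution to the sum of `G` is `1 / t` times `G_λ` for the strict component and
`2 / t` times `G_λ` for each of the `t'` others, and `(1 + 2 t') / t = 1`; this is the first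
assertion.

For the second assertion write `(2 t) ^ n / H_t(λ) = G_λ L_λ`, where `L` is the product of the
reciprocals of the hook products of the components (`DoubledDistinct.one_div_hookProdMod`). The
rules for removing a box say that the sum of `L` over the steps down from `λ` is `n L_λ`.
Exchanging the summations over the steps between the levels `n` and `n + 1` above a core shows
that `n! ∑ G_λ L_λ` does not depend on `n`. The third assertion is the case of the empty core,
since the number of hook lengths divisible by `t` is `2 n` and the core takes up the rest of the
size.
-/

/-! ### Edge words, inversions and diagrams -/

namespace EdgeWord

theorem ext_zeros {w w' : EdgeWord} (h : ∀ p, p ∈ w.zeros ↔ p ∈ w'.zeros) : w = w' := by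
  cases w; cases w'
  simp only [mk.injEq]
  exact Set.ext h

/-- The number of letters `0` at or to the right of position `q`. Together, the pair
`(w.zerosFrom q, w.onesBefore q)` is the lattice point at which the edge `q` of the boundary
starts. -/
noncomputable def zerosFrom (w : EdgeWord) (q : ℤ) : ℕ :=
  {p : ℤ | q ≤ p ∧ p ∈ w.zeros}.ncard

theorem finite_onesBefore (w : EdgeWord) (q : ℤ) : {p : ℤ | p < q ∧ p ∉ w.zeros}.Finite := by
  obtain ⟨a, ha⟩ := w.begins
  refine (Set.finite_Ico a q).subset fun p hp => ⟨?_, hp.1⟩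
  by_contra hcon
  exact hp.2 (ha p (by omega))

theorem finite_zerosFrom (w : EdgeWord) (q : ℤ) : {p : ℤ | q ≤ p ∧ p ∈ w.zeros}.Finite := by
  obtain ⟨b, hb⟩ := w.ends
  refine (Set.finite_Ico q b).subset fun p hp => ⟨hp.1, ?_⟩
  by_contra hcon
  exact hb p (by omega) hp.2

theorem onesBefore_succ_of_mem {w : EdgeWord} {q : ℤ} (hq : q ∈ w.zeros) :
    w.onesBefore (q + 1) = w.onesBefore q := by
  unfold onesBefore
  congr 1
  ext p
  simp only [Set.mem_ofPred_eq]
  refine ⟨fun h => ⟨?_, h.2⟩, fun h => ⟨by omega, h.2⟩⟩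
  have : p ≠ q := by rintro rfl; exact h.2 hq
  omega

theorem onesBefore_succ_of_notMem {w : EdgeWord} {q : ℤ} (hq : q ∉ w.zeros) :
    w.onesBefore (q + 1) = w.onesBefore q + 1 := by
  unfold onesBefore
  rw [← Set.ncard_insert_of_notMem (a := q) (by simp) (w.finite_onesBefore q)]
  congr 1
  ext p
  simp only [Set.mem_ofPred_eq, Set.mem_insert_iff]
  constructor
  · rintro ⟨h1, h2⟩
    by_cases h : p = q
    · exact Or.inl h
    · exact Or.inr ⟨by omega, h2⟩
  · rintro (rfl | ⟨h1, h2⟩)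
    · exact ⟨by omega, hq⟩
    · exact ⟨by omega, h2⟩

theorem zerosFrom_of_mem {w : EdgeWord} {q : ℤ} (hq : q ∈ w.zeros) :
    w.zerosFrom q = w.zerosFrom (q + 1) + 1 := by
  unfold zerosFrom
  rw [← Set.ncard_insert_of_notMem (a := q) (by simp) (w.finite_zerosFrom (q + 1))]
  congr 1
  ext p
  simp only [Set.mem_ofPred_eq, Set.mem_insert_iff]
  constructor
  · rintro ⟨h1, h2⟩
    by_cases h : p = q
    · exact Or.inl h
    · exact Or.inr ⟨by omega, h2⟩
  · rintro (rfl | ⟨h1, h2⟩)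
    · exact ⟨by omega, hq⟩
    · exact ⟨by omega, h2⟩

theorem zerosFrom_of_notMem {w : EdgeWord} {q : ℤ} (hq : q ∉ w.zeros) :
    w.zerosFrom q = w.zerosFrom (q + 1) := by
  unfold zerosFrom
  congr 1
  ext p
  simp only [Set.mem_ofPred_eq]
  refine ⟨fun h => ⟨?_, h.2⟩, fun h => ⟨by omega, h.2⟩⟩
  have : p ≠ q := by rintro rfl; exact hq h.2
  omega

theorem onesBefore_mono (w : EdgeWord) {p q : ℤ} (h : p ≤ q) :
    w.onesBefore p ≤ w.onesBefore q :=
  Set.ncard_le_ncard (fun _ hx => ⟨hx.1.trans_le h, hx.2⟩) (w.finite_onesBefore q)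

theorem zerosFrom_anti (w : EdgeWord) {p q : ℤ} (h : p ≤ q) :
    w.zerosFrom q ≤ w.zerosFrom p :=
  Set.ncard_le_ncard (fun _ hx => ⟨h.trans hx.1, hx.2⟩) (w.finite_zerosFrom p)

theorem onesBefore_lt_iff {w : EdgeWord} {p q : ℤ} (hp : p ∉ w.zeros) :
    w.onesBefore p < w.onesBefore q ↔ p < q := by
  constructor
  · intro h
    by_contra hcon
    exact absurd (w.onesBefore_mono (not_lt.mp hcon)) (by omega)
  · intro h
    have := w.onesBefore_mono (show p + 1 ≤ q by omega)
    rw [onesBefore_succ_of_notMem hp] at this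
    omega

theorem zerosFrom_succ_lt_iff {w : EdgeWord} {p q : ℤ} (hq : q ∈ w.zeros) :
    w.zerosFrom (q + 1) < w.zerosFrom p ↔ p ≤ q := by
  constructor
  · intro h
    by_contra hcon
    exact absurd (w.zerosFrom_anti (show q + 1 ≤ p by omega)) (by omega)
  · intro h
    have := w.zerosFrom_anti h
    rw [zerosFrom_of_mem hq] at this
    omega

/-- Both sides grow by one from `q` to `q + 1`, and they agree at `q = 0` by the definition of the
charge. -/
theorem onesBefore_sub_zerosFrom (w : EdgeWord) (q : ℤ) :
    (w.onesBefore q : ℤ) - w.zerosFrom q = q - w.charge := by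
  have step : ∀ q : ℤ, (w.onesBefore (q + 1) : ℤ) - w.zerosFrom (q + 1) =
      (w.onesBefore q : ℤ) - w.zerosFrom q + 1 := by
    intro q
    by_cases hq : q ∈ w.zeros
    · rw [onesBefore_succ_of_mem hq, zerosFrom_of_mem hq]; push_cast; ring
    · rw [onesBefore_succ_of_notMem hq, zerosFrom_of_notMem hq]; push_cast; ring
  induction q using Int.induction_on with
  | zero =>
    simp only [charge, onesBefore, zerosFrom]
    ring
  | succ n ih => rw [step, ih]; ring
  | pred n ih =>
    have := step (-(n : ℤ) - 1)
    rw [sub_add_cancel, ih] at this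
    linarith

/-- The letter `0` that closes row `i`. -/
theorem exists_zero_of_index (w : EdgeWord) (i : ℕ) :
    ∃ q ∈ w.zeros, w.zerosFrom (q + 1) = i := by
  obtain ⟨b, hb⟩ := w.ends
  have hz : ∀ q ≥ b, w.zerosFrom q = 0 := by
    intro q hq
    rw [zerosFrom, Set.ncard_eq_zero (w.finite_zerosFrom q)]
    ext p
    simp only [Set.mem_ofPred_eq, Set.mem_empty_iff_false, iff_false, not_and]
    exact fun h => hb p (hq.trans h)
  obtain ⟨q, hq, hmax⟩ := Int.exists_greatest_of_bdd (P := fun q => i < w.zerosFrom q)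
    ⟨b, fun q hq => by
      by_contra hcon
      rw [hz q (by omega)] at hq
      omega⟩
    ⟨w.charge - i - 1, by
      have := w.onesBefore_sub_zerosFrom (w.charge - i - 1)
      omega⟩
  have h1 : ¬ i < w.zerosFrom (q + 1) := fun h => by
    have := hmax _ h
    omega
  by_cases hm : q ∈ w.zeros
  · have := zerosFrom_of_mem hm
    exact ⟨q, hm, by omega⟩
  · have := zerosFrom_of_notMem hm
    omega

/-- The letter `1` below column `j`. -/
theorem exists_one_of_index (w : EdgeWord) (j : ℕ) :
    ∃ p ∉ w.zeros, w.onesBefore p = j := by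
  obtain ⟨a, ha⟩ := w.begins
  have hz : ∀ q ≤ a, w.onesBefore q = 0 := by
    intro q hq
    rw [onesBefore, Set.ncard_eq_zero (w.finite_onesBefore q)]
    ext p
    simp only [Set.mem_ofPred_eq, Set.mem_empty_iff_false, iff_false, not_and, not_not]
    exact fun h => ha p (by omega)
  obtain ⟨q, hq, hmin⟩ := Int.exists_least_of_bdd (P := fun q => j < w.onesBefore q)
    ⟨a, fun q hq => by
      by_contra hcon
      rw [hz q (by omega)] at hq
      omega⟩
    ⟨w.charge + j + 1, by
      have := w.onesBefore_sub_zerosFrom (w.charge + j + 1)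
      omega⟩
  have h1 : ¬ j < w.onesBefore (q - 1) := fun h => by
    have := hmin _ h
    omega
  by_cases hm : q - 1 ∈ w.zeros
  · have := onesBefore_succ_of_mem hm
    rw [sub_add_cancel] at this
    omega
  · have := onesBefore_succ_of_notMem hm
    rw [sub_add_cancel] at this
    exact ⟨q - 1, hm, by omega⟩

theorem mem_diagram_iff {w : EdgeWord} {p : ℤ} (hp : p ∉ w.zeros) (i : ℕ) :
    (i, w.onesBefore p) ∈ w.diagram ↔ i < w.zerosFrom p := by
  have h : w.longRows (w.onesBefore p) = {q : ℤ | p ≤ q ∧ q ∈ w.zeros} := by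
    ext q
    simp only [longRows, Set.mem_ofPred_eq, onesBefore_lt_iff hp]
    refine ⟨fun h => ⟨h.2.le, h.1⟩, fun h => ⟨h.2, lt_of_le_of_ne h.1 ?_⟩⟩
    rintro rfl
    exact hp h.2
  rw [← YoungDiagram.mem_cells]
  simp only [diagram, Set.Finite.mem_toFinset, Set.mem_ofPred_eq, h, zerosFrom]

theorem colLen_diagram {w : EdgeWord} {p : ℤ} (hp : p ∉ w.zeros) :
    w.diagram.colLen (w.onesBefore p) = w.zerosFrom p := by
  have h : ∀ i, i < w.diagram.colLen (w.onesBefore p) ↔ i < w.zerosFrom p := fun i => by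
    rw [← YoungDiagram.mem_iff_lt_colLen, mem_diagram_iff hp]
  exact le_antisymm (le_of_forall_lt fun i hi => (h i).1 hi)
    (le_of_forall_lt fun i hi => (h i).2 hi)

theorem rowLen_diagram {w : EdgeWord} {q : ℤ} (hq : q ∈ w.zeros) :
    w.diagram.rowLen (w.zerosFrom (q + 1)) = w.onesBefore q := by
  have h : ∀ j, j < w.diagram.rowLen (w.zerosFrom (q + 1)) ↔ j < w.onesBefore q := fun j => by
    obtain ⟨p, hp, rfl⟩ := w.exists_one_of_index j
    rw [← YoungDiagram.mem_iff_lt_rowLen, mem_diagram_iff hp, zerosFrom_succ_lt_iff hq,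
      onesBefore_lt_iff hp]
    refine ⟨fun h => lt_of_le_of_ne h ?_, le_of_lt⟩
    rintro rfl
    exact hp hq
  exact le_antisymm (le_of_forall_lt fun i hi => (h i).1 hi)
    (le_of_forall_lt fun i hi => (h i).2 hi)

theorem finite_inversions (w : EdgeWord) :
    {x : ℤ × ℤ | x.1 ∉ w.zeros ∧ x.2 ∈ w.zeros ∧ x.1 < x.2}.Finite := by
  obtain ⟨a, ha⟩ := w.begins
  obtain ⟨b, hb⟩ := w.ends
  refine ((Set.finite_Ico a b).prod (Set.finite_Ico a b)).subset ?_
  rintro ⟨p, q⟩ ⟨h1, h2, h3⟩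
  simp only at h1 h2 h3
  have hp : a ≤ p := by
    by_contra hcon
    exact h1 (ha p (by omega))
  have hq : q < b := by
    by_contra hcon
    exact hb q (by omega) h2
  simp only [Set.mem_prod, Set.mem_Ico]
  omega

/-- The inversions of a word: the pairs formed by a letter `1` and a letter `0` to its right. They
correspond to the boxes of the diagram: the column of the box is below the horizontal edge, its
row is to the left of the vertical edge. -/
noncomputable def inversions (w : EdgeWord) : Finset (ℤ × ℤ) :=
  w.finite_inversions.toFinset

theorem mem_inversions {w : EdgeWord} {x : ℤ × ℤ} :
    x ∈ w.inversions ↔ x.1 ∉ w.zeros ∧ x.2 ∈ w.zeros ∧ x.1 < x.2 := by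
  simp [inversions]

/-- The box of an inversion. -/
noncomputable def box (w : EdgeWord) (x : ℤ × ℤ) : ℕ × ℕ :=
  (w.zerosFrom (x.2 + 1), w.onesBefore x.1)

theorem box_injOn (w : EdgeWord) : Set.InjOn w.box w.inversions := by
  rintro ⟨p, q⟩ h ⟨p', q'⟩ h' heq
  simp only [Finset.mem_coe, mem_inversions] at h h'
  simp only [box, Prod.mk.injEq] at heq
  have h1 := (zerosFrom_succ_lt_iff (w := w) (p := q') h.2.1)
  have h2 := (zerosFrom_succ_lt_iff (w := w) (p := q) h'.2.1)
  have h3 := (onesBefore_lt_iff (w := w) (q := p') h.1)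
  have h4 := (onesBefore_lt_iff (w := w) (q := p) h'.1)
  rw [zerosFrom_of_mem h'.2.1] at h1
  rw [zerosFrom_of_mem h.2.1] at h2
  ext <;> simp only <;> omega

theorem box_mem {w : EdgeWord} {p q : ℤ} (hp : p ∉ w.zeros) (hq : q ∈ w.zeros) :
    w.box (p, q) ∈ w.diagram ↔ p < q := by
  simp only [box]
  rw [mem_diagram_iff hp, zerosFrom_succ_lt_iff hq]
  refine ⟨fun h => lt_of_le_of_ne h ?_, le_of_lt⟩
  rintro rfl
  exact hp hq

theorem cells_diagram (w : EdgeWord) : w.diagram.cells = w.inversions.image w.box := by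
  ext ⟨i, j⟩
  rw [YoungDiagram.mem_cells, Finset.mem_image]
  constructor
  · intro h
    obtain ⟨p, hp, rfl⟩ := w.exists_one_of_index j
    obtain ⟨q, hq, rfl⟩ := w.exists_zero_of_index i
    exact ⟨(p, q), mem_inversions.mpr ⟨hp, hq, (box_mem hp hq).1 h⟩, rfl⟩
  · rintro ⟨⟨p, q⟩, hx, heq⟩
    rw [mem_inversions] at hx
    rw [← heq]
    exact (box_mem hx.1 hx.2.1).2 hx.2.2

/-- The hook length of a box is the distance between the two letters of its inversion: the letters
in between are the edges along arm and leg. -/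
theorem hookLen_box {w : EdgeWord} {x : ℤ × ℤ} (hx : x ∈ w.inversions) :
    (w.diagram.hookLen (w.box x) : ℤ) = x.2 - x.1 := by
  obtain ⟨p, q⟩ := x
  rw [mem_inversions] at hx
  obtain ⟨hp, hq, hlt⟩ := hx
  simp only at hp hq hlt
  have h1 := (box_mem hp hq).2 hlt
  have h2 := YoungDiagram.mem_iff_lt_rowLen.mp h1
  have h3 := YoungDiagram.mem_iff_lt_colLen.mp h1
  simp only [YoungDiagram.hookLen, box] at h2 h3 ⊢
  rw [rowLen_diagram hq] at h2 ⊢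
  rw [colLen_diagram hp] at h3 ⊢
  have h4 := w.onesBefore_sub_zerosFrom p
  have h5 := w.onesBefore_sub_zerosFrom q
  have h6 := zerosFrom_of_mem hq
  omega

theorem hooks_diagram (w : EdgeWord) :
    w.diagram.hooks = w.inversions.val.map fun x => (x.2 - x.1).toNat := by
  rw [YoungDiagram.hooks, cells_diagram, Finset.image_val_of_injOn w.box_injOn, Multiset.map_map]
  refine Multiset.map_congr rfl fun x hx => ?_
  have := hookLen_box (w := w) hx
  simp only [Function.comp_apply]
  omega

theorem card_diagram (w : EdgeWord) : w.diagram.card = w.inversions.card := by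
  rw [YoungDiagram.card, cells_diagram, Finset.card_image_of_injOn w.box_injOn]

theorem hookProd_diagram (w : EdgeWord) :
    (w.diagram.hookProd : ℤ) = ∏ x ∈ w.inversions, (x.2 - x.1) := by
  rw [YoungDiagram.hookProd, hooks_diagram, ← Finset.prod_eq_multiset_prod, Nat.cast_prod]
  refine Finset.prod_congr rfl fun x hx => ?_
  have := (mem_inversions.mp hx).2.2
  omega

/-- A word is determined by its charge and its diagram. -/
theorem eq_of_charge_eq_of_diagram_eq {w w' : EdgeWord} (hc : w.charge = w'.charge)
    (hd : w.diagram = w'.diagram) : w = w' := by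
  have key : ∀ {w w' : EdgeWord}, w.charge = w'.charge → w.diagram = w'.diagram →
      ∀ q ∈ w.zeros, q ∈ w'.zeros := by
    intro w w' hc hd q hq
    obtain ⟨q', hq', h⟩ := w'.exists_zero_of_index (w.zerosFrom (q + 1))
    have h1 := rowLen_diagram hq
    have h2 := rowLen_diagram hq'
    rw [h, ← hd, h1] at h2
    have h3 := w.onesBefore_sub_zerosFrom q
    have h4 := w'.onesBefore_sub_zerosFrom q'
    rw [zerosFrom_of_mem hq] at h3
    rw [zerosFrom_of_mem hq', h] at h4
    have : q = q' := by omega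
    rwa [this]
  exact ext_zeros fun p => ⟨key hc hd p, key hc.symm hd.symm p⟩

end EdgeWord

namespace YoungDiagram

theorem zerosFrom_edgeWord (μ : YoungDiagram) (i : ℕ) :
    μ.edgeWord.zerosFrom ((μ.rowLen i : ℤ) - i) = i := by
  have h : {p : ℤ | (μ.rowLen i : ℤ) - i ≤ p ∧ p ∈ μ.edgeWord.zeros} =
      (fun k : ℕ => (μ.rowLen k : ℤ) - (k + 1)) '' (Finset.range i : Finset ℕ) := by
    ext p
    simp only [edgeWord, Set.mem_ofPred_eq, Set.mem_image, Finset.coe_range, Set.mem_Iio]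
    constructor
    · rintro ⟨h1, k, rfl⟩
      refine ⟨k, ?_, rfl⟩
      by_contra hcon
      have := μ.rowLen_anti i k (by omega)
      omega
    · rintro ⟨k, hk, rfl⟩
      have := μ.rowLen_anti k i (by omega)
      exact ⟨by omega, k, rfl⟩
  rw [EdgeWord.zerosFrom, h, Set.ncard_image_of_injective, Set.ncard_coe_finset,
    Finset.card_range]
  intro a b hab
  simp only at hab
  rcases lt_trichotomy a b with h | h | h
  · have := μ.rowLen_anti a b h.le
    omega
  · exact h
  · have := μ.rowLen_anti b a h.le
    omega

theorem rowLen_eq_zero {μ : YoungDiagram} {i : ℕ} (h : μ.colLen 0 ≤ i) : μ.rowLen i = 0 := by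
  by_contra hcon
  have h1 := mem_iff_lt_rowLen.mpr (Nat.pos_of_ne_zero hcon)
  have h2 := mem_iff_lt_colLen.mp h1
  omega

theorem charge_edgeWord (μ : YoungDiagram) : μ.edgeWord.charge = 0 := by
  set i := μ.colLen 0 with hi
  have h0 : μ.rowLen i = 0 := rowLen_eq_zero le_rfl
  have h1 := μ.zerosFrom_edgeWord i
  have h2 := μ.edgeWord.onesBefore_sub_zerosFrom ((μ.rowLen i : ℤ) - i)
  have h3 : μ.edgeWord.onesBefore ((μ.rowLen i : ℤ) - i) = 0 := by
    rw [EdgeWord.onesBefore, Set.ncard_eq_zero (EdgeWord.finite_onesBefore _ _)]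
    ext p
    simp only [Set.mem_ofPred_eq, Set.mem_empty_iff_false, iff_false, not_and, not_not]
    intro hp
    refine ⟨(-p - 1).toNat, ?_⟩
    rw [rowLen_eq_zero (by omega)]
    omega
  omega

theorem ext_rowLen {μ ν : YoungDiagram} (h : ∀ i, μ.rowLen i = ν.rowLen i) : μ = ν := by
  ext ⟨i, j⟩
  rw [mem_cells, mem_cells, mem_iff_lt_rowLen, mem_iff_lt_rowLen, h]

theorem le_iff_rowLen {μ ν : YoungDiagram} : μ ≤ ν ↔ ∀ i, μ.rowLen i ≤ ν.rowLen i := by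
  rw [← cells_subset_iff]
  constructor
  · intro h i
    refine le_of_forall_lt fun j hj => ?_
    rw [← mem_iff_lt_rowLen] at hj ⊢
    exact h hj
  · rintro h ⟨i, j⟩ hc
    rw [mem_cells, mem_iff_lt_rowLen] at hc ⊢
    exact hc.trans_le (h i)

theorem diagram_edgeWord (μ : YoungDiagram) : μ.edgeWord.diagram = μ := by
  refine ext_rowLen fun i => ?_
  have hq : (μ.rowLen i : ℤ) - (i + 1) ∈ μ.edgeWord.zeros := ⟨i, rfl⟩
  have h1 := EdgeWord.rowLen_diagram hq
  rw [show (μ.rowLen i : ℤ) - (i + 1) + 1 = μ.rowLen i - i by ring, zerosFrom_edgeWord] at h1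
  have h2 := μ.edgeWord.onesBefore_sub_zerosFrom ((μ.rowLen i : ℤ) - (i + 1))
  rw [EdgeWord.zerosFrom_of_mem hq,
    show (μ.rowLen i : ℤ) - (i + 1) + 1 = μ.rowLen i - i by ring, zerosFrom_edgeWord,
    charge_edgeWord] at h2
  omega

theorem edgeWord_injective : Function.Injective YoungDiagram.edgeWord := fun μ ν h => by
  rw [← diagram_edgeWord μ, h, diagram_edgeWord]

end YoungDiagram

theorem EdgeWord.edgeWord_diagram {w : EdgeWord} (hc : w.charge = 0) :
    w.diagram.edgeWord = w :=
  EdgeWord.eq_of_charge_eq_of_diagram_eq (by rw [hc, YoungDiagram.charge_edgeWord])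
    (YoungDiagram.diagram_edgeWord _)

/-! ### Residues of an edge word modulo `t` -/

namespace EdgeWord

theorem onesBefore_eq_zero {w : EdgeWord} {a : ℤ} (h : ∀ p < a, p ∈ w.zeros) :
    w.onesBefore a = 0 := by
  rw [onesBefore, Set.ncard_eq_zero (w.finite_onesBefore a)]
  ext p
  simp only [Set.mem_ofPred_eq, Set.mem_empty_iff_false, iff_false, not_and, not_not]
  exact h p

theorem zerosFrom_eq_zero {w : EdgeWord} {a : ℤ} (h : ∀ p ≥ a, p ∉ w.zeros) :
    w.zerosFrom a = 0 := by
  rw [zerosFrom, Set.ncard_eq_zero (w.finite_zerosFrom a)]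
  ext p
  simp only [Set.mem_ofPred_eq, Set.mem_empty_iff_false, iff_false, not_and]
  exact h p

/-- The charge of a word can be read off by counting letters `0` from any cut that has only letters
`0` to its left. -/
theorem zerosFrom_eq_charge_sub {w : EdgeWord} {a : ℤ} (h : ∀ p < a, p ∈ w.zeros) :
    (w.zerosFrom a : ℤ) = w.charge - a := by
  have h1 := w.onesBefore_sub_zerosFrom a
  rw [onesBefore_eq_zero h] at h1
  push_cast at h1
  linarith

/-- The positions `≥ a` of the letters `0`. -/
noncomputable def zerosFinset (w : EdgeWord) (a : ℤ) : Finset ℤ :=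
  (w.finite_zerosFrom a).toFinset

theorem mem_zerosFinset {w : EdgeWord} {a p : ℤ} :
    p ∈ w.zerosFinset a ↔ a ≤ p ∧ p ∈ w.zeros := by
  simp [zerosFinset]

theorem card_zerosFinset (w : EdgeWord) (a : ℤ) : (w.zerosFinset a).card = w.zerosFrom a := by
  rw [zerosFrom, Set.ncard_eq_toFinset_card _ (w.finite_zerosFrom a), zerosFinset]

/-- The product over all inversions, arranged according to the letter `0` of the inversion. -/
theorem prod_inversions {M : Type*} [CommMonoid M] (w : EdgeWord) {a : ℤ}
    (h : ∀ p < a, p ∈ w.zeros) (f : ℤ → ℤ → M) :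
    open Classical in ∏ x ∈ w.inversions, f x.1 x.2 =
      ∏ q ∈ w.zerosFinset a, ∏ p ∈ (Finset.Ico a q).filter (· ∉ w.zeros), f p q := by
  classical
  rw [Finset.prod_sigma']
  refine Finset.prod_bij' (fun x _ => (⟨x.2, x.1⟩ : Σ _ : ℤ, ℤ)) (fun x _ => (x.2, x.1))
    ?_ ?_ (fun _ _ => rfl) (fun _ _ => rfl) (fun _ _ => rfl)
  · rintro ⟨p, q⟩ hx
    rw [mem_inversions] at hx
    simp only at hx
    simp only [Finset.mem_sigma, mem_zerosFinset, Finset.mem_filter, Finset.mem_Ico]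
    have : a ≤ p := by
      by_contra hcon
      exact hx.1 (h p (by omega))
    exact ⟨⟨by omega, hx.2.1⟩, ⟨this, hx.2.2⟩, hx.1⟩
  · rintro ⟨q, p⟩ hx
    simp only [Finset.mem_sigma, mem_zerosFinset, Finset.mem_filter, Finset.mem_Ico] at hx
    rw [mem_inversions]
    exact ⟨hx.2.2, hx.1.2, hx.2.1.2⟩

/-- The size of the diagram as the sum of the positions of the letters `0` to the right of a cut, up
to terms that depend only on the cut and the charge. -/
theorem card_inversions (w : EdgeWord) {a : ℤ} (h : ∀ p < a, p ∈ w.zeros) :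
    (w.inversions.card : ℤ) = ∑ q ∈ w.zerosFinset a, q - w.zerosFrom a * w.charge +
      ∑ i ∈ Finset.range (w.zerosFrom a), ((i : ℤ) + 1) := by
  classical
  have h1 : w.inversions.card = ∑ q ∈ w.zerosFinset a, w.onesBefore q := by
    have := prod_inversions (M := Multiplicative ℕ) w h (fun _ _ => Multiplicative.ofAdd 1)
    rw [Finset.card_eq_sum_ones]
    refine (show ∑ x ∈ w.inversions, 1 = ∑ q ∈ w.zerosFinset a,
      ∑ p ∈ (Finset.Ico a q).filter (· ∉ w.zeros), 1 from this).trans ?_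
    refine Finset.sum_congr rfl fun q _ => ?_
    rw [← Finset.card_eq_sum_ones, onesBefore, ← Set.ncard_coe_finset]
    congr 1
    ext p
    simp only [Finset.coe_filter, Finset.mem_Ico, Set.mem_ofPred_eq]
    refine ⟨fun hp => ⟨hp.1.2, hp.2⟩, fun hp => ⟨⟨?_, hp.1⟩, hp.2⟩⟩
    by_contra hcon
    exact hp.2 (h p (by omega))
  have h2 : ∑ q ∈ w.zerosFinset a, (w.zerosFrom q : ℤ) =
      ∑ i ∈ Finset.range (w.zerosFrom a), ((i : ℤ) + 1) := by
    refine Finset.sum_bij (fun q _ => w.zerosFrom (q + 1)) ?_ ?_ ?_ ?_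
    · intro q hq
      rw [mem_zerosFinset] at hq
      rw [Finset.mem_range, zerosFrom_succ_lt_iff hq.2]
      exact hq.1
    · intro q hq q' hq' heq
      rw [mem_zerosFinset] at hq hq'
      have h1 := zerosFrom_succ_lt_iff (w := w) (p := q') hq.2
      have h2 := zerosFrom_succ_lt_iff (w := w) (p := q) hq'.2
      rw [zerosFrom_of_mem hq'.2] at h1
      rw [zerosFrom_of_mem hq.2] at h2
      omega
    · intro i hi
      obtain ⟨q, hq, rfl⟩ := w.exists_zero_of_index i
      rw [Finset.mem_range, zerosFrom_succ_lt_iff hq] at hi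
      exact ⟨q, mem_zerosFinset.mpr ⟨hi, hq⟩, rfl⟩
    · intro q hq
      rw [mem_zerosFinset] at hq
      rw [zerosFrom_of_mem hq.2]
      push_cast
      ring
  have h3 : ∀ q : ℤ, (w.onesBefore q : ℤ) = q - w.charge + w.zerosFrom q := fun q => by
    have := w.onesBefore_sub_zerosFrom q
    linarith
  rw [h1, Nat.cast_sum, Finset.sum_congr rfl fun q _ => h3 q, Finset.sum_add_distrib,
    Finset.sum_sub_distrib, h2, Finset.sum_const, card_zerosFinset]
  simp

theorem mem_residue {w : EdgeWord} {t : ℕ} [NeZero t] {k p : ℤ} :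
    p ∈ (w.residue t k).zeros ↔ (t : ℤ) * p + k ∈ w.zeros := Iff.rfl

theorem residue_begins {w : EdgeWord} {t : ℕ} [NeZero t] {m : ℤ}
    (h : ∀ p < t * m, p ∈ w.zeros) {k : ℕ} (hk : k < t) : ∀ p < m, p ∈ (w.residue t k).zeros := by
  intro p hp
  refine h _ ?_
  have : (t : ℤ) * (p + 1) ≤ t * m := mul_le_mul_of_nonneg_left (by omega) (by positivity)
  rw [mul_add] at this
  omega

/-- A sum over letters `0` splits into the sums over the residue classes. -/
theorem sum_zerosFinset (w : EdgeWord) (t : ℕ) [NeZero t] (m : ℤ) (f : ℤ → ℤ) :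
    ∑ q ∈ w.zerosFinset (t * m), f q =
      ∑ k ∈ Finset.range t, ∑ p ∈ (w.residue t k).zerosFinset m, f (t * p + k) := by
  have ht : (0 : ℤ) < t := by exact_mod_cast Nat.pos_of_ne_zero (NeZero.ne t)
  rw [Finset.sum_sigma']
  symm
  refine Finset.sum_bij' (fun x _ => (t : ℤ) * x.2 + x.1)
    (fun q _ => (⟨(q % t).toNat, q / t⟩ : Σ _ : ℕ, ℤ)) ?_ ?_ ?_ ?_ ?_
  · rintro ⟨k, p⟩ hx
    simp only [Finset.mem_sigma, Finset.mem_range, mem_zerosFinset] at hx ⊢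
    refine ⟨?_, hx.2.2⟩
    have := mul_le_mul_of_nonneg_left hx.2.1 ht.le
    omega
  · intro q hq
    rw [mem_zerosFinset] at hq
    have h1 := Int.emod_nonneg q ht.ne'
    have h2 := Int.emod_lt_of_pos q ht
    simp only [Finset.mem_sigma, Finset.mem_range, mem_zerosFinset, mem_residue]
    refine ⟨by omega, ?_, ?_⟩
    · exact Int.le_ediv_of_mul_le ht (by linarith [mul_comm (t : ℤ) m])
    · rw [Int.toNat_of_nonneg h1, Int.mul_ediv_add_emod]
      exact hq.2
  · rintro ⟨k, p⟩ hx
    simp only [Finset.mem_sigma, Finset.mem_range] at hx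
    have h1 : ((t : ℤ) * p + k) % t = k := by
      rw [Int.mul_add_emod_self_left, Int.emod_eq_of_lt (by omega) (by omega)]
    have h2 : ((t : ℤ) * p + k) / t = p := by
      rw [Int.mul_add_ediv_left _ _ ht.ne', Int.ediv_eq_zero_of_lt (by omega) (by omega), add_zero]
    simp only [h1, h2, Int.toNat_natCast]
  · intro q hq
    have h1 := Int.emod_nonneg q ht.ne'
    simp only [Int.toNat_of_nonneg h1, Int.mul_ediv_add_emod]
  · intro _ _
    rfl

theorem exists_common_begins (w w' : EdgeWord) (t : ℕ) [NeZero t] :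
    ∃ m : ℤ, (∀ p < t * m, p ∈ w.zeros) ∧ ∀ p < t * m, p ∈ w'.zeros := by
  obtain ⟨a, ha⟩ := w.begins
  obtain ⟨b, hb⟩ := w'.begins
  have ht : (1 : ℤ) ≤ t := by exact_mod_cast NeZero.one_le
  refine ⟨-(|a| + |b|), ?_⟩
  have h1 : (t : ℤ) * (-(|a| + |b|)) ≤ -(|a| + |b|) := by
    nlinarith [abs_nonneg a, abs_nonneg b]
  have := neg_abs_le a
  have := neg_abs_le b
  have := abs_nonneg a
  have := abs_nonneg b
  exact ⟨fun p hp => ha p (by omega), fun p hp => hb p (by omega)⟩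

theorem sum_charge_residue (w : EdgeWord) (t : ℕ) [NeZero t] :
    ∑ k ∈ Finset.range t, (w.residue t k).charge = w.charge := by
  obtain ⟨m, hm, -⟩ := exists_common_begins w w t
  have h1 := sum_zerosFinset w t m (fun _ => 1)
  simp only [Finset.sum_const, card_zerosFinset, nsmul_eq_mul, mul_one] at h1
  rw [zerosFrom_eq_charge_sub hm, Finset.sum_congr rfl fun k hk =>
    zerosFrom_eq_charge_sub (residue_begins hm (Finset.mem_range.mp hk))] at h1
  simp only [Finset.sum_sub_distrib, Finset.sum_const, Finset.card_range, nsmul_eq_mul] at h1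
  linarith

/-- Words whose residues have the same charges: their sizes differ by `t` times the difference of
the total sizes of their residues. -/
theorem card_diagram_sub {w w' : EdgeWord} {t : ℕ} [NeZero t]
    (h : ∀ k < t, (w.residue t k).charge = (w'.residue t k).charge) :
    (w.diagram.card : ℤ) - w'.diagram.card =
      t * ∑ k ∈ Finset.range t,
        (((w.residue t k).diagram.card : ℤ) - (w'.residue t k).diagram.card) := by
  obtain ⟨m, hm, hm'⟩ := exists_common_begins w w' t
  have hc : w.charge = w'.charge := by
    rw [← sum_charge_residue w t, ← sum_charge_residue w' t]
    exact Finset.sum_congr rfl fun k hk => h k (Finset.mem_range.mp hk)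
  have hz : w.zerosFrom (t * m) = w'.zerosFrom (t * m) := by
    have h1 := zerosFrom_eq_charge_sub hm
    have h2 := zerosFrom_eq_charge_sub hm'
    omega
  simp only [card_diagram]
  rw [card_inversions w hm, card_inversions w' hm', hz, hc,
    sum_zerosFinset w t m (fun q => q), sum_zerosFinset w' t m (fun q => q), Finset.mul_sum]
  have : ∀ k ∈ Finset.range t,
      (t : ℤ) * (((w.residue t k).inversions.card : ℤ) - (w'.residue t k).inversions.card) =
      ∑ p ∈ (w.residue t k).zerosFinset m, ((t : ℤ) * p + k) -
      ∑ p ∈ (w'.residue t k).zerosFinset m, ((t : ℤ) * p + k) := by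
    intro k hk
    have hk' := Finset.mem_range.mp hk
    have hzk : (w.residue t k).zerosFrom m = (w'.residue t k).zerosFrom m := by
      have h1 := zerosFrom_eq_charge_sub (residue_begins hm hk')
      have h2 := zerosFrom_eq_charge_sub (residue_begins hm' hk')
      have h3 := h k hk'
      omega
    rw [card_inversions _ (residue_begins hm hk'), card_inversions _ (residue_begins hm' hk'),
      hzk, h k hk']
    simp only [Finset.sum_add_distrib, Finset.sum_const, card_zerosFinset, hzk]
    rw [← Finset.mul_sum, ← Finset.mul_sum]
    ring
  rw [Finset.sum_congr rfl this, Finset.sum_sub_distrib]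
  ring

theorem mem_residue_coreWord {w : EdgeWord} {t : ℕ} [NeZero t] {k : ℕ} (hk : k < t) {p : ℤ} :
    p ∈ ((w.coreWord t).residue t k).zeros ↔ p < (w.residue t k).charge := by
  have ht : (0 : ℤ) < t := by omega
  have h1 : ((t : ℤ) * p + k) % t = k := by
    rw [Int.mul_add_emod_self_left, Int.emod_eq_of_lt (by omega) (by omega)]
  have h2 : ((t : ℤ) * p + k) / t = p := by
    rw [Int.mul_add_ediv_left _ _ ht.ne', Int.ediv_eq_zero_of_lt (by omega) (by omega), add_zero]
  rw [mem_residue]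
  simp only [coreWord, Set.mem_ofPred_eq, h1, h2]

theorem charge_residue_coreWord (w : EdgeWord) {t : ℕ} [NeZero t] {k : ℕ} (hk : k < t) :
    ((w.coreWord t).residue t k).charge = (w.residue t k).charge := by
  have h1 := zerosFrom_eq_charge_sub (w := (w.coreWord t).residue t k)
    (a := (w.residue t k).charge) fun p hp => (mem_residue_coreWord hk).2 hp
  rw [zerosFrom_eq_zero fun p hp h => by
    rw [mem_residue_coreWord hk] at h
    omega] at h1
  push_cast at h1
  linarith

theorem charge_coreWord (w : EdgeWord) (t : ℕ) [NeZero t] : (w.coreWord t).charge = w.charge := by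
  rw [← sum_charge_residue _ t, ← sum_charge_residue w t]
  exact Finset.sum_congr rfl fun k hk => charge_residue_coreWord w (Finset.mem_range.mp hk)

theorem card_diagram_residue_coreWord (w : EdgeWord) {t : ℕ} [NeZero t] {k : ℕ} (hk : k < t) :
    ((w.coreWord t).residue t k).diagram.card = 0 := by
  rw [card_diagram, Finset.card_eq_zero, Finset.eq_empty_iff_forall_notMem]
  rintro ⟨p, q⟩ hx
  simp only [mem_inversions, mem_residue_coreWord hk] at hx
  omega

/-- The core is determined by the charges of the residues. -/
theorem coreWord_eq_iff {w w' : EdgeWord} {t : ℕ} [NeZero t] :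
    w.coreWord t = w'.coreWord t ↔ ∀ k < t, (w.residue t k).charge = (w'.residue t k).charge := by
  constructor
  · intro h k hk
    rw [← charge_residue_coreWord w hk, h, charge_residue_coreWord w' hk]
  · intro h
    refine ext_zeros fun p => ?_
    have ht : (0 : ℤ) < t := by exact_mod_cast Nat.pos_of_ne_zero (NeZero.ne t)
    have h1 := Int.emod_nonneg p ht.ne'
    have h2 := Int.emod_lt_of_pos p ht
    have h3 := h (p % t).toNat (by omega)
    rw [Int.toNat_of_nonneg h1] at h3
    simp only [coreWord, Set.mem_ofPred_eq, h3]

/-- The size of a partition is the size of its core plus `t` times the size of its quotient. -/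
theorem card_diagram_eq (w : EdgeWord) (t : ℕ) [NeZero t] :
    w.diagram.card = (w.coreWord t).diagram.card +
      t * ∑ k ∈ Finset.range t, (w.residue t k).diagram.card := by
  have h := card_diagram_sub (w := w) (w' := w.coreWord t) (t := t)
    fun k hk => (charge_residue_coreWord w hk).symm
  have h2 : ∑ k ∈ Finset.range t, (((w.residue t k).diagram.card : ℤ) -
      ((w.coreWord t).residue t k).diagram.card) =
      ∑ k ∈ Finset.range t, ((w.residue t k).diagram.card : ℤ) :=
    Finset.sum_congr rfl fun k hk => by
      rw [card_diagram_residue_coreWord w (Finset.mem_range.mp hk)]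
      simp
  rw [h2] at h
  zify
  linarith

/-- The inversions of lengths divisible by `t` are the inversions of the residues. -/
theorem prod_inversions_dvd {M : Type*} [CommMonoid M] (w : EdgeWord) (t : ℕ) [NeZero t]
    (f : ℤ → M) :
    ∏ x ∈ w.inversions.filter (fun x => (t : ℤ) ∣ x.2 - x.1), f (x.2 - x.1) =
      ∏ k ∈ Finset.range t, ∏ x ∈ (w.residue t k).inversions, f (t * (x.2 - x.1)) := by
  have ht : (0 : ℤ) < t := by exact_mod_cast Nat.pos_of_ne_zero (NeZero.ne t)
  rw [Finset.prod_sigma']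
  symm
  refine Finset.prod_bij' (fun x _ => ((t : ℤ) * x.2.1 + x.1, (t : ℤ) * x.2.2 + x.1))
    (fun x _ => (⟨(x.1 % t).toNat, x.1 / t, x.2 / t⟩ : Σ _ : ℕ, ℤ × ℤ)) ?_ ?_ ?_ ?_ ?_
  · rintro ⟨k, p, q⟩ hx
    simp only [Finset.mem_sigma, Finset.mem_range, mem_inversions, mem_residue,
      Finset.mem_filter] at hx ⊢
    refine ⟨⟨hx.2.1, hx.2.2.1, ?_⟩, q - p, by ring⟩
    have := mul_lt_mul_of_pos_left hx.2.2.2 ht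
    omega
  · rintro ⟨p, q⟩ hx
    simp only [Finset.mem_sigma, Finset.mem_range, mem_inversions, mem_residue,
      Finset.mem_filter] at hx ⊢
    have h1 := Int.emod_nonneg p ht.ne'
    have h2 := Int.emod_lt_of_pos p ht
    have h3 : q % t = p % t :=
      Int.emod_eq_emod_iff_emod_sub_eq_zero.mpr (Int.emod_eq_zero_of_dvd hx.2)
    have h4 := Int.mul_ediv_add_emod p t
    have h5 := Int.mul_ediv_add_emod q t
    rw [Int.toNat_of_nonneg h1]
    refine ⟨by omega, by rw [h4]; exact hx.1.1, by rw [← h3, h5]; exact hx.1.2.1, ?_⟩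
    by_contra hcon
    have := mul_le_mul_of_nonneg_left (not_lt.mp hcon) ht.le
    omega
  · rintro ⟨k, p, q⟩ hx
    simp only [Finset.mem_sigma, Finset.mem_range] at hx
    have h1 : ∀ p : ℤ, ((t : ℤ) * p + k) % t = k := fun p => by
      rw [Int.mul_add_emod_self_left, Int.emod_eq_of_lt (by omega) (by omega)]
    have h2 : ∀ p : ℤ, ((t : ℤ) * p + k) / t = p := fun p => by
      rw [Int.mul_add_ediv_left _ _ ht.ne', Int.ediv_eq_zero_of_lt (by omega) (by omega),
        add_zero]
    simp only [h1, h2, Int.toNat_natCast]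
  · rintro ⟨p, q⟩ hx
    simp only [Finset.mem_filter] at hx
    have h1 := Int.emod_nonneg p ht.ne'
    have h3 : q % t = p % t :=
      Int.emod_eq_emod_iff_emod_sub_eq_zero.mpr (Int.emod_eq_zero_of_dvd hx.2)
    have h5 := Int.mul_ediv_add_emod q t
    rw [h3] at h5
    simp only [Int.toNat_of_nonneg h1, Int.mul_ediv_add_emod, h5]
  · rintro ⟨k, p, q⟩ hx
    congr 1
    simp only
    ring

theorem hooksMod_diagram (w : EdgeWord) (t : ℕ) :
    w.diagram.hooksMod t =
      (w.inversions.filter (fun x => (t : ℤ) ∣ x.2 - x.1)).val.map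
        fun x => (x.2 - x.1).toNat := by
  rw [YoungDiagram.hooksMod, hooks_diagram, Multiset.filter_map, Finset.filter_val]
  congr 1
  refine Multiset.filter_congr fun x hx => ?_
  have := (mem_inversions.mp hx).2.2
  simp only [Function.comp_apply]
  rw [← Int.natCast_dvd_natCast, Int.toNat_of_nonneg (by omega)]

theorem card_hooksMod_diagram (w : EdgeWord) (t : ℕ) [NeZero t] :
    (w.diagram.hooksMod t).card = ∑ k ∈ Finset.range t, (w.residue t k).diagram.card := by
  have := prod_inversions_dvd (M := Multiplicative ℕ) w t (fun _ => Multiplicative.ofAdd 1)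
  rw [hooksMod_diagram, Multiset.card_map, Finset.card_val, Finset.card_eq_sum_ones]
  refine (show _ = ∑ k ∈ Finset.range t, ∑ x ∈ (w.residue t k).inversions, 1 from this).trans ?_
  exact Finset.sum_congr rfl fun k _ => by rw [card_diagram, Finset.card_eq_sum_ones]

theorem hookProdMod_diagram (w : EdgeWord) (t : ℕ) [NeZero t] :
    w.diagram.hookProdMod t = ∏ k ∈ Finset.range t,
      (t ^ (w.residue t k).diagram.card * (w.residue t k).diagram.hookProd) := by
  zify
  have h := prod_inversions_dvd w t (fun x => x)
  rw [YoungDiagram.hookProdMod, hooksMod_diagram, ← Finset.prod_eq_multiset_prod, Nat.cast_prod]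
  refine (Finset.prod_congr rfl fun x hx => ?_).trans (h.trans ?_)
  · have := (mem_inversions.mp (Finset.mem_filter.mp hx).1).2.2
    omega
  · refine Finset.prod_congr rfl fun k _ => ?_
    rw [Finset.prod_mul_distrib, Finset.prod_const, hookProd_diagram, card_diagram]

end EdgeWord

/-! ### Words of doubled distinct partitions -/

namespace EdgeWord

/-- The words of doubled distinct partitions: the letters at `p` and `-p` are different for
`p ≠ 0`, and the letter at `0` is `1`. -/
def IsDouble (w : EdgeWord) : Prop := ∀ p, p ∈ w.zeros ↔ p ≠ 0 ∧ -p ∉ w.zeros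

theorem IsDouble.zero_notMem {w : EdgeWord} (h : w.IsDouble) : (0 : ℤ) ∉ w.zeros := fun h0 =>
  ((h 0).1 h0).1 rfl

theorem IsDouble.charge_eq_zero {w : EdgeWord} (h : w.IsDouble) : w.charge = 0 := by
  have : {p : ℤ | 0 ≤ p ∧ p ∈ w.zeros} = Neg.neg '' {p : ℤ | p < 0 ∧ p ∉ w.zeros} := by
    ext p
    simp only [Set.mem_ofPred_eq, Set.mem_image]
    constructor
    · rintro ⟨h1, h2⟩
      have := (h p).1 h2
      exact ⟨-p, ⟨by omega, this.2⟩, neg_neg p⟩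
    · rintro ⟨q, ⟨h1, h2⟩, rfl⟩
      exact ⟨by omega, (h _).2 ⟨by omega, by rwa [neg_neg]⟩⟩
  rw [charge, this, Set.ncard_image_of_injective _ neg_injective, sub_self]

theorem IsDouble.ext_pos {w w' : EdgeWord} (h : w.IsDouble) (h' : w'.IsDouble)
    (hp : ∀ p, 0 < p → (p ∈ w.zeros ↔ p ∈ w'.zeros)) : w = w' := by
  refine ext_zeros fun p => ?_
  rcases lt_trichotomy p 0 with h0 | rfl | h0
  · rw [h p, h' p, hp (-p) (by omega)]
  · exact iff_of_false h.zero_notMem h'.zero_notMem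
  · exact hp p h0

/-- The word read backwards with the letters exchanged: the word of the conjugate partition. -/
def reflect (w : EdgeWord) : EdgeWord where
  zeros := {p | -1 - p ∉ w.zeros}
  begins := by
    obtain ⟨b, hb⟩ := w.ends
    exact ⟨-b, fun p hp => hb _ (by omega)⟩
  ends := by
    obtain ⟨a, ha⟩ := w.begins
    exact ⟨-a, fun p hp => not_not.mpr (ha _ (by omega))⟩

theorem mem_reflect {w : EdgeWord} {p : ℤ} : p ∈ w.reflect.zeros ↔ -1 - p ∉ w.zeros := Iff.rfl

theorem reflect_reflect (w : EdgeWord) : w.reflect.reflect = w :=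
  ext_zeros fun p => by
    rw [mem_reflect, mem_reflect, not_not, show -1 - (-1 - p) = p by ring]

theorem charge_reflect (w : EdgeWord) : w.reflect.charge = -w.charge := by
  have key : ∀ w : EdgeWord, {p : ℤ | 0 ≤ p ∧ p ∈ w.reflect.zeros} =
      (fun p => -1 - p) '' {p : ℤ | p < 0 ∧ p ∉ w.zeros} := by
    intro w
    ext p
    simp only [Set.mem_ofPred_eq, Set.mem_image, mem_reflect]
    constructor
    · rintro ⟨h1, h2⟩
      exact ⟨-1 - p, ⟨by omega, h2⟩, by ring⟩
    · rintro ⟨q, ⟨h1, h2⟩, rfl⟩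
      exact ⟨by omega, by rwa [show -1 - (-1 - q) = q by ring]⟩
  have hinj : Function.Injective fun p : ℤ => -1 - p := fun a b h => by
    simp only at h
    omega
  have h1 := key w
  have h2 := key w.reflect
  rw [reflect_reflect] at h2
  rw [charge, charge, h1, h2, Set.ncard_image_of_injective _ hinj,
    Set.ncard_image_of_injective _ hinj]
  ring

theorem prod_inversions_reflect {M : Type*} [CommMonoid M] (w : EdgeWord) (f : ℤ → M) :
    ∏ x ∈ w.reflect.inversions, f (x.2 - x.1) = ∏ x ∈ w.inversions, f (x.2 - x.1) := by
  refine Finset.prod_bij' (fun x _ => (-1 - x.2, -1 - x.1)) (fun x _ => (-1 - x.2, -1 - x.1))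
    ?_ ?_ ?_ ?_ ?_
  · rintro ⟨p, q⟩ hx
    simp only [mem_inversions, mem_reflect, not_not] at hx ⊢
    exact ⟨hx.2.1, hx.1, by omega⟩
  · rintro ⟨p, q⟩ hx
    simp only [mem_inversions, mem_reflect, not_not] at hx ⊢
    rw [show -1 - (-1 - p) = p by ring, show -1 - (-1 - q) = q by ring]
    exact ⟨hx.2.1, hx.1, by omega⟩
  · rintro ⟨p, q⟩ _
    simp
  · rintro ⟨p, q⟩ _
    simp
  · rintro ⟨p, q⟩ _
    congr 1
    simp only
    ring

theorem hookProd_reflect (w : EdgeWord) : w.reflect.diagram.hookProd = w.diagram.hookProd := by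
  zify
  rw [hookProd_diagram, hookProd_diagram, prod_inversions_reflect w fun x => x]

theorem card_reflect (w : EdgeWord) : w.reflect.diagram.card = w.diagram.card := by
  rw [card_diagram, card_diagram, Finset.card_eq_sum_ones, Finset.card_eq_sum_ones]
  exact prod_inversions_reflect (M := Multiplicative ℕ) w fun _ => Multiplicative.ofAdd 1

theorem IsDouble.residue_zero {w : EdgeWord} (h : w.IsDouble) (t : ℕ) [NeZero t] :
    (w.residue t 0).IsDouble := by
  intro p
  rw [mem_residue, mem_residue, h]
  simp [NeZero.ne t]

theorem IsDouble.residue_sub {w : EdgeWord} (h : w.IsDouble) {t : ℕ} [NeZero t] {k : ℕ}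
    (h0 : 1 ≤ k) (hk : k < t) : w.residue t ((t - k : ℕ) : ℤ) = (w.residue t k).reflect := by
  refine ext_zeros fun p => ?_
  rw [mem_residue, mem_reflect, mem_residue, h,
    show -((t : ℤ) * p + ((t - k : ℕ) : ℤ)) = t * (-1 - p) + k by push_cast [hk.le]; ring]
  refine and_iff_right fun hcon => ?_
  have h1 : ((t : ℤ) * p + ((t - k : ℕ) : ℤ)) % t = ((t - k : ℕ) : ℤ) := by
    rw [Int.mul_add_emod_self_left, Int.emod_eq_of_lt (by omega) (by omega)]
  rw [hcon, Int.zero_emod] at h1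
  omega

theorem isDouble_of_residues {w : EdgeWord} {t : ℕ} [NeZero t] (h0 : (w.residue t 0).IsDouble)
    (h : ∀ k, 1 ≤ k → k < t → w.residue t ((t - k : ℕ) : ℤ) = (w.residue t k).reflect) :
    w.IsDouble := by
  intro p
  have ht : (0 : ℤ) < t := by exact_mod_cast Nat.pos_of_ne_zero (NeZero.ne t)
  have h1 := Int.emod_nonneg p ht.ne'
  have h2 := Int.emod_lt_of_pos p ht
  obtain ⟨k, hk⟩ := Int.eq_ofNat_of_zero_le h1
  have h3 := Int.mul_ediv_add_emod p t
  rw [hk] at h3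
  rcases Nat.eq_zero_or_pos k with rfl | hpos
  · have := h0 (p / t)
    rw [mem_residue, mem_residue, mul_neg] at this
    simp only [Int.natCast_zero, add_zero] at h3 this
    rw [h3] at this
    rw [this]
    refine and_congr_left fun _ => not_congr ⟨fun h => ?_, fun h => ?_⟩
    · rw [← h3, h, mul_zero]
    · rw [h, Int.zero_ediv]
  · have := h k hpos (by omega)
    have h4 : -1 - p / t ∈ (w.residue t ((t - k : ℕ) : ℤ)).zeros ↔
      -1 - p / t ∈ (w.residue t k).reflect.zeros := by rw [this]
    have hkt : k ≤ t := by omega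
    rw [mem_reflect, mem_residue, mem_residue, show -1 - (-1 - p / t) = p / t by ring, h3,
      show (t : ℤ) * (-1 - p / t) + ((t - k : ℕ) : ℤ) = -p by
        push_cast [hkt]; linarith] at h4
    rw [h4, not_not]
    refine (and_iff_right ?_).symm
    rintro rfl
    simp at hk
    omega

/-- The word whose residues modulo `t` are the given words. -/
def assemble (t : ℕ) [NeZero t] (W : ℕ → EdgeWord) : EdgeWord where
  zeros := {p | p / (t : ℤ) ∈ (W (p % (t : ℤ)).toNat).zeros}
  begins := by
    have ht : (0 : ℤ) < t := by exact_mod_cast Nat.pos_of_ne_zero (NeZero.ne t)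
    choose a ha using fun k => (W k).begins
    obtain ⟨M, hM⟩ := ((Finset.range t).image a).bddBelow
    refine ⟨(t : ℤ) * M, fun p hp => ha _ _ ?_⟩
    have h1 := Int.emod_lt_of_pos p ht
    have h2 : M ≤ a (p % t).toNat := hM (by
      simp only [Finset.coe_image, Set.mem_image, Finset.coe_range, Set.mem_Iio]
      exact ⟨_, by omega, rfl⟩)
    have h3 : p / (t : ℤ) < M := Int.ediv_lt_of_lt_mul ht (by linarith [mul_comm (t : ℤ) M])
    omega
  ends := by
    have ht : (0 : ℤ) < t := by exact_mod_cast Nat.pos_of_ne_zero (NeZero.ne t)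
    choose b hb using fun k => (W k).ends
    obtain ⟨M, hM⟩ := ((Finset.range t).image b).bddAbove
    refine ⟨(t : ℤ) * M, fun p hp => hb _ _ ?_⟩
    have h1 := Int.emod_lt_of_pos p ht
    have h2 : b (p % t).toNat ≤ M := hM (by
      simp only [Finset.coe_image, Set.mem_image, Finset.coe_range, Set.mem_Iio]
      exact ⟨_, by omega, rfl⟩)
    have h3 : M ≤ p / (t : ℤ) := Int.le_ediv_of_mul_le ht (by linarith [mul_comm (t : ℤ) M])
    omega

theorem residue_assemble {t : ℕ} [NeZero t] (W : ℕ → EdgeWord) {k : ℕ} (hk : k < t) :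
    (assemble t W).residue t k = W k := by
  refine ext_zeros fun p => ?_
  have ht : (0 : ℤ) < t := by omega
  have h1 : ((t : ℤ) * p + k) % t = k := by
    rw [Int.mul_add_emod_self_left, Int.emod_eq_of_lt (by omega) (by omega)]
  have h2 : ((t : ℤ) * p + k) / t = p := by
    rw [Int.mul_add_ediv_left _ _ ht.ne', Int.ediv_eq_zero_of_lt (by omega) (by omega), add_zero]
  rw [mem_residue]
  simp only [assemble, Set.mem_ofPred_eq, h1, h2, Int.toNat_natCast]

theorem eq_of_residues {w w' : EdgeWord} {t : ℕ} [NeZero t]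
    (h : ∀ k < t, w.residue t k = w'.residue t k) : w = w' := by
  refine ext_zeros fun p => ?_
  have ht : (0 : ℤ) < t := by exact_mod_cast Nat.pos_of_ne_zero (NeZero.ne t)
  have h1 := Int.emod_nonneg p ht.ne'
  have h2 := Int.emod_lt_of_pos p ht
  have h3 := h (p % t).toNat (by omega)
  have h4 : p / t ∈ (w.residue t (p % t).toNat).zeros ↔
    p / t ∈ (w'.residue t (p % t).toNat).zeros := by rw [h3]
  rwa [mem_residue, mem_residue, Int.toNat_of_nonneg h1, Int.mul_ediv_add_emod] at h4

/-- Every partition is encoded by a word of each charge. -/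
theorem exists_charge_diagram (c : ℤ) (μ : YoungDiagram) :
    ∃ w : EdgeWord, w.charge = c ∧ w.diagram = μ := by
  let w : EdgeWord :=
    { zeros := {p | p - c ∈ μ.edgeWord.zeros}
      begins := by
        obtain ⟨a, ha⟩ := μ.edgeWord.begins
        exact ⟨a + c, fun p hp => ha _ (by omega)⟩
      ends := by
        obtain ⟨b, hb⟩ := μ.edgeWord.ends
        exact ⟨b + c, fun p hp => hb _ (by omega)⟩ }
  have ho : ∀ q, w.onesBefore (q + c) = μ.edgeWord.onesBefore q := fun q => by
    have : {p : ℤ | p < q + c ∧ p ∉ w.zeros} =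
        (fun p => p + c) '' {p : ℤ | p < q ∧ p ∉ μ.edgeWord.zeros} := by
      ext p
      simp only [Set.mem_ofPred_eq, Set.mem_image, w]
      constructor
      · rintro ⟨h1, h2⟩
        exact ⟨p - c, ⟨by omega, h2⟩, by ring⟩
      · rintro ⟨q, ⟨h1, h2⟩, rfl⟩
        exact ⟨by omega, by rwa [add_sub_cancel_right]⟩
    rw [onesBefore, this, Set.ncard_image_of_injective _ (add_left_injective c), onesBefore]
  have hz : ∀ q, w.zerosFrom (q + c) = μ.edgeWord.zerosFrom q := fun q => by
    have : {p : ℤ | q + c ≤ p ∧ p ∈ w.zeros} =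
        (fun p => p + c) '' {p : ℤ | q ≤ p ∧ p ∈ μ.edgeWord.zeros} := by
      ext p
      simp only [Set.mem_ofPred_eq, Set.mem_image, w]
      constructor
      · rintro ⟨h1, h2⟩
        exact ⟨p - c, ⟨by omega, h2⟩, by ring⟩
      · rintro ⟨q, ⟨h1, h2⟩, rfl⟩
        exact ⟨by omega, by rwa [add_sub_cancel_right]⟩
    rw [zerosFrom, this, Set.ncard_image_of_injective _ (add_left_injective c), zerosFrom]
  refine ⟨w, ?_, YoungDiagram.ext_rowLen fun i => ?_⟩
  · have h1 := w.onesBefore_sub_zerosFrom (0 + c)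
    have h2 := μ.edgeWord.onesBefore_sub_zerosFrom 0
    rw [ho, hz] at h1
    rw [μ.charge_edgeWord] at h2
    omega
  · obtain ⟨q, hq, hi⟩ := μ.edgeWord.exists_zero_of_index i
    have hq' : q + c ∈ w.zeros := by
      simp only [w, Set.mem_ofPred_eq, add_sub_cancel_right]
      exact hq
    have h1 := rowLen_diagram hq'
    have h2 := rowLen_diagram hq
    rw [show q + c + 1 = q + 1 + c by ring, hz, ho, hi] at h1
    rw [hi, YoungDiagram.diagram_edgeWord] at h2
    rw [h1, h2]

end EdgeWord

namespace YoungDiagram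

/-- The letters `1` are the horizontal edges below the columns. -/
theorem notMem_edgeWord_iff {μ : YoungDiagram} {p : ℤ} :
    p ∉ μ.edgeWord.zeros ↔ ∃ j : ℕ, p = (j : ℤ) - μ.colLen j := by
  have key : ∀ p ∉ μ.edgeWord.zeros, p = (μ.edgeWord.onesBefore p : ℤ) -
      μ.colLen (μ.edgeWord.onesBefore p) := fun p hp => by
    have h1 := EdgeWord.colLen_diagram hp
    rw [diagram_edgeWord] at h1
    rw [h1, EdgeWord.onesBefore_sub_zerosFrom, charge_edgeWord, sub_zero]
  constructor
  · exact fun hp => ⟨_, key p hp⟩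
  · rintro ⟨j, hj⟩
    obtain ⟨p', hp', rfl⟩ := μ.edgeWord.exists_one_of_index j
    rwa [hj, ← key p' hp']

theorem mem_halve_parts {μ : YoungDiagram} {x : ℕ} :
    x ∈ μ.halve.parts ↔ 0 < x ∧ (x : ℤ) ∈ μ.edgeWord.zeros := by
  simp only [halve, List.mem_filter, List.mem_map, List.mem_range, decide_eq_true_eq, edgeWord,
    Set.mem_ofPred_eq]
  constructor
  · rintro ⟨⟨i, hi, rfl⟩, h⟩
    exact ⟨h, i, by omega⟩
  · rintro ⟨h, i, hi⟩
    refine ⟨⟨i, ?_, by omega⟩, h⟩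
    by_contra hcon
    rw [rowLen_eq_zero (not_lt.mp hcon)] at hi
    omega

end YoungDiagram

namespace StrictPartition

theorem mem_parts_iff {s : StrictPartition} {x : ℕ} :
    x ∈ s.parts ↔ 0 < x ∧ ∃ i, s.part i = x := by
  constructor
  · intro hx
    refine ⟨s.pos x hx, ?_⟩
    obtain ⟨i, hi, rfl⟩ := List.getElem_of_mem hx
    exact ⟨i, List.getD_eq_getElem _ _ hi⟩
  · rintro ⟨h, i, rfl⟩
    have hi : i < s.parts.length := by
      by_contra hcon
      rw [s.part_eq_zero (i := i) (not_lt.mp hcon)] at h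
      exact lt_irrefl _ h
    rw [part, List.getD_eq_getElem _ _ hi]
    exact List.getElem_mem hi

theorem mem_double {s : StrictPartition} {i j : ℕ} :
    (i, j) ∈ s.double ↔ (i < j ∧ j ≤ i + s.part i) ∨ (j ≤ i ∧ i < j + s.part j) := by
  rw [← YoungDiagram.mem_cells]
  simp only [double, Finset.mem_union, mem_shiftedCells, mem_addedCells]

theorem rowLen_double {s : StrictPartition} {i : ℕ} (h : 0 < s.part i) :
    s.double.rowLen i = i + s.part i + 1 := by
  have h1 := YoungDiagram.mem_iff_lt_rowLen (μ := s.double) (i := i) (j := i + s.part i)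
  have h2 := YoungDiagram.mem_iff_lt_rowLen (μ := s.double) (i := i) (j := i + s.part i + 1)
  rw [mem_double] at h1 h2
  omega

theorem colLen_double {s : StrictPartition} {j : ℕ} (h : 0 < s.part j) :
    s.double.colLen j = j + s.part j := by
  have h1 := YoungDiagram.mem_iff_lt_colLen (μ := s.double) (i := j + s.part j - 1) (j := j)
  have h2 := YoungDiagram.mem_iff_lt_colLen (μ := s.double) (i := j + s.part j) (j := j)
  rw [mem_double] at h1 h2
  omega

theorem mem_edgeWord_double {s : StrictPartition} {p : ℤ} (hp : 0 < p) :
    p ∈ s.double.edgeWord.zeros ↔ ∃ i, (s.part i : ℤ) = p := by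
  constructor
  · rintro ⟨i, hi⟩
    have h1 : (i, i) ∈ s.double := YoungDiagram.mem_iff_lt_rowLen.mpr (by omega)
    rw [mem_double] at h1
    have h2 : 0 < s.part i := by omega
    rw [rowLen_double h2] at hi
    exact ⟨i, by push_cast at hi; linarith⟩
  · rintro ⟨i, rfl⟩
    refine ⟨i, ?_⟩
    rw [rowLen_double (by omega)]
    push_cast
    ring

theorem isDouble_edgeWord_double (s : StrictPartition) : s.double.edgeWord.IsDouble := by
  have h0 : (0 : ℤ) ∉ s.double.edgeWord.zeros := by
    rintro ⟨i, hi⟩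
    have h1 : (i, i) ∈ s.double := YoungDiagram.mem_iff_lt_rowLen.mpr (by omega)
    rw [mem_double] at h1
    have h2 : 0 < s.part i := by omega
    rw [rowLen_double h2] at hi
    omega
  have key : ∀ p : ℤ, 0 < p → (p ∈ s.double.edgeWord.zeros ↔ -p ∉ s.double.edgeWord.zeros) := by
    intro p hp
    rw [mem_edgeWord_double hp, YoungDiagram.notMem_edgeWord_iff]
    constructor
    · rintro ⟨i, rfl⟩
      refine ⟨i, ?_⟩
      rw [colLen_double (by omega)]
      push_cast
      ring
    · rintro ⟨j, hj⟩
      have h1 : (j, j) ∈ s.double := YoungDiagram.mem_iff_lt_colLen.mpr (by omega)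
      rw [mem_double] at h1
      have h2 : 0 < s.part j := by omega
      rw [colLen_double h2] at hj
      exact ⟨j, by push_cast at hj; linarith⟩
  intro p
  rcases lt_trichotomy p 0 with h | rfl | h
  · have := key (-p) (by omega)
    rw [neg_neg] at this
    rw [this, not_not]
    exact (and_iff_right h.ne).symm
  · exact iff_of_false h0 fun h => h.1 rfl
  · rw [key p h]
    exact (and_iff_right h.ne').symm

theorem mem_parts_iff_edgeWord {s : StrictPartition} {x : ℕ} :
    x ∈ s.parts ↔ 0 < x ∧ (x : ℤ) ∈ s.double.edgeWord.zeros := by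
  rw [mem_parts_iff]
  refine and_congr_right fun h => ?_
  rw [mem_edgeWord_double (by omega)]
  simp

/-- Every word symmetric in the sense of `IsDouble` encodes a doubled distinct partition. -/
theorem double_halve {w : EdgeWord} (h : w.IsDouble) : w.diagram.halve.double = w.diagram := by
  have hw := EdgeWord.edgeWord_diagram h.charge_eq_zero
  refine YoungDiagram.edgeWord_injective ?_
  rw [hw]
  refine (isDouble_edgeWord_double _).ext_pos h fun p hp => ?_
  obtain ⟨x, rfl⟩ := Int.eq_ofNat_of_zero_le hp.le
  have h1 := mem_parts_iff_edgeWord (s := w.diagram.halve) (x := x)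
  rw [YoungDiagram.mem_halve_parts, hw] at h1
  have hx : 0 < x := by omega
  simpa [hx] using h1.symm

end StrictPartition

namespace DoubledDistinct

theorem isDouble_edgeWord (lam : DoubledDistinct) : lam.diagram.edgeWord.IsDouble := by
  obtain ⟨μ, s, rfl⟩ := lam
  exact s.isDouble_edgeWord_double

theorem diagram_injective : Function.Injective diagram := Subtype.val_injective

/-- The doubled distinct partition encoded by a symmetric word. -/
noncomputable def ofWord (w : EdgeWord) (h : w.IsDouble) : DoubledDistinct :=
  ⟨w.diagram, _, StrictPartition.double_halve h⟩

theorem edgeWord_ofWord {w : EdgeWord} (h : w.IsDouble) : (ofWord w h).diagram.edgeWord = w :=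
  EdgeWord.edgeWord_diagram h.charge_eq_zero

theorem littlewoodQuotient_zero (t : ℕ) [NeZero t] (lam : DoubledDistinct) :
    lam.diagram.littlewoodQuotient t 0 = (lam.bar0 t).double := by
  have h := lam.isDouble_edgeWord.residue_zero t
  have := StrictPartition.double_halve h
  rw [bar0, YoungDiagram.littlewoodQuotient, Nat.cast_zero, this]

theorem littlewoodCore_eq_iff {t : ℕ} [NeZero t] {μ ν : YoungDiagram} :
    μ.littlewoodCore t = ν.littlewoodCore t ↔
      ∀ k < t, (μ.edgeWord.residue t k).charge = (ν.edgeWord.residue t k).charge := by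
  rw [← EdgeWord.coreWord_eq_iff]
  constructor
  · exact EdgeWord.eq_of_charge_eq_of_diagram_eq (by
      rw [EdgeWord.charge_coreWord, EdgeWord.charge_coreWord, YoungDiagram.charge_edgeWord,
        YoungDiagram.charge_edgeWord])
  · intro h
    rw [YoungDiagram.littlewoodCore, YoungDiagram.littlewoodCore, h]

/-- A doubled distinct partition is determined by its core, its strict partition `λ̄⁰` and half of
the other components of its quotient. -/
theorem eq_of_components {t : ℕ} [NeZero t] (ht : Odd t) {lam mu : DoubledDistinct}
    (hc : lam.diagram.littlewoodCore t = mu.diagram.littlewoodCore t)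
    (h0 : lam.bar0 t = mu.bar0 t)
    (h : ∀ i ∈ Finset.Icc 1 (t / 2),
      lam.diagram.littlewoodQuotient t i = mu.diagram.littlewoodQuotient t i) : lam = mu := by
  rw [littlewoodCore_eq_iff] at hc
  have h1 : ∀ k, 1 ≤ k → k ≤ t / 2 →
      lam.diagram.edgeWord.residue t k = mu.diagram.edgeWord.residue t k := fun k hk hk' =>
    EdgeWord.eq_of_charge_eq_of_diagram_eq (hc k (by omega))
      (h k (Finset.mem_Icc.mpr ⟨hk, hk'⟩))
  refine diagram_injective (YoungDiagram.edgeWord_injective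
    (EdgeWord.eq_of_residues (t := t) fun k hk => ?_))
  rcases Nat.eq_zero_or_pos k with rfl | hpos
  · refine EdgeWord.eq_of_charge_eq_of_diagram_eq (hc 0 hk) ?_
    have h2 := littlewoodQuotient_zero t lam
    rw [h0, ← littlewoodQuotient_zero t mu] at h2
    exact h2
  · by_cases hk' : k ≤ t / 2
    · exact h1 k hpos hk'
    · obtain ⟨m, rfl⟩ := ht
      have h2 := lam.isDouble_edgeWord.residue_sub (t := 2 * m + 1) (k := 2 * m + 1 - k)
        (by omega) (by omega)
      have h3 := mu.isDouble_edgeWord.residue_sub (t := 2 * m + 1) (k := 2 * m + 1 - k)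
        (by omega) (by omega)
      rw [show 2 * m + 1 - (2 * m + 1 - k) = k by omega] at h2 h3
      rw [h2, h3, h1 (2 * m + 1 - k) (by omega) (by omega)]

/-- The core, the strict partition `λ̄⁰` and half of the other components of the quotient can be
prescribed arbitrarily. -/
theorem exists_of_components {t : ℕ} [NeZero t] (ht : Odd t) (mu : DoubledDistinct)
    (s : StrictPartition) (f : ℕ → YoungDiagram) :
    ∃ lam : DoubledDistinct, lam.diagram.littlewoodCore t = mu.diagram.littlewoodCore t ∧
      lam.bar0 t = s ∧
      ∀ i ∈ Finset.Icc 1 (t / 2), lam.diagram.littlewoodQuotient t i = f i := by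
  obtain ⟨m, hm⟩ := ht
  choose V hV1 hV2 using fun k : ℕ =>
    EdgeWord.exists_charge_diagram (mu.diagram.edgeWord.residue t k).charge (f k)
  let W : ℕ → EdgeWord := fun k => if k = 0 then s.double.edgeWord else
    if k ≤ t / 2 then V k else (V (t - k)).reflect
  have hW0 : W 0 = s.double.edgeWord := if_pos rfl
  have hW1 : ∀ k, 1 ≤ k → k ≤ t / 2 → W k = V k := fun k h1 h2 => by
    simp only [W, if_neg (show k ≠ 0 by omega), if_pos h2]
  have hW2 : ∀ k, t / 2 < k → k < t → W k = (V (t - k)).reflect := fun k h1 h2 => by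
    simp only [W, if_neg (show k ≠ 0 by omega), if_neg (show ¬ k ≤ t / 2 by omega)]
  have hres : ∀ k, k < t → (EdgeWord.assemble t W).residue t k = W k :=
    fun k hk => EdgeWord.residue_assemble W hk
  have hres0 : (EdgeWord.assemble t W).residue t 0 = s.double.edgeWord := by
    have := hres 0 (by omega)
    rwa [Nat.cast_zero, hW0] at this
  have hd : (EdgeWord.assemble t W).IsDouble := by
    refine EdgeWord.isDouble_of_residues (t := t) ?_ fun k h1 h2 => ?_
    · rw [hres0]
      exact s.isDouble_edgeWord_double
    · rw [hres _ (by omega), hres _ h2]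
      by_cases hk : k ≤ t / 2
      · rw [hW1 k h1 hk, hW2 (t - k) (by omega) (by omega), show t - (t - k) = k by omega]
      · rw [hW2 k (by omega) h2, hW1 (t - k) (by omega) (by omega), EdgeWord.reflect_reflect]
  refine ⟨ofWord _ hd, ?_, ?_, ?_⟩
  · rw [littlewoodCore_eq_iff, edgeWord_ofWord]
    intro k hk
    rw [hres k hk]
    rcases Nat.eq_zero_or_pos k with rfl | hpos
    · rw [hW0, YoungDiagram.charge_edgeWord, Nat.cast_zero,
        (mu.isDouble_edgeWord.residue_zero t).charge_eq_zero]
    · by_cases hk' : k ≤ t / 2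
      · rw [hW1 k hpos hk', hV1]
      · rw [hW2 k (by omega) hk, EdgeWord.charge_reflect, hV1,
          ← EdgeWord.charge_reflect, ← mu.isDouble_edgeWord.residue_sub (by omega) (by omega),
          show t - (t - k) = k by omega]
  · rw [bar0, YoungDiagram.littlewoodQuotient, edgeWord_ofWord, Nat.cast_zero, hres0,
      YoungDiagram.diagram_edgeWord, StrictPartition.halve_double]
  · intro i hi
    rw [Finset.mem_Icc] at hi
    rw [YoungDiagram.littlewoodQuotient, edgeWord_ofWord, hres i (by omega), hW1 i hi.1 hi.2, hV2]

end DoubledDistinct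

/-! ### Partial fractions -/

section PartialFractions

variable {ι : Type*} [DecidableEq ι]

/-- The residue at `x i` of the rational function `∏ j, (z - y j) / (z - x j)`. -/
def ratResidue (S : Finset ι) (x y : ι → ℚ) (i : ι) : ℚ :=
  (x i - y i) * ∏ j ∈ S.erase i, (x i - y j) / (x i - x j)

theorem ratResidue_insert_of_mem {S : Finset ι} {x y : ι → ℚ} {c i : ι} (hc : c ∉ S)
    (hi : i ∈ S) :
    ratResidue (insert c S) x y i = ratResidue S x y i * ((x i - y c) / (x i - x c)) := by
  have hne : c ≠ i := by rintro rfl; exact hc hi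
  rw [ratResidue, ratResidue, Finset.erase_insert_of_ne hne,
    Finset.prod_insert fun h => hc (Finset.mem_of_mem_erase h)]
  ring

theorem ratResidue_insert_self {S : Finset ι} {x y : ι → ℚ} {c : ι} (hc : c ∉ S) :
    ratResidue (insert c S) x y c = (x c - y c) * ∏ j ∈ S, (x c - y j) / (x c - x j) := by
  rw [ratResidue, Finset.erase_insert hc]

/-- Partial fraction decomposition. -/
theorem prod_div_eq_one_add_sum (S : Finset ι) (x y : ι → ℚ) (hx : Set.InjOn x S) (z : ℚ)
    (hz : ∀ i ∈ S, z ≠ x i) :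
    ∏ i ∈ S, (z - y i) / (z - x i) = 1 + ∑ i ∈ S, ratResidue S x y i / (z - x i) := by
  induction S using Finset.induction_on generalizing z with
  | empty => simp
  | insert c S hc ih =>
    have hx' : Set.InjOn x S := hx.mono (by simp)
    have hcx : ∀ i ∈ S, x c ≠ x i := fun i hi h =>
      hc (hx (by simp) (by simp [hi]) h ▸ hi)
    have hzc : z - x c ≠ 0 := sub_ne_zero.mpr (hz c (by simp))
    have h1 := ih hx' z fun i hi => hz i (by simp [hi])
    have h2 := ih hx' (x c) hcx
    rw [Finset.prod_insert hc, Finset.sum_insert hc, ratResidue_insert_self hc, h1, h2]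
    have h3 : ∑ i ∈ S, ratResidue (insert c S) x y i / (z - x i) =
        (z - y c) / (z - x c) * ∑ i ∈ S, ratResidue S x y i / (z - x i) -
          (x c - y c) / (z - x c) * ∑ i ∈ S, ratResidue S x y i / (x c - x i) := by
      rw [Finset.mul_sum, Finset.mul_sum, ← Finset.sum_sub_distrib]
      refine Finset.sum_congr rfl fun i hi => ?_
      have ha : z - x i ≠ 0 := sub_ne_zero.mpr (hz i (by simp [hi]))
      have hb : x c - x i ≠ 0 := sub_ne_zero.mpr (hcx i hi)
      have hb' : x i - x c ≠ 0 := sub_ne_zero.mpr (hcx i hi).symm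
      rw [ratResidue_insert_of_mem hc hi, ← neg_sub (x c) (x i)]
      field_simp
      ring
    rw [h3]
    field_simp
    ring

/-- The coefficients of `1 / z` at infinity in the partial fraction decomposition. -/
theorem sum_ratResidue (S : Finset ι) (x y : ι → ℚ) (hx : Set.InjOn x S) :
    ∑ i ∈ S, ratResidue S x y i = ∑ i ∈ S, (x i - y i) := by
  induction S using Finset.induction_on with
  | empty => simp
  | insert c S hc ih =>
    have hx' : Set.InjOn x S := hx.mono (by simp)
    have hcx : ∀ i ∈ S, x c ≠ x i := fun i hi h =>
      hc (hx (by simp) (by simp [hi]) h ▸ hi)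
    rw [Finset.sum_insert hc, Finset.sum_insert hc, ratResidue_insert_self hc, ← ih hx',
      prod_div_eq_one_add_sum S x y hx' (x c) hcx]
    have h3 : ∑ i ∈ S, ratResidue (insert c S) x y i = ∑ i ∈ S, ratResidue S x y i -
        (x c - y c) * ∑ i ∈ S, ratResidue S x y i / (x c - x i) := by
      rw [Finset.mul_sum, ← Finset.sum_sub_distrib]
      refine Finset.sum_congr rfl fun i hi => ?_
      have hb : x c - x i ≠ 0 := sub_ne_zero.mpr (hcx i hi)
      rw [ratResidue_insert_of_mem hc hi, ← neg_sub (x c) (x i)]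
      field_simp
      ring
    rw [h3]
    ring

/-- The coefficients of `1 / z ^ 2` at infinity in the partial fraction decomposition. -/
theorem sum_ratResidue_mul (S : Finset ι) (x y : ι → ℚ) (hx : Set.InjOn x S) :
    2 * ∑ i ∈ S, ratResidue S x y i * x i =
      (∑ i ∈ S, (x i - y i)) ^ 2 + ∑ i ∈ S, (x i ^ 2 - y i ^ 2) := by
  induction S using Finset.induction_on with
  | empty => simp
  | insert c S hc ih =>
    have hx' : Set.InjOn x S := hx.mono (by simp)
    have hcx : ∀ i ∈ S, x c ≠ x i := fun i hi h =>
      hc (hx (by simp) (by simp [hi]) h ▸ hi)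
    have h0 := sum_ratResidue S x y hx'
    rw [Finset.sum_insert hc, Finset.sum_insert hc, Finset.sum_insert hc,
      ratResidue_insert_self hc, prod_div_eq_one_add_sum S x y hx' (x c) hcx]
    have h3 : ∑ i ∈ S, ratResidue (insert c S) x y i * x i =
        ∑ i ∈ S, ratResidue S x y i * x i + (x c - y c) * ∑ i ∈ S, ratResidue S x y i -
        (x c - y c) * x c * ∑ i ∈ S, ratResidue S x y i / (x c - x i) := by
      rw [Finset.mul_sum, Finset.mul_sum, ← Finset.sum_add_distrib, ← Finset.sum_sub_distrib]
      refine Finset.sum_congr rfl fun i hi => ?_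
      have hb : x c - x i ≠ 0 := sub_ne_zero.mpr (hcx i hi)
      rw [ratResidue_insert_of_mem hc hi, ← neg_sub (x c) (x i)]
      field_simp
      ring
    rw [h3, h0]
    linear_combination ih hx'

end PartialFractions

/-! ### Products over pairs in a finite set -/

/-- The product of `u x` over the elements of `B` and of `ψ x c` over the pairs `c < x` of elements
of `B`. -/
def pairWeight (u : ℕ → ℚ) (ψ : ℕ → ℕ → ℚ) (B : Finset ℕ) : ℚ :=
  ∏ x ∈ B, (u x * ∏ c ∈ B.filter (· < x), ψ x c)

/-- By symmetry of `ψ`, a new element interacts with all the others in the same way, whatever their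
order. -/
theorem pairWeight_insert (u : ℕ → ℚ) {ψ : ℕ → ℕ → ℚ} (hψ : ∀ x c, ψ x c = ψ c x)
    {R : Finset ℕ} {x : ℕ} (hx : x ∉ R) :
    pairWeight u ψ (insert x R) = u x * (∏ c ∈ R, ψ x c) * pairWeight u ψ R := by
  have h1 : (insert x R).filter (· < x) = R.filter (· < x) := by
    rw [Finset.filter_insert, if_neg (lt_irrefl x)]
  have h2 : ∀ y ∈ R, u y * ∏ c ∈ (insert x R).filter (· < y), ψ y c =
      (if x < y then ψ x y else 1) * (u y * ∏ c ∈ R.filter (· < y), ψ y c) := by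
    intro y hy
    rw [Finset.filter_insert]
    split_ifs with h
    · rw [Finset.prod_insert fun h' => hx (Finset.mem_of_mem_filter _ h'), hψ y x]
      ring
    · ring
  have h3 : (∏ c ∈ R.filter (· < x), ψ x c) * ∏ y ∈ R, (if x < y then ψ x y else 1) =
      ∏ c ∈ R, ψ x c := by
    rw [Finset.prod_filter, ← Finset.prod_mul_distrib]
    refine Finset.prod_congr rfl fun c hc => ?_
    have : c ≠ x := by rintro rfl; exact hx hc
    rcases lt_or_gt_of_ne this with h | h
    · rw [if_pos h, if_neg h.not_gt, mul_one]
    · rw [if_neg h.not_gt, if_pos h, one_mul]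
  rw [pairWeight, Finset.prod_insert hx, h1, Finset.prod_congr rfl h2, Finset.prod_mul_distrib,
    ← h3, pairWeight]
  ring

/-- For the first column hook lengths `B` of a partition (possibly padded with empty rows), the
reciprocal of the product of the hook lengths. -/
def betaWeight (B : Finset ℕ) : ℚ :=
  pairWeight (fun x => 1 / (x.factorial : ℚ)) (fun x c => |(x : ℚ) - c|) B

/-- For the set `S` of parts of a strict partition, the reciprocal of the product of the shifted hook
lengths. -/
def strictWeight (S : Finset ℕ) : ℚ :=
  pairWeight (fun x => 1 / (x.factorial : ℚ)) (fun x c => |(x : ℚ) - c| / (x + c)) S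

theorem betaWeight_insert {R : Finset ℕ} {x : ℕ} (hx : x ∉ R) :
    betaWeight (insert x R) =
      1 / (x.factorial : ℚ) * (∏ c ∈ R, |(x : ℚ) - c|) * betaWeight R :=
  pairWeight_insert _ (fun _ _ => abs_sub_comm _ _) hx

theorem strictWeight_insert {R : Finset ℕ} {x : ℕ} (hx : x ∉ R) :
    strictWeight (insert x R) =
      1 / (x.factorial : ℚ) * (∏ c ∈ R, |(x : ℚ) - c| / (x + c)) * strictWeight R :=
  pairWeight_insert _ (fun _ _ => by rw [abs_sub_comm, add_comm]) hx

/-- Raising `b ≠ c` by one does not move it past `c`, so absolute values can be dropped. -/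
theorem abs_div_abs_of_ne {b c : ℕ} (h : b ≠ c) :
    |((b + 1 : ℕ) : ℚ) - c| / |(b : ℚ) - c| = ((b : ℚ) - (c - 1)) / (b - c) := by
  rw [← abs_div, show ((b + 1 : ℕ) : ℚ) - c = (b : ℚ) - (c - 1) by push_cast; ring]
  refine abs_of_nonneg ?_
  rcases lt_or_gt_of_ne h with h | h
  · have h1 : ((b + 1 : ℕ) : ℚ) ≤ c := by exact_mod_cast h
    push_cast at h1
    exact div_nonneg_of_nonpos (by linarith) (by linarith)
  · have h1 : (c : ℚ) < b := by exact_mod_cast h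
    exact div_nonneg (by linarith) (by linarith)

theorem betaWeight_up_term {B : Finset ℕ} {b : ℕ} (hb : b ∈ B) (hb' : b + 1 ∉ B) :
    betaWeight (insert (b + 1) (B.erase b)) = betaWeight B *
      (ratResidue B (fun c => (c : ℚ)) (fun c => (c : ℚ) - 1) b / (b + 1)) := by
  have h1 : b + 1 ∉ B.erase b := fun h => hb' (Finset.mem_of_mem_erase h)
  have h2 : betaWeight B = betaWeight (insert b (B.erase b)) := by rw [Finset.insert_erase hb]
  have h4 : (∏ c ∈ B.erase b, |((b + 1 : ℕ) : ℚ) - c|) =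
      (∏ c ∈ B.erase b, |(b : ℚ) - c|) *
        ∏ c ∈ B.erase b, ((b : ℚ) - (c - 1)) / (b - c) := by
    rw [← Finset.prod_mul_distrib]
    refine Finset.prod_congr rfl fun c hc => ?_
    have hne : b ≠ c := (Finset.ne_of_mem_erase hc).symm
    have h0 : |(b : ℚ) - c| ≠ 0 := abs_ne_zero.mpr (sub_ne_zero.mpr (by exact_mod_cast hne))
    rw [← abs_div_abs_of_ne hne]
    field_simp
  rw [h2, betaWeight_insert h1, betaWeight_insert (Finset.notMem_erase b B), h4, ratResidue,
    Nat.factorial_succ]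
  have : (b.factorial : ℚ) ≠ 0 := by exact_mod_cast b.factorial_ne_zero
  have : (b : ℚ) + 1 ≠ 0 := by positivity
  push_cast
  field_simp
  ring

theorem cast_injOn (B : Finset ℕ) : Set.InjOn (fun c : ℕ => (c : ℚ)) B :=
  Nat.cast_injective.injOn

/-- Summing the weights of the sets obtained by raising one element. -/
theorem sum_betaWeight_up {B : Finset ℕ} (h0 : 0 ∈ B) :
    ∑ b ∈ B.filter (· + 1 ∉ B), betaWeight (insert (b + 1) (B.erase b)) = betaWeight B := by
  -- at `z = -1` the product vanishes, because of its factor at `0`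
  have h1 := prod_div_eq_one_add_sum B (fun c => (c : ℚ)) (fun c => (c : ℚ) - 1)
    (cast_injOn B) (-1) fun i _ h => by
      have : (0 : ℚ) ≤ i := Nat.cast_nonneg i
      linarith
  rw [Finset.prod_eq_zero h0 (by simp)] at h1
  rw [Finset.sum_congr rfl fun b hb => betaWeight_up_term (Finset.mem_filter.mp hb).1
    (Finset.mem_filter.mp hb).2, ← Finset.mul_sum]
  have h2 : ∑ b ∈ B.filter (· + 1 ∉ B),
      ratResidue B (fun c => (c : ℚ)) (fun c => (c : ℚ) - 1) b / (b + 1) =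
      ∑ b ∈ B, ratResidue B (fun c => (c : ℚ)) (fun c => (c : ℚ) - 1) b / (b + 1) := by
    refine Finset.sum_filter_of_ne fun b hb hne hmem => hne ?_
    -- the factor of `b + 1` vanishes
    rw [ratResidue, Finset.prod_eq_zero (i := b + 1)
      (Finset.mem_erase.mpr ⟨by omega, hmem⟩) (by push_cast; simp)]
    simp
  have h3 : ∀ b ∈ B, ratResidue B (fun c => (c : ℚ)) (fun c => (c : ℚ) - 1) b / (b + 1) =
      -(ratResidue B (fun c => (c : ℚ)) (fun c => (c : ℚ) - 1) b / (-1 - b)) := fun b _ => by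
    rw [show (-1 : ℚ) - b = -(b + 1) by ring, div_neg, neg_neg]
  rw [h2, Finset.sum_congr rfl h3, Finset.sum_neg_distrib]
  linear_combination betaWeight B * h1

theorem betaWeight_down_term {B : Finset ℕ} {b : ℕ} (hb : b + 1 ∈ B) (hb' : b ∉ B) :
    betaWeight (insert b (B.erase (b + 1))) = betaWeight B *
      (-(ratResidue B (fun c => (c : ℚ)) (fun c => (c : ℚ) + 1) (b + 1 : ℕ) *
        ((b + 1 : ℕ) : ℚ))) := by
  have h1 : b ∉ B.erase (b + 1) := fun h => hb' (Finset.mem_of_mem_erase h)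
  have h2 : betaWeight B = betaWeight (insert (b + 1) (B.erase (b + 1))) := by
    rw [Finset.insert_erase hb]
  have h4 : (∏ c ∈ B.erase (b + 1), |(b : ℚ) - c|) =
      (∏ c ∈ B.erase (b + 1), |((b + 1 : ℕ) : ℚ) - c|) *
        ∏ c ∈ B.erase (b + 1), (((b + 1 : ℕ) : ℚ) - (c + 1)) / (((b + 1 : ℕ) : ℚ) - c) := by
    rw [← Finset.prod_mul_distrib]
    refine Finset.prod_congr rfl fun c hc => ?_
    have hne : b + 1 ≠ c := (Finset.ne_of_mem_erase hc).symm
    have hne' : b ≠ c := by rintro rfl; exact h1 hc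
    have h0 : ((b + 1 : ℕ) : ℚ) - c ≠ 0 := sub_ne_zero.mpr (by exact_mod_cast hne)
    have h5 : (b : ℚ) - c ≠ 0 := sub_ne_zero.mpr (by exact_mod_cast hne')
    have h6 := abs_div_abs_of_ne hne'
    rw [show (b : ℚ) - (c - 1) = ((b + 1 : ℕ) : ℚ) - c by push_cast; ring,
      div_eq_div_iff (abs_ne_zero.mpr h5) h5] at h6
    rw [show ((b + 1 : ℕ) : ℚ) - (c + 1) = (b : ℚ) - c by push_cast; ring, mul_div_assoc', h6]
    field_simp
  rw [h2, betaWeight_insert h1, betaWeight_insert (Finset.notMem_erase (b + 1) B), h4, ratResidue,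
    Nat.factorial_succ]
  have : (b.factorial : ℚ) ≠ 0 := by exact_mod_cast b.factorial_ne_zero
  have : (b : ℚ) + 1 ≠ 0 := by positivity
  push_cast
  field_simp
  ring

/-- Summing the weights of the sets obtained by lowering one element. -/
theorem sum_betaWeight_down (B : Finset ℕ) :
    ∑ b ∈ B.filter (fun b => b ≠ 0 ∧ b - 1 ∉ B), betaWeight (insert (b - 1) (B.erase b)) =
      (∑ b ∈ B, (b : ℚ) - B.card * (B.card - 1) / 2) * betaWeight B := by
  have h1 := sum_ratResidue_mul B (fun c => (c : ℚ)) (fun c => (c : ℚ) + 1) (cast_injOn B)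
  have hterm : ∀ b ∈ B.filter (fun b => b ≠ 0 ∧ b - 1 ∉ B),
      betaWeight (insert (b - 1) (B.erase b)) = betaWeight B *
        (-(ratResidue B (fun c => (c : ℚ)) (fun c => (c : ℚ) + 1) b * (b : ℚ))) := by
    intro b hb
    rw [Finset.mem_filter] at hb
    obtain ⟨a, rfl⟩ := Nat.exists_eq_succ_of_ne_zero hb.2.1
    exact betaWeight_down_term hb.1 hb.2.2
  rw [Finset.sum_congr rfl hterm, ← Finset.mul_sum]
  have h2 : ∑ b ∈ B.filter (fun b => b ≠ 0 ∧ b - 1 ∉ B),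
      (-(ratResidue B (fun c => (c : ℚ)) (fun c => (c : ℚ) + 1) b * (b : ℚ))) =
      ∑ b ∈ B, (-(ratResidue B (fun c => (c : ℚ)) (fun c => (c : ℚ) + 1) b * (b : ℚ))) := by
    refine Finset.sum_filter_of_ne fun b hb hne => ?_
    by_contra hcon
    refine hne ?_
    by_cases h0 : b = 0
    · simp [h0]
    · have hmem : b - 1 ∈ B := by
        by_contra h
        exact hcon ⟨h0, h⟩
      -- the factor of `b - 1` vanishes
      rw [ratResidue, Finset.prod_eq_zero (i := b - 1)
        (Finset.mem_erase.mpr ⟨by omega, hmem⟩)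
        (by rw [Nat.cast_sub (by omega)]; simp)]
      simp
  rw [h2, Finset.sum_neg_distrib]
  have h3 : ∑ i ∈ B, ((i : ℚ) - ((i : ℚ) + 1)) = -B.card := by simp
  have h4 : ∑ i ∈ B, ((i : ℚ) ^ 2 - ((i : ℚ) + 1) ^ 2) = -(2 * ∑ b ∈ B, (b : ℚ)) - B.card := by
    have : ∀ i ∈ B, (i : ℚ) ^ 2 - ((i : ℚ) + 1) ^ 2 = -(2 * (i : ℚ)) - 1 := fun i _ => by ring
    rw [Finset.sum_congr rfl this, Finset.sum_sub_distrib, Finset.sum_neg_distrib,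
      Finset.mul_sum]
    simp
  rw [h3, h4] at h1
  linear_combination (-(betaWeight B) / 2) * h1

theorem strictWeight_insert_zero {S : Finset ℕ} (h0 : 0 ∉ S) :
    strictWeight (insert 0 S) = strictWeight S := by
  rw [strictWeight_insert h0, Finset.prod_eq_one]
  · simp
  · intro c hc
    have h : (0 : ℚ) < c := by
      exact_mod_cast Nat.pos_of_ne_zero fun h => h0 (h ▸ hc)
    rw [Nat.cast_zero, zero_sub, zero_add, abs_neg, abs_of_pos h, div_self h.ne']

/-- Raising `b` by one multiplies the interaction of `b` with another element `c` by the factor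
displayed on the right, in which the variables `b` and `c` are separated. -/
theorem strict_factor {b c : ℕ} (h : b ≠ c) (h' : b + c ≠ 0) :
    (|((b + 1 : ℕ) : ℚ) - c| / ((b + 1 : ℕ) + c)) / (|(b : ℚ) - c| / (b + c)) =
      ((b : ℚ) * (b + 1) - c * (c - 1)) / (b * (b + 1) - c * (c + 1)) := by
  have h1 : (b : ℚ) - c ≠ 0 := sub_ne_zero.mpr (by exact_mod_cast h)
  have h2 : (b : ℚ) + c ≠ 0 := by exact_mod_cast h'
  have h3 : (b : ℚ) + 1 + c ≠ 0 := by positivity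
  rw [div_div_div_comm, abs_div_abs_of_ne h,
    show (b : ℚ) * (b + 1) - c * (c - 1) = (b - (c - 1)) * (b + c) by ring,
    show (b : ℚ) * (b + 1) - c * (c + 1) = (b - c) * (b + 1 + c) by ring]
  push_cast
  field_simp

theorem mul_succ_injOn (S : Finset ℕ) : Set.InjOn (fun c : ℕ => (c : ℚ) * (c + 1)) S := by
  intro a _ b _ h
  simp only at h
  have h1 : a * (a + 1) = b * (b + 1) := by exact_mod_cast h
  nlinarith [h1, lt_trichotomy a b]

theorem mul_pred_injOn {S : Finset ℕ} (h0 : 0 ∉ S) :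
    Set.InjOn (fun c : ℕ => (c : ℚ) * (c - 1)) S := by
  intro a ha b hb h
  have ha' : a ≠ 0 := fun h => h0 (h ▸ ha)
  have hb' : b ≠ 0 := fun h => h0 (h ▸ hb)
  obtain ⟨a, rfl⟩ := Nat.exists_eq_succ_of_ne_zero ha'
  obtain ⟨b, rfl⟩ := Nat.exists_eq_succ_of_ne_zero hb'
  have h2 : (a : ℚ) * (a + 1) = b * (b + 1) := by
    simp only [Nat.succ_eq_add_one, Nat.cast_add, Nat.cast_one] at h
    linarith
  rw [mul_succ_injOn {a, b} (by simp) (by simp) h2]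

theorem strictWeight_up_term {S : Finset ℕ} (h0 : 0 ∉ S) {b : ℕ} (hb : b ∈ S)
    (hb' : b + 1 ∉ S) :
    2 * strictWeight (insert (b + 1) (S.erase b)) = strictWeight S *
      (ratResidue S (fun c => (c : ℚ) * (c + 1)) (fun c => (c : ℚ) * (c - 1)) b /
        (b * (b + 1))) := by
  have h1 : b + 1 ∉ S.erase b := fun h => hb' (Finset.mem_of_mem_erase h)
  have h2 : strictWeight S = strictWeight (insert b (S.erase b)) := by
    rw [Finset.insert_erase hb]
  have hbz : (b : ℚ) ≠ 0 := by
    have : b ≠ 0 := fun h => h0 (h ▸ hb)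
    exact_mod_cast this
  have h4 : (∏ c ∈ S.erase b, |((b + 1 : ℕ) : ℚ) - c| / ((b + 1 : ℕ) + c)) =
      (∏ c ∈ S.erase b, |(b : ℚ) - c| / (b + c)) *
        ∏ c ∈ S.erase b, ((b : ℚ) * (b + 1) - c * (c - 1)) / (b * (b + 1) - c * (c + 1)) := by
    rw [← Finset.prod_mul_distrib]
    refine Finset.prod_congr rfl fun c hc => ?_
    have hne : b ≠ c := (Finset.ne_of_mem_erase hc).symm
    have hne' : b + c ≠ 0 := by omega
    have h5 : |(b : ℚ) - c| ≠ 0 := abs_ne_zero.mpr (sub_ne_zero.mpr (by exact_mod_cast hne))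
    have h6 : (b : ℚ) + c ≠ 0 := by exact_mod_cast hne'
    rw [← strict_factor hne hne', mul_div_cancel₀ _ (div_ne_zero h5 h6)]
  rw [h2, strictWeight_insert h1, strictWeight_insert (Finset.notMem_erase b S), h4, ratResidue,
    Nat.factorial_succ]
  have : (b.factorial : ℚ) ≠ 0 := by exact_mod_cast b.factorial_ne_zero
  have : (b : ℚ) + 1 ≠ 0 := by positivity
  push_cast
  field_simp
  ring

/-- Summing the weights of the sets obtained by raising one element or adding the element `1`. -/
theorem sum_strictWeight_up {S : Finset ℕ} (h0 : 0 ∉ S) :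
    ∑ b ∈ (insert 0 S).filter (· + 1 ∉ S),
      (if b = 0 then 1 else 2) * strictWeight (insert (b + 1) (S.erase b)) = strictWeight S := by
  -- at `z = 0` the product is the contribution of the new element `1`
  have h1 := prod_div_eq_one_add_sum S (fun c => (c : ℚ) * (c + 1)) (fun c => (c : ℚ) * (c - 1))
    (mul_succ_injOn S) 0 fun i hi h => by
      have : (0 : ℚ) < i := by
        exact_mod_cast Nat.pos_of_ne_zero fun h => h0 (h ▸ hi)
      have h2 : (0 : ℚ) < i * (i + 1) := by positivity
      linarith
  have hnew : ∑ b ∈ ({0} : Finset ℕ).filter (· + 1 ∉ S),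
      (if b = 0 then 1 else 2) * strictWeight (insert (b + 1) (S.erase b)) =
      strictWeight S * ∏ c ∈ S, ((0 : ℚ) - c * (c - 1)) / (0 - c * (c + 1)) := by
    rw [Finset.filter_singleton]
    by_cases h : 1 ∈ S
    · rw [Finset.prod_eq_zero h (by simp), if_neg (by simpa using h)]
      simp
    · rw [if_pos (by simpa using h), Finset.sum_singleton, if_pos rfl, zero_add,
        Finset.erase_eq_of_notMem h0, strictWeight_insert h, mul_comm (strictWeight S), one_mul]
      simp only [Nat.factorial_one, Nat.cast_one, div_one, one_mul]
      congr 1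
      refine Finset.prod_congr rfl fun c hc => ?_
      have h2 : (1 : ℚ) ≤ c := by
        exact_mod_cast Nat.one_le_iff_ne_zero.mpr fun h => h0 (h ▸ hc)
      rw [abs_sub_comm, abs_of_nonneg (by linarith)]
      have : (c : ℚ) ≠ 0 := by linarith
      have : (1 : ℚ) + c ≠ 0 := by positivity
      have : (c : ℚ) + 1 ≠ 0 := by positivity
      simp only [zero_sub, neg_div_neg_eq]
      field_simp
      ring
  have hold : ∑ b ∈ S.filter (· + 1 ∉ S),
      (if b = 0 then 1 else 2) * strictWeight (insert (b + 1) (S.erase b)) =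
      strictWeight S * ∑ b ∈ S,
        ratResidue S (fun c => (c : ℚ) * (c + 1)) (fun c => (c : ℚ) * (c - 1)) b /
          (b * (b + 1)) := by
    have h2 : ∑ b ∈ S.filter (· + 1 ∉ S),
        ratResidue S (fun c => (c : ℚ) * (c + 1)) (fun c => (c : ℚ) * (c - 1)) b /
          (b * (b + 1)) = ∑ b ∈ S,
        ratResidue S (fun c => (c : ℚ) * (c + 1)) (fun c => (c : ℚ) * (c - 1)) b /
          (b * (b + 1)) := by
      refine Finset.sum_filter_of_ne fun b hb hne hmem => hne ?_
      -- the factor of `b + 1` vanishes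
      rw [ratResidue, Finset.prod_eq_zero (i := b + 1)
        (Finset.mem_erase.mpr ⟨by omega, hmem⟩) (by push_cast; ring)]
      simp
    rw [← h2, Finset.mul_sum]
    refine Finset.sum_congr rfl fun b hb => ?_
    rw [Finset.mem_filter] at hb
    rw [if_neg (show b ≠ 0 from fun h => h0 (h ▸ hb.1)),
      strictWeight_up_term h0 hb.1 hb.2]
  have h3 : ∀ b ∈ S, ratResidue S (fun c => (c : ℚ) * (c + 1)) (fun c => (c : ℚ) * (c - 1)) b /
      (0 - b * (b + 1)) =
      -(ratResidue S (fun c => (c : ℚ) * (c + 1)) (fun c => (c : ℚ) * (c - 1)) b /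
        (b * (b + 1))) := fun b _ => by rw [zero_sub, div_neg]
  rw [Finset.sum_congr rfl h3, Finset.sum_neg_distrib] at h1
  rw [Finset.insert_eq, Finset.filter_union, Finset.sum_union, hnew, hold, h1]
  · ring
  · exact Finset.disjoint_filter_filter (Finset.disjoint_singleton_left.mpr h0)

theorem strictWeight_down_term {S : Finset ℕ} (h0 : 0 ∉ S) {b : ℕ} (hb : b + 1 ∈ S)
    (hb' : b ∉ S) :
    2 * strictWeight (insert b (S.erase (b + 1))) = strictWeight S *
      (-(ratResidue S (fun c => (c : ℚ) * (c - 1)) (fun c => (c : ℚ) * (c + 1)) (b + 1 : ℕ))) := by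
  have h1 : b ∉ S.erase (b + 1) := fun h => hb' (Finset.mem_of_mem_erase h)
  have h2 : strictWeight S = strictWeight (insert (b + 1) (S.erase (b + 1))) := by
    rw [Finset.insert_erase hb]
  have h4 : (∏ c ∈ S.erase (b + 1), |(b : ℚ) - c| / (b + c)) =
      (∏ c ∈ S.erase (b + 1), |((b + 1 : ℕ) : ℚ) - c| / ((b + 1 : ℕ) + c)) *
        ∏ c ∈ S.erase (b + 1), (((b + 1 : ℕ) : ℚ) * ((b + 1 : ℕ) - 1) - c * (c + 1)) /
          (((b + 1 : ℕ) : ℚ) * ((b + 1 : ℕ) - 1) - c * (c - 1)) := by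
    rw [← Finset.prod_mul_distrib]
    refine Finset.prod_congr rfl fun c hc => ?_
    have hcz : c ≠ 0 := fun h => h0 (h ▸ Finset.mem_of_mem_erase hc)
    have hne : b ≠ c := by rintro rfl; exact h1 hc
    have hne' : b + c ≠ 0 := by omega
    have hne2 : b + 1 ≠ c := (Finset.ne_of_mem_erase hc).symm
    have h5 : |(b : ℚ) - c| ≠ 0 := abs_ne_zero.mpr (sub_ne_zero.mpr (by exact_mod_cast hne))
    have h6 : (b : ℚ) + c ≠ 0 := by exact_mod_cast hne'
    have h7 : |((b + 1 : ℕ) : ℚ) - c| ≠ 0 :=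
      abs_ne_zero.mpr (sub_ne_zero.mpr (by exact_mod_cast hne2))
    have h8 : ((b + 1 : ℕ) : ℚ) + c ≠ 0 := by positivity
    have h9 := strict_factor hne hne'
    have e1 : ((b + 1 : ℕ) : ℚ) * ((b + 1 : ℕ) - 1) - c * (c + 1) =
      (b : ℚ) * (b + 1) - c * (c + 1) := by push_cast; ring
    have e2 : ((b + 1 : ℕ) : ℚ) * ((b + 1 : ℕ) - 1) - c * (c - 1) =
      (b : ℚ) * (b + 1) - c * (c - 1) := by push_cast; ring
    rw [e1, e2, ← inv_div ((b : ℚ) * (b + 1) - c * (c - 1)), ← h9, inv_div, mul_div_cancel₀ _ (div_ne_zero h7 h8)]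
  rw [h2, strictWeight_insert h1, strictWeight_insert (Finset.notMem_erase (b + 1) S), h4,
    ratResidue, Nat.factorial_succ]
  have : (b.factorial : ℚ) ≠ 0 := by exact_mod_cast b.factorial_ne_zero
  have : (b : ℚ) + 1 ≠ 0 := by positivity
  push_cast
  field_simp
  ring

/-- Summing the weights of the sets obtained by lowering one element, where an element `1` may
disappear. -/
theorem sum_strictWeight_down {S : Finset ℕ} (h0 : 0 ∉ S) :
    ∑ b ∈ S.filter (· - 1 ∉ S), strictWeight (insert (b - 1) (S.erase b)) =
      (∑ b ∈ S, (b : ℚ)) * strictWeight S := by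
  have h1 := sum_ratResidue S (fun c => (c : ℚ) * (c - 1)) (fun c => (c : ℚ) * (c + 1))
    (mul_pred_injOn h0)
  have hterm : ∀ b ∈ S.filter (· - 1 ∉ S),
      strictWeight (insert (b - 1) (S.erase b)) = strictWeight S / 2 *
        (-(ratResidue S (fun c => (c : ℚ) * (c - 1)) (fun c => (c : ℚ) * (c + 1)) b)) := by
    intro b hb
    rw [Finset.mem_filter] at hb
    obtain ⟨a, rfl⟩ := Nat.exists_eq_succ_of_ne_zero fun h => h0 (h ▸ hb.1)
    have := strictWeight_down_term h0 hb.1 hb.2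
    simp only [Nat.succ_eq_add_one, Nat.add_sub_cancel] at this ⊢
    linarith
  have h2 : ∑ b ∈ S.filter (· - 1 ∉ S),
      (-(ratResidue S (fun c => (c : ℚ) * (c - 1)) (fun c => (c : ℚ) * (c + 1)) b)) =
      ∑ b ∈ S,
        (-(ratResidue S (fun c => (c : ℚ) * (c - 1)) (fun c => (c : ℚ) * (c + 1)) b)) := by
    refine Finset.sum_filter_of_ne fun b hb hne hmem => hne ?_
    have hbz : b ≠ 0 := fun h => h0 (h ▸ hb)
    -- the factor of `b - 1` vanishes
    rw [ratResidue, Finset.prod_eq_zero (i := b - 1)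
      (Finset.mem_erase.mpr ⟨by omega, hmem⟩)
      (by rw [Nat.cast_sub (by omega)]; push_cast; ring)]
    simp
  rw [Finset.sum_congr rfl hterm, ← Finset.mul_sum, h2, Finset.sum_neg_distrib, h1]
  have h3 : ∀ b ∈ S, (b : ℚ) * (b - 1) - b * (b + 1) = (-2) * b := fun b _ => by ring
  rw [Finset.sum_congr rfl h3, ← Finset.mul_sum]
  ring

/-! ### Hook products in terms of beta numbers and of parts -/

/-- The numbers `x - n` with `n < x` have the product `x!`; here they are split according to
whether `n` belongs to `B`. -/
theorem prod_notMem_mul_prod_mem (B : Finset ℕ) (x : ℕ) :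
    (∏ n ∈ (Finset.range x).filter (· ∉ B), ((x : ℚ) - n)) *
      ∏ c ∈ B.filter (· < x), |(x : ℚ) - c| = x.factorial := by
  have h1 : ∏ c ∈ B.filter (· < x), |(x : ℚ) - c| =
      ∏ n ∈ (Finset.range x).filter (· ∈ B), ((x : ℚ) - n) := by
    have : B.filter (· < x) = (Finset.range x).filter (· ∈ B) := by
      ext c
      simp only [Finset.mem_filter, Finset.mem_range]
      tauto
    rw [this]
    refine Finset.prod_congr rfl fun c hc => abs_of_nonneg ?_
    have : (c : ℚ) < x := by exact_mod_cast Finset.mem_range.mp (Finset.mem_filter.mp hc).1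
    linarith
  rw [h1, mul_comm, Finset.prod_filter_mul_prod_filter_not, ← Finset.prod_range_add_one_eq_factorial,
    ← Finset.prod_range_reflect, Nat.cast_prod]
  refine Finset.prod_congr rfl fun n hn => ?_
  rw [Finset.mem_range] at hn
  rw [show x - 1 - n = x - (n + 1) by omega, Nat.cast_sub (by omega)]
  ring

namespace YoungDiagram

theorem mem_edgeWord_of_lt {μ : YoungDiagram} {r : ℕ} (hr : μ.colLen 0 ≤ r) {p : ℤ}
    (hp : p < -(r : ℤ)) : p ∈ μ.edgeWord.zeros := by
  refine ⟨(-p - 1).toNat, ?_⟩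
  rw [rowLen_eq_zero (by omega)]
  omega

/-- The beta numbers of a partition written with `r` rows, some of which may be empty. -/
def beta (μ : YoungDiagram) (r : ℕ) : Finset ℕ :=
  (Finset.range r).image fun i => μ.rowLen i + (r - (i + 1))

theorem mem_beta_iff {μ : YoungDiagram} {r : ℕ} (hr : μ.colLen 0 ≤ r) {b : ℕ} :
    b ∈ μ.beta r ↔ (b : ℤ) - r ∈ μ.edgeWord.zeros := by
  simp only [beta, Finset.mem_image, Finset.mem_range, edgeWord, Set.mem_ofPred_eq]
  constructor
  · rintro ⟨i, hi, rfl⟩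
    exact ⟨i, by omega⟩
  · rintro ⟨i, hi⟩
    have hir : i < r := by
      by_contra hcon
      rw [rowLen_eq_zero (by omega)] at hi
      omega
    exact ⟨i, hir, by omega⟩

/-- The hook length formula in terms of beta numbers. -/
theorem one_div_hookProd {μ : YoungDiagram} {r : ℕ} (hr : μ.colLen 0 ≤ r) :
    1 / (μ.hookProd : ℚ) = betaWeight (μ.beta r) := by
  classical
  have h1 := congrArg (Int.cast : ℤ → ℚ) (EdgeWord.hookProd_diagram μ.edgeWord)
  rw [diagram_edgeWord] at h1
  push_cast at h1
  rw [EdgeWord.prod_inversions μ.edgeWord (a := -(r : ℤ)) (fun p hp => mem_edgeWord_of_lt hr hp)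
    (fun p q => (q : ℚ) - p)] at h1
  have h2 : ∏ q ∈ μ.edgeWord.zerosFinset (-(r : ℤ)),
      ∏ p ∈ (Finset.Ico (-(r : ℤ)) q).filter (· ∉ μ.edgeWord.zeros), ((q : ℚ) - p) =
      ∏ b ∈ μ.beta r, ∏ n ∈ (Finset.range b).filter (· ∉ μ.beta r), ((b : ℚ) - n) := by
    refine Finset.prod_bij' (fun q _ => (q + r).toNat) (fun b _ => (b : ℤ) - r) ?_ ?_ ?_ ?_ ?_
    · intro q hq
      rw [EdgeWord.mem_zerosFinset] at hq
      rw [mem_beta_iff hr, Int.toNat_of_nonneg (by omega), add_sub_cancel_right]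
      exact hq.2
    · intro b hb
      rw [mem_beta_iff hr] at hb
      rw [EdgeWord.mem_zerosFinset]
      exact ⟨by omega, hb⟩
    · intro q hq
      rw [EdgeWord.mem_zerosFinset] at hq
      omega
    · intro b _
      omega
    · intro q hq
      rw [EdgeWord.mem_zerosFinset] at hq
      have hq' : (((q + r).toNat : ℤ) : ℚ) = q + r := by
        rw [Int.toNat_of_nonneg (by omega)]
        push_cast
        ring
      refine Finset.prod_bij' (fun p _ => (p + r).toNat) (fun n _ => (n : ℤ) - r) ?_ ?_ ?_ ?_ ?_
      · intro p hp
        simp only [Finset.mem_filter, Finset.mem_Ico, Finset.mem_range] at hp ⊢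
        rw [mem_beta_iff hr, Int.toNat_of_nonneg (by omega), add_sub_cancel_right]
        exact ⟨by omega, hp.2⟩
      · intro n hn
        simp only [Finset.mem_filter, Finset.mem_Ico, Finset.mem_range] at hn ⊢
        rw [mem_beta_iff hr] at hn
        exact ⟨by omega, hn.2⟩
      · intro p hp
        simp only [Finset.mem_filter, Finset.mem_Ico] at hp
        omega
      · intro n _
        omega
      · intro p hp
        simp only [Finset.mem_filter, Finset.mem_Ico] at hp
        have hp' : (((p + r).toNat : ℤ) : ℚ) = p + r := by
          rw [Int.toNat_of_nonneg (by omega)]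
          push_cast
          ring
        rw [Int.cast_natCast] at hp' hq'
        rw [hp', hq']
        ring
  rw [h1, h2, betaWeight, pairWeight, one_div, ← Finset.prod_inv_distrib]
  refine Finset.prod_congr rfl fun b _ => ?_
  have h3 := prod_notMem_mul_prod_mem (μ.beta r) b
  have h4 : (b.factorial : ℚ) ≠ 0 := by exact_mod_cast b.factorial_ne_zero
  have h5 := left_ne_zero_of_mul (h3.trans_ne h4)
  rw [← h3] at h4 ⊢
  have h6 := right_ne_zero_of_mul h4
  field_simp

theorem hookProd_pos (μ : YoungDiagram) : 0 < μ.hookProd := by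
  refine Nat.pos_of_ne_zero ?_
  rw [hookProd, Ne, Multiset.prod_eq_zero_iff, hooks, Multiset.mem_map]
  rintro ⟨c, -, hc⟩
  simp [hookLen] at hc

end YoungDiagram

namespace StrictPartition

/-- The set of parts of a strict partition. -/
def partSet (s : StrictPartition) : Finset ℕ := s.parts.toFinset

theorem mem_partSet {s : StrictPartition} {x : ℕ} :
    x ∈ s.partSet ↔ 0 < x ∧ (x : ℤ) ∈ s.double.edgeWord.zeros := by
  rw [partSet, List.mem_toFinset, mem_parts_iff_edgeWord]

theorem zero_notMem_partSet (s : StrictPartition) : 0 ∉ s.partSet := fun h =>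
  lt_irrefl _ (mem_partSet.mp h).1

theorem nodup_parts (s : StrictPartition) : s.parts.Nodup := s.sorted.nodup

theorem card_partSet (s : StrictPartition) : s.partSet.card = s.length :=
  List.toFinset_card_of_nodup s.nodup_parts

theorem sum_partSet (s : StrictPartition) : ∑ x ∈ s.partSet, x = s.size := by
  rw [partSet, List.sum_toFinset _ s.nodup_parts, List.map_id', size]

/-- The hook length of a box of the shifted diagram is the hook length of the same box in the
doubled distinct partition. -/
theorem hookLen_eq {s : StrictPartition} {c : ℕ × ℕ} (hc : c ∈ s.shiftedCells) :
    s.hookLen c = s.double.hookLen c := by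
  obtain ⟨i, j⟩ := c
  have hc' := s.mem_shiftedCells.mp hc
  have h1 : (s.shiftedCells.filter fun d => d.1 = i ∧ j < d.2).card = i + s.part i - j := by
    have : (s.shiftedCells.filter fun d => d.1 = i ∧ j < d.2) =
        (Finset.Ioc j (i + s.part i)).image fun k => (i, k) := by
      ext ⟨a, b⟩
      simp only [Finset.mem_filter, s.mem_shiftedCells, Finset.mem_image, Finset.mem_Ioc,
        Prod.mk.injEq]
      constructor
      · rintro ⟨⟨h1, h2⟩, rfl, h3⟩
        exact ⟨b, ⟨h3, h2⟩, rfl, rfl⟩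
      · rintro ⟨k, ⟨h1, h2⟩, rfl, rfl⟩
        exact ⟨⟨by omega, h2⟩, rfl, h1⟩
    rw [this, Finset.card_image_of_injective _ fun a b h => (Prod.mk.inj h).2, Nat.card_Ioc]
  have h2 : (s.shiftedCells.filter fun d => i < d.1 ∧ d.2 = j).card + s.part j =
      s.double.colLen j - (i + 1) := by
    have hu : (s.shiftedCells.filter fun d => i < d.1 ∧ d.2 = j).image Prod.fst ∪
        Finset.Ico j (j + s.part j) = Finset.Ioo i (s.double.colLen j) := by
      ext k
      simp only [Finset.mem_union, Finset.mem_image, Finset.mem_filter, Finset.mem_Ico,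
        Finset.mem_Ioo, Prod.exists, s.mem_shiftedCells, ← YoungDiagram.mem_iff_lt_colLen,
        mem_double]
      constructor
      · rintro (⟨a, b, ⟨ha, hb, rfl⟩, rfl⟩ | h)
        · exact ⟨hb, Or.inl ha⟩
        · exact ⟨by omega, Or.inr h⟩
      · rintro ⟨h1, h | h⟩
        · exact Or.inl ⟨k, j, ⟨h, h1, rfl⟩, rfl⟩
        · exact Or.inr h
    have hd : Disjoint ((s.shiftedCells.filter fun d => i < d.1 ∧ d.2 = j).image Prod.fst)
        (Finset.Ico j (j + s.part j)) := by
      rw [Finset.disjoint_left]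
      intro k hk
      simp only [Finset.mem_image, Finset.mem_filter, Prod.exists, s.mem_shiftedCells] at hk
      obtain ⟨a, b, ⟨h1, h2, rfl⟩, rfl⟩ := hk
      simp only [Finset.mem_Ico]
      omega
    have := congrArg Finset.card hu
    rw [Finset.card_union_of_disjoint hd, Nat.card_Ico, Nat.card_Ioo,
      Finset.card_image_of_injOn] at this
    · omega
    · rintro ⟨a, b⟩ h ⟨a', b'⟩ h' heq
      simp only [Finset.coe_filter, Set.mem_ofPred_eq] at h h'
      ext
      · exact heq
      · rw [h.2.2, h'.2.2]
  have h3 := rowLen_double (s := s) (i := i) (by omega)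
  simp only [hookLen, YoungDiagram.hookLen, h1, h3]
  omega

theorem shiftedCells_eq (s : StrictPartition) :
    s.shiftedCells = s.double.cells.filter fun c => c.1 < c.2 := by
  ext ⟨i, j⟩
  rw [Finset.mem_filter, YoungDiagram.mem_cells, mem_double, s.mem_shiftedCells]
  simp only
  omega

end StrictPartition

namespace EdgeWord

theorem IsDouble.zerosFrom_eq {w : EdgeWord} (h : w.IsDouble) {q : ℤ} (hq : 0 < q) :
    w.zerosFrom q = w.onesBefore (1 - q) := by
  have : {p : ℤ | q ≤ p ∧ p ∈ w.zeros} = Neg.neg '' {p : ℤ | p < 1 - q ∧ p ∉ w.zeros} := by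
    ext p
    simp only [Set.mem_ofPred_eq, Set.mem_image]
    constructor
    · rintro ⟨h1, h2⟩
      exact ⟨-p, ⟨by omega, ((h p).1 h2).2⟩, neg_neg p⟩
    · rintro ⟨q, ⟨h1, h2⟩, rfl⟩
      exact ⟨by omega, (h _).2 ⟨by omega, by rwa [neg_neg]⟩⟩
  rw [zerosFrom, this, Set.ncard_image_of_injective _ neg_injective, onesBefore]

/-- In the diagram of a doubled distinct partition, the box of an inversion lies to the right of
the diagonal if and only if the sum of the two positions is positive. -/
theorem IsDouble.box_fst_lt_snd {w : EdgeWord} (h : w.IsDouble) {x : ℤ × ℤ}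
    (hx : x ∈ w.inversions) : (w.box x).1 < (w.box x).2 ↔ 0 < x.1 + x.2 := by
  obtain ⟨p, q⟩ := x
  rw [mem_inversions] at hx
  obtain ⟨hp, hq, hlt⟩ := hx
  simp only at hp hq hlt
  simp only [box]
  have hq0 : q ≠ 0 := fun h0 => h.zero_notMem (h0 ▸ hq)
  rcases lt_or_gt_of_ne hq0 with hneg | hpos
  · have h1 := w.zerosFrom_anti (show q + 1 ≤ 0 by omega)
    have h2 := zerosFrom_of_notMem h.zero_notMem
    rw [zero_add, h.zerosFrom_eq one_pos, sub_self] at h2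
    have h3 := w.onesBefore_mono (show p ≤ 0 by omega)
    omega
  · rw [h.zerosFrom_eq (by omega), show 1 - (q + 1) = -q by ring,
      onesBefore_lt_iff ((h q).1 hq).2]
    omega

end EdgeWord

namespace StrictPartition

theorem hookProd_eq_prod_inversions (s : StrictPartition) :
    (s.hookProd : ℤ) = ∏ x ∈ s.double.edgeWord.inversions.filter (fun x => 0 < x.1 + x.2),
      (x.2 - x.1) := by
  have hd := s.isDouble_edgeWord_double
  have h1 : s.hookProd = ∏ c ∈ s.shiftedCells, s.double.hookLen c :=
    Finset.prod_congr rfl fun c hc => hookLen_eq hc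
  have h2 : s.shiftedCells = (s.double.edgeWord.inversions.filter
      (fun x => 0 < x.1 + x.2)).image s.double.edgeWord.box := by
    have h3 := s.double.edgeWord.cells_diagram
    rw [YoungDiagram.diagram_edgeWord] at h3
    rw [shiftedCells_eq, h3, Finset.filter_image]
    congr 1
    exact Finset.filter_congr fun x hx => hd.box_fst_lt_snd hx
  rw [h1, h2, Finset.prod_image fun a ha b hb hab =>
    s.double.edgeWord.box_injOn (Finset.mem_of_mem_filter a ha) (Finset.mem_of_mem_filter b hb) hab,
    Nat.cast_prod]
  refine Finset.prod_congr rfl fun x hx => ?_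
  have := EdgeWord.hookLen_box (Finset.mem_of_mem_filter x hx)
  rwa [YoungDiagram.diagram_edgeWord] at this

/-- Schur's product formula for the shifted hook lengths. -/
theorem one_div_hookProd (s : StrictPartition) :
    1 / (s.hookProd : ℚ) = strictWeight s.partSet := by
  classical
  have hd := s.isDouble_edgeWord_double
  have h1 := congrArg (Int.cast : ℤ → ℚ) s.hookProd_eq_prod_inversions
  push_cast at h1
  have h2 : ∏ x ∈ s.double.edgeWord.inversions.filter (fun x => 0 < x.1 + x.2),
      ((x.2 : ℚ) - x.1) = ∏ b ∈ s.partSet,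
        ((∏ n ∈ (Finset.range b).filter (· ∉ s.partSet), ((b : ℚ) - n)) *
          ∏ c ∈ s.partSet.filter (· < b), ((b : ℚ) + c)) := by
    have h3 : ∏ x ∈ s.double.edgeWord.inversions.filter (fun x => 0 < x.1 + x.2),
        ((x.2 : ℚ) - x.1) = ∏ b ∈ s.partSet,
        ∏ p ∈ (Finset.Ioo (-(b : ℤ)) b).filter (· ∉ s.double.edgeWord.zeros), ((b : ℚ) - p) := by
      rw [Finset.prod_sigma']
      refine Finset.prod_bij' (fun x _ => (⟨x.2.toNat, x.1⟩ : Σ _ : ℕ, ℤ))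
        (fun x _ => (x.2, (x.1 : ℤ))) ?_ ?_ ?_ ?_ ?_
      · rintro ⟨p, q⟩ hx
        simp only [Finset.mem_filter, EdgeWord.mem_inversions] at hx
        simp only [Finset.mem_sigma, Finset.mem_filter, Finset.mem_Ioo, mem_partSet]
        rw [Int.toNat_of_nonneg (by omega)]
        exact ⟨⟨by omega, hx.1.2.1⟩, ⟨by omega, by omega⟩, hx.1.1⟩
      · rintro ⟨b, p⟩ hx
        simp only [Finset.mem_sigma, Finset.mem_filter, Finset.mem_Ioo, mem_partSet] at hx
        simp only [Finset.mem_filter, EdgeWord.mem_inversions]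
        exact ⟨⟨hx.2.2, hx.1.2, by omega⟩, by omega⟩
      · rintro ⟨p, q⟩ hx
        simp only [Finset.mem_filter, EdgeWord.mem_inversions] at hx
        simp only [Int.toNat_of_nonneg (show 0 ≤ q by omega)]
      · rintro ⟨b, p⟩ _
        simp
      · rintro ⟨p, q⟩ hx
        simp only [Finset.mem_filter, EdgeWord.mem_inversions] at hx
        have : ((q.toNat : ℤ) : ℚ) = q := by rw [Int.toNat_of_nonneg (by omega)]
        rw [Int.cast_natCast] at this
        simp only [this]
    rw [h3]
    refine Finset.prod_congr rfl fun b hb => ?_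
    rw [← Finset.prod_filter_mul_prod_filter_not _ (fun p : ℤ => 0 ≤ p)]
    congr 1
    · refine Finset.prod_bij' (fun p _ => p.toNat) (fun n _ => (n : ℤ)) ?_ ?_ ?_ ?_ ?_
      · intro p hp
        simp only [Finset.mem_filter, Finset.mem_Ioo] at hp
        simp only [Finset.mem_filter, Finset.mem_range, mem_partSet,
          Int.toNat_of_nonneg hp.2]
        exact ⟨by omega, fun h => hp.1.2 h.2⟩
      · intro n hn
        simp only [Finset.mem_filter, Finset.mem_range, mem_partSet] at hn
        simp only [Finset.mem_filter, Finset.mem_Ioo]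
        refine ⟨⟨by omega, fun h => hn.2 ⟨?_, h⟩⟩, by omega⟩
        exact Nat.pos_of_ne_zero fun h0 => hd.zero_notMem (by rwa [h0] at h)
      · intro p hp
        exact Int.toNat_of_nonneg (Finset.mem_filter.mp hp).2
      · intro n _
        simp
      · intro p hp
        have : ((p.toNat : ℤ) : ℚ) = p := by
          rw [Int.toNat_of_nonneg (Finset.mem_filter.mp hp).2]
        rw [Int.cast_natCast] at this
        rw [this]
    · refine Finset.prod_bij' (fun p _ => (-p).toNat) (fun n _ => -(n : ℤ)) ?_ ?_ ?_ ?_ ?_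
      · intro p hp
        simp only [Finset.mem_filter, Finset.mem_Ioo] at hp
        simp only [Finset.mem_filter, mem_partSet, Int.toNat_of_nonneg (show 0 ≤ -p by omega)]
        refine ⟨⟨by omega, (hd _).2 ⟨by omega, ?_⟩⟩, by omega⟩
        rw [neg_neg]
        exact hp.1.2
      · intro n hn
        simp only [Finset.mem_filter, mem_partSet] at hn
        simp only [Finset.mem_filter, Finset.mem_Ioo]
        exact ⟨⟨by omega, ((hd _).1 hn.1.2).2⟩, by omega⟩
      · intro p hp
        simp only [Finset.mem_filter, Finset.mem_Ioo] at hp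
        omega
      · intro n _
        simp
      · intro p hp
        simp only [Finset.mem_filter, Finset.mem_Ioo] at hp
        have : (((-p).toNat : ℤ) : ℚ) = -p := by
          rw [Int.toNat_of_nonneg (by omega)]
          push_cast
          ring
        rw [Int.cast_natCast] at this
        rw [this, sub_eq_add_neg]
  rw [h1, h2, strictWeight, pairWeight, one_div, ← Finset.prod_inv_distrib]
  refine Finset.prod_congr rfl fun b _ => ?_
  have h3 := prod_notMem_mul_prod_mem s.partSet b
  have h4 : (b.factorial : ℚ) ≠ 0 := by exact_mod_cast b.factorial_ne_zero
  have h5 := left_ne_zero_of_mul (h3.trans_ne h4)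
  rw [← h3] at h4 ⊢
  have h6 := right_ne_zero_of_mul h4
  rw [Finset.prod_div_distrib]
  field_simp

theorem hookProd_pos (s : StrictPartition) : 0 < s.hookProd :=
  Finset.prod_pos fun c _ => by
    rw [hookLen]
    omega

theorem hookProd_double (s : StrictPartition) :
    s.double.hookProd = 2 ^ s.length * s.hookProd ^ 2 := by
  zify
  have hd := s.isDouble_edgeWord_double
  have hH := EdgeWord.hookProd_diagram s.double.edgeWord
  rw [YoungDiagram.diagram_edgeWord] at hH
  set w := s.double.edgeWord with hw
  set P := w.inversions.filter (fun x => 0 < x.1 + x.2) with hP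
  have hA : (s.hookProd : ℤ) = ∏ x ∈ P, (x.2 - x.1) := s.hookProd_eq_prod_inversions
  have hA' : ∏ x ∈ P, (x.2 - x.1) = (∏ x ∈ P.filter (fun x => x.1 = 0), (x.2 - x.1)) *
      ∏ x ∈ P.filter (fun x => ¬ x.1 = 0), (x.2 - x.1) :=
    (Finset.prod_filter_mul_prod_filter_not _ _ _).symm
  set N := w.inversions.filter (fun x => ¬ 0 < x.1 + x.2) with hN
  have hB : ∏ x ∈ w.inversions, (x.2 - x.1) = (∏ x ∈ P, (x.2 - x.1)) * ∏ x ∈ N, (x.2 - x.1) :=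
    (Finset.prod_filter_mul_prod_filter_not _ _ _).symm
  have hB' : ∏ x ∈ N, (x.2 - x.1) = (∏ x ∈ N.filter (fun x => x.1 + x.2 = 0), (x.2 - x.1)) *
      ∏ x ∈ N.filter (fun x => ¬ x.1 + x.2 = 0), (x.2 - x.1) :=
    (Finset.prod_filter_mul_prod_filter_not _ _ _).symm
  -- the reflection `(p, q) ↦ (-q, -p)` across the diagonal
  have h1 : ∏ x ∈ N.filter (fun x => ¬ x.1 + x.2 = 0), (x.2 - x.1) =
      ∏ x ∈ P.filter (fun x => ¬ x.1 = 0), (x.2 - x.1) := by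
    refine Finset.prod_bij' (fun x _ => (-x.2, -x.1)) (fun x _ => (-x.2, -x.1)) ?_ ?_ ?_ ?_ ?_
    · rintro ⟨p, q⟩ hx
      simp only [hP, hN, Finset.mem_filter, EdgeWord.mem_inversions] at hx ⊢
      have h1 := (hd q).1 hx.1.1.2.1
      have h2 := (hd (-p)).2 ⟨by omega, by rw [neg_neg]; exact hx.1.1.1⟩
      exact ⟨⟨⟨h1.2, h2, by omega⟩, by omega⟩, by omega⟩
    · rintro ⟨p, q⟩ hx
      simp only [hP, hN, Finset.mem_filter, EdgeWord.mem_inversions] at hx ⊢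
      have h1 := (hd q).1 hx.1.1.2.1
      have h2 := (hd (-p)).2 ⟨by omega, by rw [neg_neg]; exact hx.1.1.1⟩
      exact ⟨⟨⟨h1.2, h2, by omega⟩, by omega⟩, by omega⟩
    · rintro ⟨p, q⟩ _
      simp
    · rintro ⟨p, q⟩ _
      simp
    · rintro ⟨p, q⟩ _
      simp only
      ring
  have h2 : ∏ x ∈ P.filter (fun x => x.1 = 0), (x.2 - x.1) = ∏ b ∈ s.partSet, (b : ℤ) := by
    symm
    refine Finset.prod_bij' (fun b _ => ((0 : ℤ), (b : ℤ))) (fun x _ => x.2.toNat) ?_ ?_ ?_ ?_ ?_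
    · intro b hb
      rw [mem_partSet] at hb
      simp only [hP, Finset.mem_filter, EdgeWord.mem_inversions]
      exact ⟨⟨⟨hd.zero_notMem, hb.2, by omega⟩, by omega⟩, trivial⟩
    · rintro ⟨p, q⟩ hx
      simp only [hP, Finset.mem_filter, EdgeWord.mem_inversions] at hx
      rw [mem_partSet, Int.toNat_of_nonneg (by omega)]
      exact ⟨by omega, hx.1.1.2.1⟩
    · intro b _
      simp
    · rintro ⟨p, q⟩ hx
      simp only [hP, Finset.mem_filter, EdgeWord.mem_inversions] at hx
      rw [Int.toNat_of_nonneg (by omega), hx.2]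
    · intro b _
      simp
  have h3 : ∏ x ∈ N.filter (fun x => x.1 + x.2 = 0), (x.2 - x.1) =
      ∏ b ∈ s.partSet, (2 * (b : ℤ)) := by
    symm
    refine Finset.prod_bij' (fun b _ => (-(b : ℤ), (b : ℤ))) (fun x _ => x.2.toNat) ?_ ?_ ?_ ?_ ?_
    · intro b hb
      rw [mem_partSet] at hb
      simp only [hN, Finset.mem_filter, EdgeWord.mem_inversions]
      exact ⟨⟨⟨((hd b).1 hb.2).2, hb.2, by omega⟩, by omega⟩, by omega⟩
    · rintro ⟨p, q⟩ hx
      simp only [hN, Finset.mem_filter, EdgeWord.mem_inversions] at hx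
      rw [mem_partSet, Int.toNat_of_nonneg (by omega)]
      exact ⟨by omega, hx.1.1.2.1⟩
    · intro b _
      simp
    · rintro ⟨p, q⟩ hx
      simp only [hN, Finset.mem_filter, EdgeWord.mem_inversions] at hx
      rw [Int.toNat_of_nonneg (by omega)]
      ext <;> simp only
      omega
    · intro b _
      simp only
      ring
  rw [Finset.prod_mul_distrib, Finset.prod_const, card_partSet] at h3
  rw [hH, hA, hB, hB', h1, h3, hA', h2]
  ring

theorem size_eq_sum_part (s : StrictPartition) {N : ℕ} (hN : s.length ≤ N) :
    s.size = ∑ i ∈ Finset.range N, s.part i := by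
  rw [← Finset.sum_subset (Finset.range_mono hN) fun i _ hi =>
    s.part_eq_zero (by simpa using hi), Finset.sum_range, size, ← Fin.sum_univ_getElem]
  refine Finset.sum_congr rfl fun i _ => ?_
  exact (List.getD_eq_getElem _ _ i.2).symm

theorem card_double (s : StrictPartition) : s.double.card = 2 * s.size := by
  have hd : Disjoint s.shiftedCells s.addedCells := by
    rw [Finset.disjoint_left]
    rintro ⟨i, j⟩ h1 h2
    rw [mem_shiftedCells] at h1
    rw [mem_addedCells] at h2
    omega
  have h1 : s.shiftedCells.card = s.size := by
    rw [shiftedCells, Finset.card_biUnion, s.size_eq_sum_part le_rfl]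
    · refine Finset.sum_congr rfl fun i _ => ?_
      rw [Finset.card_image_of_injective _ fun a b h => (Prod.mk.inj h).2, Nat.card_Icc]
      omega
    · intro a _ b _ hab
      refine Finset.disjoint_left.mpr ?_
      rintro ⟨i, j⟩ h1 h2
      simp only [Finset.mem_image, Prod.mk.injEq] at h1 h2
      obtain ⟨_, -, rfl, -⟩ := h1
      obtain ⟨_, -, rfl, -⟩ := h2
      exact hab rfl
  have h2 : s.addedCells.card = s.size := by
    rw [addedCells, Finset.card_biUnion, s.size_eq_sum_part le_rfl]
    · refine Finset.sum_congr rfl fun i _ => ?_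
      rw [Finset.card_image_of_injective _ fun a b h => (Prod.mk.inj h).1, Nat.card_Ico]
      omega
    · intro a _ b _ hab
      refine Finset.disjoint_left.mpr ?_
      rintro ⟨i, j⟩ h1 h2
      simp only [Finset.mem_image, Prod.mk.injEq] at h1 h2
      obtain ⟨_, -, -, rfl⟩ := h1
      obtain ⟨_, -, -, rfl⟩ := h2
      exact hab rfl
  rw [YoungDiagram.card, double, Finset.card_union_of_disjoint hd, h1, h2, two_mul]

end StrictPartition

/-! ### Adding and removing boxes -/

/-- If one family dominates another and has a sum larger by one, then they differ in one place
only. -/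
theorem exists_eq_add_one_of_sum_eq {ι : Type*} [DecidableEq ι] {S : Finset ι} {a b : ι → ℕ}
    (hle : ∀ i ∈ S, a i ≤ b i) (hsum : ∑ i ∈ S, b i = ∑ i ∈ S, a i + 1) :
    ∃ i ∈ S, b i = a i + 1 ∧ ∀ k ∈ S, k ≠ i → b k = a k := by
  have h1 : ∑ i ∈ S, (b i - a i) = 1 := by
    have h2 : ∑ i ∈ S, b i = ∑ i ∈ S, a i + ∑ i ∈ S, (b i - a i) := by
      rw [← Finset.sum_add_distrib]
      exact Finset.sum_congr rfl fun i hi => (Nat.add_sub_cancel' (hle i hi)).symm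
    omega
  obtain ⟨i, hi, hne⟩ := Finset.exists_ne_zero_of_sum_ne_zero (h1.trans_ne one_ne_zero)
  have h3 := Finset.add_sum_erase _ (fun i => b i - a i) hi
  refine ⟨i, hi, by omega, fun k hk hki => ?_⟩
  have h4 := hle k hk
  have h5 := Finset.single_le_sum (f := fun i => b i - a i) (fun _ _ => Nat.zero_le _)
    (Finset.mem_erase.mpr ⟨hki, hk⟩)
  omega

theorem exists_eq_add_ite {a b : ℕ → ℕ} {N : ℕ} (hle : ∀ i, a i ≤ b i)
    (hN : ∀ i, N ≤ i → b i = a i)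
    (hsum : ∑ i ∈ Finset.range N, b i = ∑ i ∈ Finset.range N, a i + 1) :
    ∃ i, ∀ k, b k = a k + if k = i then 1 else 0 := by
  obtain ⟨i, -, hi, h⟩ := exists_eq_add_one_of_sum_eq (fun i _ => hle i) hsum
  refine ⟨i, fun k => ?_⟩
  split_ifs with hk
  · rw [hk, hi]
  · by_cases hkN : N ≤ k
    · rw [hN k hkN, add_zero]
    · rw [h k (Finset.mem_range.mpr (not_le.mp hkN)) hk, add_zero]

namespace YoungDiagram

theorem colLen_zero_le_iff {μ : YoungDiagram} {r : ℕ} : μ.colLen 0 ≤ r ↔ μ.rowLen r = 0 := by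
  refine ⟨rowLen_eq_zero, fun h => ?_⟩
  by_contra hcon
  have := mem_iff_lt_rowLen.mp (mem_iff_lt_colLen.mpr (not_le.mp hcon))
  omega

theorem card_eq_sum_rowLen {μ : YoungDiagram} {N : ℕ} (hN : μ.colLen 0 ≤ N) :
    μ.card = ∑ i ∈ Finset.range N, μ.rowLen i := by
  rw [YoungDiagram.card, Finset.card_eq_sum_card_fiberwise (f := Prod.fst) (t := Finset.range N)]
  · exact Finset.sum_congr rfl fun i _ => (μ.rowLen_eq_card).symm
  · rintro ⟨i, j⟩ hc
    have h1 : (i, j) ∈ μ := hc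
    have h2 := mem_iff_lt_rowLen.mp h1
    simp only [Finset.coe_range, Set.mem_Iio]
    by_contra hcon
    rw [rowLen_eq_zero (by omega)] at h2
    omega

theorem exists_rowLen {f : ℕ → ℕ} (hf : Antitone f) {N : ℕ} (hN : f N = 0) :
    ∃ μ : YoungDiagram, ∀ i, μ.rowLen i = f i := by
  have hmem : ∀ i j, (i, j) ∈ (Finset.range N ×ˢ Finset.range (f 0)).filter
      (fun c => c.2 < f c.1) ↔ j < f i := by
    intro i j
    simp only [Finset.mem_filter, Finset.mem_product, Finset.mem_range, and_iff_right_iff_imp]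
    intro h
    have h1 := hf (Nat.zero_le i)
    refine ⟨?_, by omega⟩
    by_contra hcon
    have h2 := hf (not_lt.mp hcon)
    omega
  let μ : YoungDiagram :=
    { cells := (Finset.range N ×ˢ Finset.range (f 0)).filter (fun c => c.2 < f c.1)
      isLowerSet := by
        rintro ⟨i, j⟩ ⟨i', j'⟩ ⟨hi, hj⟩ h
        simp only [Finset.mem_coe, hmem] at h ⊢
        simp only at hi hj
        have := hf hi
        omega }
  refine ⟨μ, fun i => ?_⟩
  have h : ∀ j, j < μ.rowLen i ↔ j < f i := fun j => by
    rw [← mem_iff_lt_rowLen, ← mem_cells]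
    exact hmem i j
  exact le_antisymm (le_of_forall_lt fun j hj => (h j).1 hj)
    (le_of_forall_lt fun j hj => (h j).2 hj)

/-- The diagram `ν` arises from `μ` by adding one box. -/
def IsCover (μ ν : YoungDiagram) : Prop := μ ≤ ν ∧ ν.card = μ.card + 1

theorem isCover_iff {μ ν : YoungDiagram} :
    μ.IsCover ν ↔ ∃ i, ∀ k, ν.rowLen k = μ.rowLen k + if k = i then 1 else 0 := by
  constructor
  · rintro ⟨hle, hcard⟩
    rw [card_eq_sum_rowLen (μ := ν) (le_max_left _ (μ.colLen 0)),
      card_eq_sum_rowLen (μ := μ) (le_max_right (ν.colLen 0) _)] at hcard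
    refine exists_eq_add_ite (le_iff_rowLen.mp hle) (fun i hi => ?_) hcard
    rw [rowLen_eq_zero ((le_max_left _ _).trans hi), rowLen_eq_zero ((le_max_right _ _).trans hi)]
  · rintro ⟨i, hi⟩
    refine ⟨le_iff_rowLen.mpr fun k => by rw [hi k]; exact Nat.le_add_right _ _, ?_⟩
    set N := max (max (ν.colLen 0) (μ.colLen 0)) (i + 1)
    rw [card_eq_sum_rowLen (μ := ν) (N := N) (by omega),
      card_eq_sum_rowLen (μ := μ) (N := N) (by omega), Finset.sum_congr rfl fun k _ => hi k,
      Finset.sum_add_distrib, Finset.sum_ite_eq', if_pos (Finset.mem_range.mpr (by omega))]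

/-- Adding a box to row `i` raises the beta number of this row by one. -/
theorem beta_of_isCover {μ ν : YoungDiagram} {r i : ℕ} (hir : i < r)
    (h : ∀ k, ν.rowLen k = μ.rowLen k + if k = i then 1 else 0) {b : ℕ}
    (hb : b = μ.rowLen i + (r - (i + 1))) :
    b ∈ μ.beta r ∧ b + 1 ∉ μ.beta r ∧ ν.beta r = insert (b + 1) ((μ.beta r).erase b) := by
  have hi := h i
  rw [if_pos rfl] at hi
  have hne : ∀ k, k ≠ i → k < r → μ.rowLen k + (r - (k + 1)) ≠ b ∧
      μ.rowLen k + (r - (k + 1)) ≠ b + 1 := by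
    intro k hk hkr
    rcases lt_or_gt_of_ne hk with h' | h'
    · have h1 := ν.rowLen_anti k i h'.le
      rw [h k, if_neg hk] at h1
      omega
    · have h1 := μ.rowLen_anti i k h'.le
      omega
  refine ⟨Finset.mem_image.mpr ⟨i, Finset.mem_range.mpr hir, hb.symm⟩, ?_, ?_⟩
  · intro hmem
    obtain ⟨k, hk, hk'⟩ := Finset.mem_image.mp hmem
    by_cases hki : k = i
    · subst hki
      omega
    · exact (hne k hki (Finset.mem_range.mp hk)).2 hk'
  · ext x
    simp only [beta, Finset.mem_image, Finset.mem_range, Finset.mem_insert, Finset.mem_erase]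
    constructor
    · rintro ⟨k, hk, rfl⟩
      by_cases hki : k = i
      · subst hki
        left
        omega
      · rw [h k, if_neg hki, add_zero]
        exact Or.inr ⟨(hne k hki hk).1, k, hk, rfl⟩
    · rintro (rfl | ⟨hx, k, hk, rfl⟩)
      · exact ⟨i, hir, by omega⟩
      · refine ⟨k, hk, ?_⟩
        rw [h k, if_neg, add_zero]
        rintro rfl
        exact hx hb.symm

theorem beta_index_injective {μ : YoungDiagram} {r i j : ℕ} (hi : i < r) (hj : j < r)
    (h : μ.rowLen i + (r - (i + 1)) = μ.rowLen j + (r - (j + 1))) : i = j := by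
  rcases lt_trichotomy i j with h' | h' | h'
  · have := μ.rowLen_anti i j h'.le
    omega
  · exact h'
  · have := μ.rowLen_anti j i h'.le
    omega

/-- The branching rule `1 / H(μ) = ∑ 1 / H(μ⁺)`. -/
theorem sum_isCover_up {μ : YoungDiagram} {S : Finset YoungDiagram}
    (hS : ∀ ν, ν ∈ S ↔ μ.IsCover ν) :
    ∑ ν ∈ S, 1 / (ν.hookProd : ℚ) = 1 / (μ.hookProd : ℚ) := by
  -- one empty row more, so that a box can be added below the last row and `0` is a beta number
  set r := μ.colLen 0 + 1 with hr
  have h0 : 0 ∈ μ.beta r := by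
    refine Finset.mem_image.mpr ⟨μ.colLen 0, Finset.mem_range.mpr (by omega), ?_⟩
    rw [rowLen_eq_zero le_rfl]
    omega
  have h : ∀ ν ∈ S, ∃ i, ∀ k, ν.rowLen k = μ.rowLen k + if k = i then 1 else 0 :=
    fun ν hν => isCover_iff.mp ((hS ν).mp hν)
  choose! idx hidx using h
  have hlt : ∀ ν ∈ S, idx ν < r := by
    intro ν hν
    by_contra hcon
    have h1 := hidx ν hν (idx ν)
    have h2 := hidx ν hν (μ.colLen 0)
    have h3 := ν.rowLen_anti (μ.colLen 0) (idx ν) (by omega)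
    rw [if_pos rfl] at h1
    rw [if_neg (by omega), rowLen_eq_zero le_rfl] at h2
    omega
  rw [one_div_hookProd (show μ.colLen 0 ≤ r by omega), ← sum_betaWeight_up h0]
  refine Finset.sum_bij (fun ν _ => μ.rowLen (idx ν) + (r - (idx ν + 1))) ?_ ?_ ?_ ?_
  · intro ν hν
    have := beta_of_isCover (hlt ν hν) (hidx ν hν) rfl
    exact Finset.mem_filter.mpr ⟨this.1, this.2.1⟩
  · intro ν hν ν' hν' heq
    have h1 := beta_index_injective (hlt ν hν) (hlt ν' hν') heq
    exact ext_rowLen fun k => by rw [hidx ν hν k, hidx ν' hν' k, h1]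
  · intro b hb
    rw [Finset.mem_filter] at hb
    obtain ⟨i, hi, rfl⟩ := Finset.mem_image.mp hb.1
    rw [Finset.mem_range] at hi
    have hgt : ∀ k, k < i → μ.rowLen i < μ.rowLen k := by
      intro k hk
      have h1 := μ.rowLen_anti k (i - 1) (by omega)
      have h2 := μ.rowLen_anti (i - 1) i (by omega)
      by_contra hcon
      refine hb.2 (Finset.mem_image.mpr ⟨i - 1, Finset.mem_range.mpr (by omega), ?_⟩)
      omega
    obtain ⟨ν, hν⟩ := exists_rowLen (f := fun k => μ.rowLen k + if k = i then 1 else 0)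
      (N := r) (by
        intro k l hkl
        simp only
        have h1 := μ.rowLen_anti k l hkl
        split_ifs with hk hl hl
        · omega
        · have := hgt l
          have := hgt k
          subst hk
          omega
        · omega
        · omega) (by
        rw [rowLen_eq_zero (by omega), if_neg (by omega)])
    have hνS : ν ∈ S := (hS ν).mpr (isCover_iff.mpr ⟨i, hν⟩)
    refine ⟨ν, hνS, ?_⟩
    have h1 := hidx ν hνS i
    rw [hν i, if_pos rfl] at h1
    have : i = idx ν := by
      by_contra hcon
      rw [if_neg hcon] at h1
      omega
    rw [← this]
  · intro ν hν
    have h1 := hlt ν hν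
    rw [one_div_hookProd (r := r), (beta_of_isCover (hlt ν hν) (hidx ν hν) rfl).2.2]
    rw [colLen_zero_le_iff, hidx ν hν r, rowLen_eq_zero (by omega), if_neg (by omega)]

/-- The size of a partition in terms of its beta numbers. -/
theorem sum_beta {μ : YoungDiagram} {r : ℕ} (hr : μ.colLen 0 ≤ r) :
    ∑ b ∈ μ.beta r, (b : ℚ) - (μ.beta r).card * ((μ.beta r).card - 1) / 2 = μ.card := by
  have hinj : Set.InjOn (fun i => μ.rowLen i + (r - (i + 1))) (Finset.range r) :=
    fun i hi j hj h => beta_index_injective (Finset.mem_range.mp hi) (Finset.mem_range.mp hj) h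
  rw [beta, Finset.sum_image hinj, Finset.card_image_of_injOn hinj, Finset.card_range,
    card_eq_sum_rowLen hr]
  have h1 : ∑ i ∈ Finset.range r, ((r - (i + 1) : ℕ) : ℚ) = r * (r - 1) / 2 := by
    have h2 := Finset.sum_range_reflect (fun i => (i : ℚ)) r
    have h3 : ∀ n : ℕ, ∑ i ∈ Finset.range n, (i : ℚ) = n * (n - 1) / 2 := fun n => by
      induction n with
      | zero => simp
      | succ n ih =>
        rw [Finset.sum_range_succ, ih]
        push_cast
        ring
    rw [← h3, ← h2]
    refine Finset.sum_congr rfl fun i _ => ?_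
    rw [show r - (i + 1) = r - 1 - i by omega]
  push_cast
  rw [Finset.sum_add_distrib, h1]
  ring

/-- The branching rule `|μ| / H(μ) = ∑ 1 / H(μ⁻)`. -/
theorem sum_isCover_down {ν : YoungDiagram} {S : Finset YoungDiagram}
    (hS : ∀ μ, μ ∈ S ↔ μ.IsCover ν) :
    ∑ μ ∈ S, 1 / (μ.hookProd : ℚ) = ν.card * (1 / (ν.hookProd : ℚ)) := by
  set r := ν.colLen 0 with hr
  have h : ∀ μ ∈ S, ∃ i, ∀ k, ν.rowLen k = μ.rowLen k + if k = i then 1 else 0 :=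
    fun μ hμ => isCover_iff.mp ((hS μ).mp hμ)
  choose! idx hidx using h
  have hpos : ∀ μ ∈ S, ν.rowLen (idx μ) = μ.rowLen (idx μ) + 1 := fun μ hμ => by
    rw [hidx μ hμ (idx μ), if_pos rfl]
  have hlt : ∀ μ ∈ S, idx μ < r := by
    intro μ hμ
    by_contra hcon
    have h1 := hpos μ hμ
    rw [rowLen_eq_zero (not_lt.mp hcon)] at h1
    omega
  rw [one_div_hookProd (le_refl r), ← sum_beta (le_refl r), ← sum_betaWeight_down]
  have key : ∀ μ ∈ S, ∀ b, b = μ.rowLen (idx μ) + (r - (idx μ + 1)) →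
      b + 1 ∈ ν.beta r ∧ b ∉ ν.beta r ∧ μ.beta r = insert b ((ν.beta r).erase (b + 1)) := by
    intro μ hμ b hb
    obtain ⟨h1, h2, h3⟩ := beta_of_isCover (hlt μ hμ) (hidx μ hμ) hb
    refine ⟨by rw [h3]; exact Finset.mem_insert_self _ _, ?_, ?_⟩
    · rw [h3, Finset.mem_insert, not_or]
      exact ⟨by omega, Finset.notMem_erase _ _⟩
    · rw [h3, Finset.erase_insert fun h => h2 (Finset.mem_of_mem_erase h), Finset.insert_erase h1]
  refine Finset.sum_bij (fun μ _ => ν.rowLen (idx μ) + (r - (idx μ + 1))) ?_ ?_ ?_ ?_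
  · intro μ hμ
    obtain ⟨h1, h2, -⟩ := key μ hμ _ rfl
    have h3 := hpos μ hμ
    have h4 : ν.rowLen (idx μ) + (r - (idx μ + 1)) =
      μ.rowLen (idx μ) + (r - (idx μ + 1)) + 1 := by omega
    rw [h4, Finset.mem_filter]
    exact ⟨h1, by omega, h2⟩
  · intro μ hμ μ' hμ' heq
    have h1 := beta_index_injective (hlt μ hμ) (hlt μ' hμ') heq
    refine ext_rowLen fun k => ?_
    have h2 := hidx μ hμ k
    have h3 := hidx μ' hμ' k
    rw [h1] at h2
    omega
  · intro b hb
    rw [Finset.mem_filter] at hb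
    obtain ⟨i, hi, rfl⟩ := Finset.mem_image.mp hb.1
    rw [Finset.mem_range] at hi
    have hgt : ∀ k, i < k → ν.rowLen k < ν.rowLen i := by
      intro k hk
      have h1 := ν.rowLen_anti (i + 1) k (by omega)
      have h2 := ν.rowLen_anti i (i + 1) (by omega)
      by_contra hcon
      by_cases hir : i + 1 < r
      · refine hb.2.2 (Finset.mem_image.mpr ⟨i + 1, Finset.mem_range.mpr hir, ?_⟩)
        omega
      · rw [rowLen_eq_zero (i := i + 1) (by omega)] at h1
        omega
    have hi0 := hgt (i + 1) (by omega)
    obtain ⟨μ, hμ⟩ := exists_rowLen (f := fun k => ν.rowLen k - if k = i then 1 else 0)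
      (N := r) (by
        intro k l hkl
        simp only
        have h1 := ν.rowLen_anti k l hkl
        split_ifs with hl hk hk
        · omega
        · omega
        · subst hk
          have := hgt l (by omega)
          omega
        · omega) (by
        rw [rowLen_eq_zero (by omega)]
        omega)
    have hcov : ∀ k, ν.rowLen k = μ.rowLen k + if k = i then 1 else 0 := by
      intro k
      rw [hμ k]
      split_ifs with hk
      · subst hk
        omega
      · omega
    have hμS : μ ∈ S := (hS μ).mpr (isCover_iff.mpr ⟨i, hcov⟩)
    refine ⟨μ, hμS, ?_⟩
    have h1 := hidx μ hμS i
    rw [hcov i, if_pos rfl] at h1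
    have : i = idx μ := by
      by_contra hcon
      rw [if_neg hcon] at h1
      omega
    rw [← this]
  · intro μ hμ
    obtain ⟨-, -, h3⟩ := key μ hμ _ rfl
    have h4 := hpos μ hμ
    have h5 : ν.rowLen (idx μ) + (r - (idx μ + 1)) =
      μ.rowLen (idx μ) + (r - (idx μ + 1)) + 1 := by omega
    rw [one_div_hookProd (r := r), h3, h5, Nat.add_sub_cancel]
    have h6 := hidx μ hμ r
    rw [rowLen_eq_zero (μ := ν) (le_refl r)] at h6
    rw [colLen_zero_le_iff]
    omega

end YoungDiagram

namespace StrictPartition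

theorem ext_part {s r : StrictPartition} (h : ∀ i, s.part i = r.part i) : s = r := by
  have : s.double = r.double := by
    ext ⟨i, j⟩
    rw [YoungDiagram.mem_cells, YoungDiagram.mem_cells, mem_double, mem_double, h, h]
  rw [← s.halve_double, this, r.halve_double]

theorem exists_part {f : ℕ → ℕ} (hf : ∀ i j, i < j → 0 < f j → f j < f i) {N : ℕ}
    (hN : f N = 0) : ∃ s : StrictPartition, ∀ i, s.part i = f i := by
  classical
  have hex : ∃ n, f n = 0 := ⟨N, hN⟩
  set M := Nat.find hex with hM
  have hpos : ∀ i, i < M → 0 < f i := fun i hi => Nat.pos_of_ne_zero (Nat.find_min hex hi)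
  let s : StrictPartition :=
    { parts := List.ofFn fun i : Fin M => f i
      sorted := by
        apply List.Pairwise.sortedGT
        rw [List.pairwise_ofFn]
        exact fun i j hij => hf i j hij (hpos j j.2)
      pos := by
        intro x hx
        rw [List.mem_ofFn] at hx
        obtain ⟨i, rfl⟩ := hx
        exact hpos i i.2 }
  refine ⟨s, fun i => ?_⟩
  by_cases hi : i < M
  · rw [part, List.getD_eq_getElem _ _ (by simpa [s] using hi)]
    simp [s]
  · rw [s.part_eq_zero (by simpa [s, length] using hi)]
    by_contra hcon
    have h1 : f M = 0 := Nat.find_spec hex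
    rcases eq_or_lt_of_le (not_lt.mp hi) with h | h
    · rw [h] at h1
      exact hcon h1.symm
    · have := hf M i h (Nat.pos_of_ne_zero (Ne.symm hcon))
      omega

/-- The strict partition `s` arises from `r` by adding one box to the shifted diagram. -/
def IsCover (r s : StrictPartition) : Prop := s.Contains r ∧ s.size = r.size + 1

theorem isCover_iff {r s : StrictPartition} :
    r.IsCover s ↔ ∃ i, ∀ k, s.part k = r.part k + if k = i then 1 else 0 := by
  constructor
  · rintro ⟨hle, hsize⟩
    rw [s.size_eq_sum_part (le_max_left _ r.length),
      r.size_eq_sum_part (le_max_right s.length _)] at hsize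
    refine exists_eq_add_ite hle (fun i hi => ?_) hsize
    rw [s.part_eq_zero ((le_max_left _ _).trans hi), r.part_eq_zero ((le_max_right _ _).trans hi)]
  · rintro ⟨i, hi⟩
    refine ⟨fun k => by rw [hi k]; exact Nat.le_add_right _ _, ?_⟩
    set N := max (max s.length r.length) (i + 1)
    rw [s.size_eq_sum_part (N := N) (by omega), r.size_eq_sum_part (N := N) (by omega),
      Finset.sum_congr rfl fun k _ => hi k,
      Finset.sum_add_distrib, Finset.sum_ite_eq', if_pos (Finset.mem_range.mpr (by omega))]

theorem mem_partSet_iff_part {s : StrictPartition} {x : ℕ} :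
    x ∈ s.partSet ↔ 0 < x ∧ ∃ i, s.part i = x := by
  rw [partSet, List.mem_toFinset, mem_parts_iff]

theorem part_injective {s : StrictPartition} {i j : ℕ} (hi : 0 < s.part i)
    (h : s.part i = s.part j) : i = j := by
  rcases lt_trichotomy i j with h' | h' | h'
  · have := s.part_lt h' (by omega)
    omega
  · exact h'
  · have := s.part_lt h' hi
    omega

/-- Adding a box to row `i` raises the part in this row by one; the part may be zero before. -/
theorem partSet_of_isCover {r s : StrictPartition} {i : ℕ}
    (h : ∀ k, s.part k = r.part k + if k = i then 1 else 0) {x : ℕ} (hx : x = r.part i) :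
    x ∈ insert 0 r.partSet ∧ x + 1 ∉ r.partSet ∧
      s.partSet = insert (x + 1) (r.partSet.erase x) := by
  have hi := h i
  rw [if_pos rfl, ← hx] at hi
  have hne : ∀ k, k ≠ i → r.part k ≠ x + 1 := fun k hk heq => by
    have h1 := h k
    rw [if_neg hk, add_zero, heq, ← hi] at h1
    exact hk (part_injective (by omega) h1)
  refine ⟨?_, ?_, ?_⟩
  · rw [Finset.mem_insert, mem_partSet_iff_part]
    rcases Nat.eq_zero_or_pos x with h0 | h0
    · exact Or.inl h0
    · exact Or.inr ⟨h0, i, hx.symm⟩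
  · rw [mem_partSet_iff_part]
    rintro ⟨-, k, hk⟩
    refine hne k ?_ hk
    rintro rfl
    omega
  · ext y
    simp only [Finset.mem_insert, Finset.mem_erase, mem_partSet_iff_part]
    constructor
    · rintro ⟨hy, k, rfl⟩
      by_cases hk : k = i
      · subst hk
        exact Or.inl hi
      · have h1 := h k
        rw [if_neg hk, add_zero] at h1
        rw [h1] at hy ⊢
        refine Or.inr ⟨fun heq => hk (part_injective hy (heq.trans hx)), hy, k, rfl⟩
    · rintro (rfl | ⟨h1, h2, k, rfl⟩)
      · exact ⟨by omega, i, hi⟩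
      · refine ⟨h2, k, ?_⟩
        rw [h k, if_neg, add_zero]
        rintro rfl
        exact h1 hx.symm

/-- The branching rule for `2 ^ (|s| - ℓ(s)) / H(s)`, summed over the strict partitions with one
more box. -/
theorem sum_isCover_up {r : StrictPartition} {S : Finset StrictPartition}
    (hS : ∀ s, s ∈ S ↔ r.IsCover s) :
    ∑ s ∈ S, (2 : ℚ) ^ ((s.size : ℤ) - s.length) * (1 / (s.hookProd : ℚ)) =
      (2 : ℚ) ^ ((r.size : ℤ) - r.length) * (1 / (r.hookProd : ℚ)) := by
  have h : ∀ s ∈ S, ∃ i, ∀ k, s.part k = r.part k + if k = i then 1 else 0 :=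
    fun s hs => isCover_iff.mp ((hS s).mp hs)
  choose! idx hidx using h
  rw [r.one_div_hookProd, ← sum_strictWeight_up r.zero_notMem_partSet, Finset.mul_sum]
  have hinj : ∀ s ∈ S, ∀ s' ∈ S, r.part (idx s) = r.part (idx s') → s = s' := by
    intro s hs s' hs' heq
    suffices h : idx s = idx s' from
      ext_part fun k => by rw [hidx s hs k, hidx s' hs' k, h]
    rcases Nat.eq_zero_or_pos (r.part (idx s)) with h0 | h0
    · -- both rows are the first empty row of `r`
      have key : ∀ s ∈ S, r.part (idx s) = 0 → ∀ j < idx s, r.part j ≠ 0 := by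
        intro s hs h0 j hj hj0
        have h1 := hidx s hs (idx s)
        have h2 := hidx s hs j
        rw [if_pos rfl] at h1
        rw [if_neg hj.ne, hj0] at h2
        have := s.part_lt hj (by omega)
        omega
      rcases lt_trichotomy (idx s) (idx s') with h' | h' | h'
      · exact absurd h0 (key s' hs' (heq ▸ h0) _ h')
      · exact h'
      · exact absurd (heq ▸ h0) (key s hs h0 _ h')
    · exact part_injective h0 heq
  refine Finset.sum_bij (fun s _ => r.part (idx s)) ?_ ?_ ?_ ?_
  · intro s hs
    have := partSet_of_isCover (hidx s hs) rfl
    exact Finset.mem_filter.mpr ⟨this.1, this.2.1⟩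
  · exact fun s hs s' hs' heq => hinj s hs s' hs' heq
  · intro x hx
    rw [Finset.mem_filter, Finset.mem_insert, mem_partSet_iff_part] at hx
    obtain ⟨i, hi, hpos⟩ : ∃ i, r.part i = x ∧ ∀ k < i, 0 < r.part k := by
      rcases hx.1 with rfl | ⟨h0, i, hi⟩
      · refine ⟨r.length, r.part_eq_zero le_rfl, fun k hk => ?_⟩
        rw [part, List.getD_eq_getElem _ _ hk]
        exact r.pos _ (List.getElem_mem hk)
      · refine ⟨i, hi, fun k hk => ?_⟩
        have := r.part_lt hk (by omega)
        omega
    have hgt : ∀ k < i, x + 1 < r.part k := by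
      intro k hk
      have h1 : x < r.part k := by
        rcases Nat.eq_zero_or_pos x with h0 | h0
        · rw [h0]
          exact hpos k hk
        · rw [← hi]
          exact r.part_lt hk (by omega)
      have h2 : r.part k ≠ x + 1 := fun h => hx.2 (mem_partSet_iff_part.mpr ⟨by omega, k, h⟩)
      omega
    obtain ⟨s, hs⟩ := exists_part (f := fun k => r.part k + if k = i then 1 else 0)
      (N := max r.length (i + 1)) (by
        intro k l hkl h0
        split_ifs at h0 ⊢ with hl hk hk
        · omega
        · subst hl
          have := hgt k hkl
          omega
        · have := r.part_lt hkl (by omega)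
          omega
        · have := r.part_lt hkl (by omega)
          omega) (by
        rw [r.part_eq_zero (le_max_left _ _), if_neg (by omega)])
    have hsS : s ∈ S := (hS s).mpr (isCover_iff.mpr ⟨i, hs⟩)
    refine ⟨s, hsS, ?_⟩
    have h1 := hidx s hsS i
    rw [hs i, if_pos rfl] at h1
    have : i = idx s := by
      by_contra hcon
      rw [if_neg hcon] at h1
      omega
    rw [← this, hi]
  · intro s hs
    obtain ⟨h1, h2, h3⟩ := partSet_of_isCover (hidx s hs) rfl
    have hsize : s.size = r.size + 1 := ((hS s).mp hs).2
    have hcard := congrArg Finset.card h3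
    rw [Finset.card_insert_of_notMem fun h => h2 (Finset.mem_of_mem_erase h), card_partSet] at hcard
    rw [s.one_div_hookProd, h3, hsize, ← mul_assoc]
    congr 1
    split_ifs with h0
    · rw [h0, Finset.erase_eq_of_notMem r.zero_notMem_partSet, card_partSet] at hcard
      rw [hcard, mul_one]
      push_cast
      congr 1
      ring
    · have hmem := (Finset.mem_insert.mp h1).resolve_left h0
      rw [Finset.card_erase_add_one hmem, card_partSet] at hcard
      rw [hcard, ← zpow_add_one₀ two_ne_zero]
      push_cast
      congr 1
      ring

/-- The branching rule `|s| / H(s) = ∑ 1 / H(s⁻)`. -/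
theorem sum_isCover_down {s : StrictPartition} {S : Finset StrictPartition}
    (hS : ∀ r, r ∈ S ↔ r.IsCover s) :
    ∑ r ∈ S, 1 / (r.hookProd : ℚ) = s.size * (1 / (s.hookProd : ℚ)) := by
  have h : ∀ r ∈ S, ∃ i, ∀ k, s.part k = r.part k + if k = i then 1 else 0 :=
    fun r hr => isCover_iff.mp ((hS r).mp hr)
  choose! idx hidx using h
  have hpos : ∀ r ∈ S, s.part (idx r) = r.part (idx r) + 1 := fun r hr => by
    rw [hidx r hr (idx r), if_pos rfl]
  rw [s.one_div_hookProd, ← s.sum_partSet, Nat.cast_sum,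
    ← sum_strictWeight_down s.zero_notMem_partSet]
  refine Finset.sum_bij (fun r _ => s.part (idx r)) ?_ ?_ ?_ ?_
  · intro r hr
    obtain ⟨-, h2, h3⟩ := partSet_of_isCover (hidx r hr) rfl
    rw [hpos r hr, Finset.mem_filter, Nat.add_sub_cancel, h3]
    refine ⟨Finset.mem_insert_self _ _, ?_⟩
    rw [Finset.mem_insert, not_or]
    exact ⟨by omega, Finset.notMem_erase _ _⟩
  · intro r hr r' hr' heq
    have h1 := part_injective (by rw [hpos r hr]; omega) heq
    refine ext_part fun k => ?_
    have h2 := hidx r hr k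
    have h3 := hidx r' hr' k
    rw [h1] at h2
    omega
  · intro x hx
    rw [Finset.mem_filter] at hx
    obtain ⟨h0, i, hi⟩ := mem_partSet_iff_part.mp hx.1
    have hlt : ∀ k, i < k → 0 < s.part k → s.part k + 1 < x := by
      intro k hk hk0
      have h1 := s.part_lt hk hk0
      have h2 : s.part k ≠ x - 1 := fun h => hx.2 (mem_partSet_iff_part.mpr ⟨by omega, k, h⟩)
      omega
    obtain ⟨r, hr⟩ := exists_part (f := fun k => s.part k - if k = i then 1 else 0)
      (N := s.length) (by
        intro k l hkl h0
        have h1 := s.part_lt hkl (by omega)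
        split_ifs at h0 ⊢ with hl hk hk
        · omega
        · omega
        · subst hk
          have := hlt l hkl (by omega)
          omega
        · omega) (by
        rw [s.part_eq_zero le_rfl]
        omega)
    have hcov : ∀ k, s.part k = r.part k + if k = i then 1 else 0 := by
      intro k
      rw [hr k]
      split_ifs with hk
      · subst hk
        omega
      · omega
    have hrS : r ∈ S := (hS r).mpr (isCover_iff.mpr ⟨i, hcov⟩)
    refine ⟨r, hrS, ?_⟩
    have h1 := hidx r hrS i
    rw [hcov i, if_pos rfl] at h1
    have : i = idx r := by
      by_contra hcon
      rw [if_neg hcon] at h1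
      omega
    rw [← this, hi]
  · intro r hr
    obtain ⟨h1, h2, h3⟩ := partSet_of_isCover (hidx r hr) rfl
    rw [hpos r hr, Nat.add_sub_cancel, h3,
      Finset.erase_insert fun h => h2 (Finset.mem_of_mem_erase h), r.one_div_hookProd]
    rcases Finset.mem_insert.mp h1 with h0 | hmem
    · rw [h0, Finset.erase_eq_of_notMem r.zero_notMem_partSet,
        strictWeight_insert_zero r.zero_notMem_partSet]
    · rw [Finset.insert_erase hmem]

end StrictPartition

/-! ### Finiteness and sizes -/

namespace YoungDiagram

theorem finite_card_eq (n : ℕ) : {μ : YoungDiagram | μ.card = n}.Finite := by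
  refine Set.Finite.of_finite_image (f := cells) ?_ fun a _ b _ h => YoungDiagram.ext h
  refine ((Finset.range n ×ˢ Finset.range n).powerset.finite_toSet).subset ?_
  rintro _ ⟨μ, rfl, rfl⟩
  simp only [Finset.coe_powerset, Set.mem_preimage, Set.mem_powerset_iff, Finset.coe_subset]
  rintro ⟨i, j⟩ hc
  rw [mem_cells] at hc
  have h1 : μ.rowLen i ≤ μ.card := by
    rw [rowLen_eq_card]
    exact Finset.card_le_card (Finset.filter_subset _ _)
  have h2 : μ.colLen j ≤ μ.card := by
    rw [colLen_eq_card]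
    exact Finset.card_le_card (Finset.filter_subset _ _)
  have h3 := mem_iff_lt_rowLen.mp hc
  have h4 := mem_iff_lt_colLen.mp hc
  simp only [Finset.mem_product, Finset.mem_range]
  omega

theorem not_isCover_self (μ : YoungDiagram) : ¬ μ.IsCover μ := fun h => by
  have := h.2
  omega

theorem finite_isCover_up (μ : YoungDiagram) : {ν | μ.IsCover ν}.Finite :=
  (finite_card_eq (μ.card + 1)).subset fun _ h => h.2

theorem finite_isCover_down (ν : YoungDiagram) : {μ : YoungDiagram | μ.IsCover ν}.Finite :=
  (finite_card_eq (ν.card - 1)).subset fun μ h => by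
    have := h.2
    simp only [Set.mem_ofPred_eq]
    omega

theorem card_mono {μ ν : YoungDiagram} (h : μ ≤ ν) : μ.card ≤ ν.card :=
  Finset.card_le_card (cells_subset_iff.mpr h)

theorem eq_of_le_of_card_eq {μ ν : YoungDiagram} (h : μ ≤ ν) (hc : ν.card = μ.card) : ν = μ :=
  (YoungDiagram.ext (Finset.eq_of_subset_of_card_le (cells_subset_iff.mpr h) hc.le)).symm

theorem eq_bot_of_card_eq_zero {μ : YoungDiagram} (h : μ.card = 0) : μ = ⊥ :=
  eq_of_le_of_card_eq bot_le (by rw [h]; rfl)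

theorem hookProd_bot : (⊥ : YoungDiagram).hookProd = 1 := rfl

end YoungDiagram

namespace StrictPartition

theorem double_injective : Function.Injective double := fun s r h => by
  rw [← s.halve_double, h, r.halve_double]

theorem finite_size_eq (n : ℕ) : {s : StrictPartition | s.size = n}.Finite := by
  refine ((YoungDiagram.finite_card_eq (2 * n)).preimage double_injective.injOn).subset ?_
  rintro s rfl
  exact s.card_double

theorem not_isCover_self (s : StrictPartition) : ¬ s.IsCover s := fun h => by
  have := h.2
  omega

theorem finite_isCover_up (r : StrictPartition) : {s | r.IsCover s}.Finite :=
  (finite_size_eq (r.size + 1)).subset fun _ h => h.2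

theorem finite_isCover_down (s : StrictPartition) : {r : StrictPartition | r.IsCover s}.Finite :=
  (finite_size_eq (s.size - 1)).subset fun r h => by
    have := h.2
    simp only [Set.mem_ofPred_eq]
    omega

theorem Contains.size_le {s r : StrictPartition} (h : s.Contains r) : r.size ≤ s.size := by
  rw [s.size_eq_sum_part (le_max_left _ r.length), r.size_eq_sum_part (le_max_right s.length _)]
  exact Finset.sum_le_sum fun i _ => h i

theorem Contains.eq_of_size_eq {s r : StrictPartition} (h : s.Contains r)
    (hs : s.size = r.size) : s = r := by
  rw [s.size_eq_sum_part (le_max_left _ r.length),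
    r.size_eq_sum_part (le_max_right s.length _)] at hs
  refine ext_part fun i => ?_
  by_cases hi : i < max s.length r.length
  · exact ((Finset.sum_eq_sum_iff_of_le fun i _ => h i).mp hs.symm i (Finset.mem_range.mpr hi)).symm
  · rw [s.part_eq_zero (by omega), r.part_eq_zero (by omega)]

theorem contains_of_size_eq_zero {s r : StrictPartition} (h : r.size = 0) : s.Contains r := by
  intro i
  rw [r.size_eq_sum_part (le_max_left _ (i + 1)), Finset.sum_eq_zero_iff] at h
  rw [h i (Finset.mem_range.mpr (by omega))]
  exact Nat.zero_le _

theorem length_eq_zero {s : StrictPartition} (h : s.size = 0) : s.length = 0 := by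
  rw [← card_partSet, Finset.card_eq_zero, Finset.eq_empty_iff_forall_notMem]
  intro x hx
  have h1 := Finset.single_le_sum (f := fun x => x) (fun _ _ => Nat.zero_le _) hx
  rw [sum_partSet] at h1
  have h2 := (mem_partSet.mp hx).1
  omega

theorem hookProd_eq_one {s : StrictPartition} (h : s.size = 0) : s.hookProd = 1 := by
  rw [hookProd, shiftedCells, length_eq_zero h]
  rfl

end StrictPartition

/-! ### The quotient of a doubled distinct partition -/

/-- A product over `0, …, t - 1`, for odd `t`, whose factors at `k` and `t - k` agree. -/
@[to_additive]
theorem prod_range_of_symm {M : Type*} [CommMonoid M] {t : ℕ} (ht : Odd t) {F : ℕ → M}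
    (hF : ∀ k, 1 ≤ k → k < t → F (t - k) = F k) :
    ∏ k ∈ Finset.range t, F k = F 0 * (∏ i ∈ Finset.Icc 1 (t / 2), F i) ^ 2 := by
  obtain ⟨m, rfl⟩ := ht
  rw [show (2 * m + 1) / 2 = m by omega, Finset.prod_range_succ', mul_comm, two_mul,
    Finset.prod_range_add, pow_two]
  have h1 : ∏ i ∈ Finset.Icc 1 m, F i = ∏ k ∈ Finset.range m, F (k + 1) := by
    rw [Finset.range_eq_Ico, Finset.prod_Ico_add' F 0 m 1, zero_add]
    rfl
  have h2 : ∏ k ∈ Finset.range m, F (m + k + 1) = ∏ k ∈ Finset.range m, F (k + 1) := by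
    refine Finset.prod_bij' (fun k _ => m - 1 - k) (fun k _ => m - 1 - k) ?_ ?_ ?_ ?_ ?_
    iterate 4
      intro k hk
      rw [Finset.mem_range] at *
      omega
    intro k hk
    rw [Finset.mem_range] at hk
    rw [← hF (m - 1 - k + 1) (by omega) (by omega)]
    congr 1
    omega
  rw [h1, h2]

namespace DoubledDistinct

variable {t : ℕ} [NeZero t]

theorem card_littlewoodQuotient_sub (lam : DoubledDistinct) {k : ℕ} (h1 : 1 ≤ k) (hk : k < t) :
    (lam.diagram.littlewoodQuotient t (t - k)).card =
      (lam.diagram.littlewoodQuotient t k).card := by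
  rw [YoungDiagram.littlewoodQuotient, lam.isDouble_edgeWord.residue_sub h1 hk,
    EdgeWord.card_reflect, YoungDiagram.littlewoodQuotient]

theorem hookProd_littlewoodQuotient_sub (lam : DoubledDistinct) {k : ℕ} (h1 : 1 ≤ k)
    (hk : k < t) : (lam.diagram.littlewoodQuotient t (t - k)).hookProd =
      (lam.diagram.littlewoodQuotient t k).hookProd := by
  rw [YoungDiagram.littlewoodQuotient, lam.isDouble_edgeWord.residue_sub h1 hk,
    EdgeWord.hookProd_reflect, YoungDiagram.littlewoodQuotient]

theorem sum_card_littlewoodQuotient (ht : Odd t) (lam : DoubledDistinct) :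
    ∑ k ∈ Finset.range t, (lam.diagram.littlewoodQuotient t k).card = 2 * lam.weight t := by
  rw [sum_range_of_symm ht fun k h1 hk => lam.card_littlewoodQuotient_sub h1 hk,
    littlewoodQuotient_zero, StrictPartition.card_double, weight, smul_eq_mul, mul_add]

theorem card_hooksMod (ht : Odd t) (lam : DoubledDistinct) :
    (lam.diagram.hooksMod t).card = 2 * lam.weight t := by
  rw [← sum_card_littlewoodQuotient ht, ← lam.diagram.diagram_edgeWord,
    EdgeWord.card_hooksMod_diagram, YoungDiagram.diagram_edgeWord]
  rfl

theorem card_eq (ht : Odd t) (lam : DoubledDistinct) :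
    lam.diagram.card = (lam.diagram.littlewoodCore t).card + 2 * lam.weight t * t := by
  have h := EdgeWord.card_diagram_eq lam.diagram.edgeWord t
  rw [YoungDiagram.diagram_edgeWord] at h
  rw [← sum_card_littlewoodQuotient ht, mul_comm _ t]
  exact h

/-- The product of the hook lengths divisible by `t`; the components `λ^k` and `λ^(t - k)` are
conjugate and contribute equally. -/
theorem hookProdMod_eq (ht : Odd t) (lam : DoubledDistinct) :
    lam.diagram.hookProdMod t = t ^ (2 * lam.weight t) *
      (2 ^ (lam.bar0 t).length * (lam.bar0 t).hookProd ^ 2 *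
        (∏ i ∈ Finset.Icc 1 (t / 2), (lam.diagram.littlewoodQuotient t i).hookProd) ^ 2) := by
  have h := EdgeWord.hookProdMod_diagram lam.diagram.edgeWord t
  rw [YoungDiagram.diagram_edgeWord, Finset.prod_mul_distrib, Finset.prod_pow_eq_pow_sum] at h
  rw [← sum_card_littlewoodQuotient ht, h, ← StrictPartition.hookProd_double,
    ← littlewoodQuotient_zero]
  congr 1
  exact prod_range_of_symm ht fun k h1 hk => lam.hookProd_littlewoodQuotient_sub h1 hk

/-! ### The order `≥_t` one step at a time -/

theorem mem_ofSize {n : ℕ} {lam : DoubledDistinct} : lam ∈ ofSize n ↔ lam.diagram.card = n := by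
  simp [ofSize]

/-- Above `mu` with respect to `≥_t`, the size is measured by the weight. -/
theorem mem_above (ht : Odd t) {lam mu : DoubledDistinct} {n : ℕ} :
    lam ∈ mu.above t n ↔ lam.GeT t mu ∧ lam.weight t = mu.weight t + n := by
  classical
  rw [above, Finset.mem_filter, mem_ofSize, and_comm]
  refine and_congr_right fun h => ?_
  have h1 := card_eq ht lam
  have h2 := card_eq ht mu
  rw [h.1] at h1
  have htpos : 0 < t := Nat.pos_of_ne_zero (NeZero.ne t)
  rw [h1, h2, add_assoc, add_right_inj, ← add_mul, ← mul_add, Nat.mul_left_inj htpos.ne']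
  omega

/-- A step up in the order `≥_t` adds one box to exactly one component. -/
theorem mem_above_one (ht : Odd t) {lam nu : DoubledDistinct} :
    nu ∈ lam.above t 1 ↔ nu.diagram.littlewoodCore t = lam.diagram.littlewoodCore t ∧
      (((lam.bar0 t).IsCover (nu.bar0 t) ∧ ∀ i ∈ Finset.Icc 1 (t / 2),
        nu.diagram.littlewoodQuotient t i = lam.diagram.littlewoodQuotient t i) ∨
      (nu.bar0 t = lam.bar0 t ∧ ∃ i ∈ Finset.Icc 1 (t / 2),
        (lam.diagram.littlewoodQuotient t i).IsCover (nu.diagram.littlewoodQuotient t i) ∧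
        ∀ j ∈ Finset.Icc 1 (t / 2), j ≠ i →
          nu.diagram.littlewoodQuotient t j = lam.diagram.littlewoodQuotient t j)) := by
  rw [mem_above ht, GeT, and_assoc]
  refine and_congr_right fun _ => ?_
  simp only [weight]
  constructor
  · rintro ⟨⟨h1, h2⟩, hw⟩
    have h3 := h1.size_le
    have hle : ∀ i ∈ Finset.Icc 1 (t / 2), (lam.diagram.littlewoodQuotient t i).card ≤
        (nu.diagram.littlewoodQuotient t i).card := fun i hi => YoungDiagram.card_mono (h2 i hi)
    have h4 := Finset.sum_le_sum hle
    by_cases hs : (nu.bar0 t).size = (lam.bar0 t).size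
    · obtain ⟨i, hi, hi', hk⟩ := exists_eq_add_one_of_sum_eq hle (by omega)
      exact Or.inr ⟨h1.eq_of_size_eq hs, i, hi, ⟨h2 i hi, hi'⟩, fun j hj hji =>
        YoungDiagram.eq_of_le_of_card_eq (h2 j hj) (hk j hj hji)⟩
    · have h5 := (Finset.sum_eq_sum_iff_of_le hle).mp (by omega)
      exact Or.inl ⟨⟨h1, by omega⟩, fun i hi =>
        YoungDiagram.eq_of_le_of_card_eq (h2 i hi) (h5 i hi).symm⟩
  · rintro (⟨h1, h2⟩ | ⟨h1, i, hi, h2, h3⟩)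
    · refine ⟨⟨h1.1, fun i hi => (h2 i hi).ge⟩, ?_⟩
      rw [Finset.sum_congr rfl fun i hi => by rw [h2 i hi], h1.2]
      ring
    · refine ⟨⟨fun k => by rw [h1], fun j hj => ?_⟩, ?_⟩
      · by_cases hji : j = i
        · rw [hji]
          exact h2.1
        · exact (h3 j hj hji).ge
      · rw [h1, ← Finset.add_sum_erase _ _ hi, ← Finset.add_sum_erase _ _ hi, h2.2,
          Finset.sum_congr rfl fun j hj => by
            rw [h3 j (Finset.mem_of_mem_erase hj) (Finset.ne_of_mem_erase hj)]]
        ring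

/-- A sum of products over the doubled distinct partitions that arise from `lam` by exchanging one
component, either `λ̄⁰` by an element of `U` or `λ^i` by an element of `V i`. -/
theorem sum_exchange (ht : Odd t) (lam : DoubledDistinct) (S : Finset DoubledDistinct)
    (U : Finset StrictPartition) (V : ℕ → Finset YoungDiagram) (hU : lam.bar0 t ∉ U)
    (hV : ∀ i, lam.diagram.littlewoodQuotient t i ∉ V i)
    (hS : ∀ nu, nu ∈ S ↔ nu.diagram.littlewoodCore t = lam.diagram.littlewoodCore t ∧
      ((nu.bar0 t ∈ U ∧ ∀ i ∈ Finset.Icc 1 (t / 2),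
        nu.diagram.littlewoodQuotient t i = lam.diagram.littlewoodQuotient t i) ∨
      (nu.bar0 t = lam.bar0 t ∧ ∃ i ∈ Finset.Icc 1 (t / 2),
        nu.diagram.littlewoodQuotient t i ∈ V i ∧ ∀ j ∈ Finset.Icc 1 (t / 2), j ≠ i →
          nu.diagram.littlewoodQuotient t j = lam.diagram.littlewoodQuotient t j)))
    (a : StrictPartition → ℚ) (b : YoungDiagram → ℚ) :
    ∑ nu ∈ S, a (nu.bar0 t) * ∏ i ∈ Finset.Icc 1 (t / 2), b (nu.diagram.littlewoodQuotient t i) =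
      (∑ s ∈ U, a s) * ∏ i ∈ Finset.Icc 1 (t / 2), b (lam.diagram.littlewoodQuotient t i) +
      a (lam.bar0 t) * ∑ i ∈ Finset.Icc 1 (t / 2), (∑ y ∈ V i, b y) *
        ∏ j ∈ (Finset.Icc 1 (t / 2)).erase i, b (lam.diagram.littlewoodQuotient t j) := by
  classical
  rw [← Finset.sum_filter_add_sum_filter_not S fun nu => nu.bar0 t ∈ U]
  congr 1
  · rw [Finset.sum_mul]
    have hmem : ∀ nu ∈ S.filter (fun nu => nu.bar0 t ∈ U),
        nu.diagram.littlewoodCore t = lam.diagram.littlewoodCore t ∧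
        ∀ i ∈ Finset.Icc 1 (t / 2),
          nu.diagram.littlewoodQuotient t i = lam.diagram.littlewoodQuotient t i := by
      intro nu hnu
      rw [Finset.mem_filter, hS] at hnu
      refine ⟨hnu.1.1, hnu.1.2.elim (fun h => h.2) fun h => ?_⟩
      exact absurd (h.1 ▸ hnu.2) hU
    refine Finset.sum_bij (fun nu _ => nu.bar0 t) ?_ ?_ ?_ ?_
    · exact fun nu hnu => (Finset.mem_filter.mp hnu).2
    · intro nu hnu nu' hnu' heq
      obtain ⟨h1, h2⟩ := hmem nu hnu
      obtain ⟨h1', h2'⟩ := hmem nu' hnu'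
      exact eq_of_components ht (h1.trans h1'.symm) heq fun i hi =>
        (h2 i hi).trans (h2' i hi).symm
    · intro s hs
      obtain ⟨nu, h1, h2, h3⟩ := exists_of_components ht lam s fun i =>
        lam.diagram.littlewoodQuotient t i
      refine ⟨nu, Finset.mem_filter.mpr ⟨(hS nu).mpr ⟨h1, Or.inl ⟨h2 ▸ hs, h3⟩⟩, h2 ▸ hs⟩, h2⟩
    · intro nu hnu
      rw [Finset.prod_congr rfl fun i hi => by rw [(hmem nu hnu).2 i hi]]
  · rw [Finset.mul_sum]
    simp only [Finset.sum_mul, Finset.mul_sum]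
    rw [Finset.sum_sigma']
    symm
    have hex : ∀ x : Σ _ : ℕ, YoungDiagram, ∃ nu : DoubledDistinct,
        nu.diagram.littlewoodCore t = lam.diagram.littlewoodCore t ∧
        nu.bar0 t = lam.bar0 t ∧ ∀ i ∈ Finset.Icc 1 (t / 2),
          nu.diagram.littlewoodQuotient t i =
            Function.update (fun i => lam.diagram.littlewoodQuotient t i) x.1 x.2 i :=
      fun x => exists_of_components ht lam _ _
    choose nu hnu1 hnu2 hnu3 using hex
    have hself : ∀ x : Σ _ : ℕ, YoungDiagram, x.1 ∈ Finset.Icc 1 (t / 2) →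
        (nu x).diagram.littlewoodQuotient t x.1 = x.2 := fun x hx => by
      rw [hnu3 x _ hx, Function.update_self]
    have hother : ∀ x : Σ _ : ℕ, YoungDiagram, ∀ j ∈ Finset.Icc 1 (t / 2), j ≠ x.1 →
        (nu x).diagram.littlewoodQuotient t j = lam.diagram.littlewoodQuotient t j :=
      fun x j hj hjx => by rw [hnu3 x _ hj, Function.update_of_ne hjx]
    refine Finset.sum_bij (fun x _ => nu x) ?_ ?_ ?_ ?_
    · intro x hx
      rw [Finset.mem_sigma] at hx
      rw [Finset.mem_filter, hS, hnu2 x]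
      exact ⟨⟨hnu1 x, Or.inr ⟨rfl, x.1, hx.1, (hself x hx.1).symm ▸ hx.2, hother x⟩⟩, hU⟩
    · intro x hx x' hx' heq
      rw [Finset.mem_sigma] at hx hx'
      have h1 : x.1 = x'.1 := by
        by_contra hne
        have h2 := hself x hx.1
        rw [heq, hother x' _ hx.1 hne] at h2
        exact hV x.1 (h2 ▸ hx.2)
      have h2 : x.2 = x'.2 := by
        rw [← hself x hx.1, ← hself x' hx'.1, heq, h1]
      exact Sigma.ext h1 (heq_of_eq h2)
    · intro ka hka
      rw [Finset.mem_filter, hS] at hka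
      obtain ⟨⟨h1, h2⟩, h3⟩ := hka
      obtain ⟨h4, i, hi, h5, h6⟩ := h2.resolve_left fun h => h3 h.1
      refine ⟨⟨i, ka.diagram.littlewoodQuotient t i⟩, Finset.mem_sigma.mpr ⟨hi, h5⟩, ?_⟩
      refine eq_of_components ht ((hnu1 _).trans h1.symm) ((hnu2 _).trans h4.symm)
        fun j hj => ?_
      by_cases hji : j = i
      · subst hji
        exact hself _ hj
      · rw [hother _ j hj hji, h6 j hj hji]
    · rintro ⟨i, y⟩ hx
      rw [Finset.mem_sigma] at hx
      have h1 : ∏ j ∈ (Finset.Icc 1 (t / 2)).erase i,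
          b ((nu ⟨i, y⟩).diagram.littlewoodQuotient t j) =
          ∏ j ∈ (Finset.Icc 1 (t / 2)).erase i, b (lam.diagram.littlewoodQuotient t j) :=
        Finset.prod_congr rfl fun j hj => by
          rw [hother ⟨i, y⟩ j (Finset.mem_of_mem_erase hj) (Finset.ne_of_mem_erase hj)]
      rw [hnu2, ← Finset.mul_prod_erase _ _ hx.1, hself ⟨i, y⟩ hx.1, h1]

/-- `G_λ` as a product over the components of the quotient. -/
theorem G_eq (lam : DoubledDistinct) :
    lam.G t = ((t : ℚ) ^ lam.weight t)⁻¹ *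
      ((2 : ℚ) ^ (((lam.bar0 t).size : ℤ) - (lam.bar0 t).length) *
        (1 / ((lam.bar0 t).hookProd : ℚ)) *
      ∏ i ∈ Finset.Icc 1 (t / 2), (2 : ℚ) ^ (lam.diagram.littlewoodQuotient t i).card *
        (1 / ((lam.diagram.littlewoodQuotient t i).hookProd : ℚ))) := by
  have h : (2 : ℚ) ^ ((lam.weight t : ℤ) - ((lam.bar0 t).length : ℤ)) =
      (2 : ℚ) ^ (((lam.bar0 t).size : ℤ) - (lam.bar0 t).length) *
        (2 : ℚ) ^ (∑ i ∈ Finset.Icc 1 (t / 2), (lam.diagram.littlewoodQuotient t i).card) := by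
    rw [← zpow_natCast (2 : ℚ), ← zpow_add₀ two_ne_zero]
    congr 1
    rw [weight]
    push_cast
    ring
  rw [G, h, Finset.prod_mul_distrib, Finset.prod_pow_eq_pow_sum]
  simp only [one_div, Finset.prod_inv_distrib]
  rw [div_eq_mul_inv, mul_inv, mul_inv]
  ring

/-- The strict component contributes `1 / t` and each other component `2 / t`. -/
theorem sum_G_above_one (ht : Odd t) (lam : DoubledDistinct) :
    ∑ nu ∈ lam.above t 1, nu.G t = lam.G t := by
  have ht0 : (t : ℚ) ≠ 0 := by exact_mod_cast NeZero.ne t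
  have h1 : ∀ nu ∈ lam.above t 1, nu.G t = ((t : ℚ) ^ (lam.weight t + 1))⁻¹ *
      ((2 : ℚ) ^ (((nu.bar0 t).size : ℤ) - (nu.bar0 t).length) *
        (1 / ((nu.bar0 t).hookProd : ℚ)) *
      ∏ i ∈ Finset.Icc 1 (t / 2), (2 : ℚ) ^ (nu.diagram.littlewoodQuotient t i).card *
        (1 / ((nu.diagram.littlewoodQuotient t i).hookProd : ℚ))) := fun nu hnu => by
    rw [G_eq, ((mem_above ht).mp hnu).2]
  have hU := fun s => (StrictPartition.finite_isCover_up (lam.bar0 t)).mem_toFinset (a := s)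
  have hV := fun i y => (YoungDiagram.finite_isCover_up
    (lam.diagram.littlewoodQuotient t i)).mem_toFinset (a := y)
  simp only [Set.mem_ofPred_eq] at hU hV
  rw [Finset.sum_congr rfl h1, ← Finset.mul_sum, sum_exchange ht lam _
    (StrictPartition.finite_isCover_up (lam.bar0 t)).toFinset
    (fun i => (YoungDiagram.finite_isCover_up (lam.diagram.littlewoodQuotient t i)).toFinset)
    (by rw [hU]; exact StrictPartition.not_isCover_self _)
    (fun i => by rw [hV]; exact YoungDiagram.not_isCover_self _)
    (fun nu => by simp only [hU, hV]; exact mem_above_one ht)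
    (fun s => (2 : ℚ) ^ ((s.size : ℤ) - s.length) * (1 / (s.hookProd : ℚ)))
    (fun y => (2 : ℚ) ^ y.card * (1 / (y.hookProd : ℚ))),
    StrictPartition.sum_isCover_up hU]
  have h2 : ∀ i ∈ Finset.Icc 1 (t / 2),
      (∑ y ∈ (YoungDiagram.finite_isCover_up (lam.diagram.littlewoodQuotient t i)).toFinset,
        (2 : ℚ) ^ y.card * (1 / (y.hookProd : ℚ))) *
      ∏ j ∈ (Finset.Icc 1 (t / 2)).erase i, ((2 : ℚ) ^ (lam.diagram.littlewoodQuotient t j).card *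
        (1 / ((lam.diagram.littlewoodQuotient t j).hookProd : ℚ))) =
      2 * ∏ j ∈ Finset.Icc 1 (t / 2), ((2 : ℚ) ^ (lam.diagram.littlewoodQuotient t j).card *
        (1 / ((lam.diagram.littlewoodQuotient t j).hookProd : ℚ))) := by
    intro i hi
    rw [← Finset.mul_prod_erase _ _ hi, Finset.sum_congr rfl fun y hy => by
      rw [((hV i y).mp hy).2], ← Finset.mul_sum, YoungDiagram.sum_isCover_up (hV i)]
    ring
  rw [Finset.sum_congr rfl h2, Finset.sum_const, Nat.card_Icc, G_eq, nsmul_eq_mul]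
  obtain ⟨m, rfl⟩ := ht
  rw [show (2 * m + 1) / 2 + 1 - 1 = m by omega, pow_succ, mul_inv]
  have h3 : ((2 * m + 1 : ℕ) : ℚ) = 2 * m + 1 := by push_cast; ring
  have h4 : ((2 * m + 1 : ℕ) : ℚ)⁻¹ * (1 + m * 2) = 1 := by
    rw [h3, inv_mul_eq_one₀ (by rw [← h3]; exact ht0)]
    ring
  linear_combination (((2 * m + 1 : ℕ) : ℚ) ^ lam.weight (2 * m + 1))⁻¹ *
      ((2 : ℚ) ^ (((lam.bar0 (2 * m + 1)).size : ℤ) - (lam.bar0 (2 * m + 1)).length) *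
        (1 / ((lam.bar0 (2 * m + 1)).hookProd : ℚ)) *
      ∏ i ∈ Finset.Icc 1 ((2 * m + 1) / 2),
        (2 : ℚ) ^ (lam.diagram.littlewoodQuotient (2 * m + 1) i).card *
        (1 / ((lam.diagram.littlewoodQuotient (2 * m + 1) i).hookProd : ℚ))) * h4

/-- The reciprocal of the product of the hook lengths of `λ̄⁰` and of `λ^1, …, λ^t'`. Up to the
factor `n!`, with `n` the weight, this is the number of ways to build up these partitions box by
box. -/
noncomputable def invHooks (t : ℕ) [NeZero t] (lam : DoubledDistinct) : ℚ :=
  1 / ((lam.bar0 t).hookProd : ℚ) *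
    ∏ i ∈ Finset.Icc 1 (t / 2), (1 / ((lam.diagram.littlewoodQuotient t i).hookProd : ℚ))

theorem one_div_hookProdMod (ht : Odd t) (lam : DoubledDistinct) :
    (2 * t : ℚ) ^ lam.weight t * (1 / (lam.diagram.hookProdMod t : ℚ)) =
      lam.G t * lam.invHooks t := by
  have ht0 : (t : ℚ) ≠ 0 := by exact_mod_cast NeZero.ne t
  have h1 : ((lam.bar0 t).hookProd : ℚ) ≠ 0 := by
    exact_mod_cast (lam.bar0 t).hookProd_pos.ne'
  have h2 : ∏ i ∈ Finset.Icc 1 (t / 2),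
      ((lam.diagram.littlewoodQuotient t i).hookProd : ℚ) ≠ 0 :=
    Finset.prod_ne_zero_iff.mpr fun i _ => by
      exact_mod_cast (lam.diagram.littlewoodQuotient t i).hookProd_pos.ne'
  rw [hookProdMod_eq ht, G, invHooks, zpow_sub₀ two_ne_zero, zpow_natCast, zpow_natCast]
  simp only [one_div, Finset.prod_inv_distrib]
  push_cast
  rw [mul_pow, pow_mul']
  field_simp

open Classical in
/-- The doubled distinct partitions that `lam` exceeds by one step in the order `≥_t`. -/
noncomputable def below (t : ℕ) [NeZero t] (lam : DoubledDistinct) : Finset DoubledDistinct :=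
  (ofSize (lam.diagram.card - 2 * 1 * t)).filter fun ka => lam ∈ ka.above t 1

theorem mem_below {lam ka : DoubledDistinct} : ka ∈ lam.below t ↔ lam ∈ ka.above t 1 := by
  classical
  rw [below, Finset.mem_filter, mem_ofSize, and_iff_right_iff_imp]
  intro h
  rw [above, Finset.mem_filter, mem_ofSize] at h
  omega

/-- Removing a box from one component; the sizes of the components add up to the weight. -/
theorem sum_invHooks_below (ht : Odd t) (lam : DoubledDistinct) :
    ∑ ka ∈ lam.below t, ka.invHooks t = lam.weight t * lam.invHooks t := by
  have hU := fun s => (StrictPartition.finite_isCover_down (lam.bar0 t)).mem_toFinset (a := s)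
  have hV := fun i y => (YoungDiagram.finite_isCover_down
    (lam.diagram.littlewoodQuotient t i)).mem_toFinset (a := y)
  simp only [Set.mem_ofPred_eq] at hU hV
  simp only [invHooks]
  rw [sum_exchange ht lam _
    (StrictPartition.finite_isCover_down (lam.bar0 t)).toFinset
    (fun i => (YoungDiagram.finite_isCover_down (lam.diagram.littlewoodQuotient t i)).toFinset)
    (by rw [hU]; exact StrictPartition.not_isCover_self _)
    (fun i => by rw [hV]; exact YoungDiagram.not_isCover_self _)
    (fun ka => by
      simp only [hU, hV]
      rw [mem_below, mem_above_one ht]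
      refine and_congr eq_comm (or_congr (and_congr_right' ?_) (and_congr eq_comm ?_))
      · exact forall₂_congr fun i _ => eq_comm
      · refine exists_congr fun i => and_congr_right' (and_congr_right' ?_)
        exact forall₃_congr fun j _ _ => eq_comm)
    (fun s => 1 / (s.hookProd : ℚ)) (fun y => 1 / (y.hookProd : ℚ)),
    StrictPartition.sum_isCover_down hU]
  have h2 : ∀ i ∈ Finset.Icc 1 (t / 2),
      (∑ y ∈ (YoungDiagram.finite_isCover_down (lam.diagram.littlewoodQuotient t i)).toFinset,
        (1 / (y.hookProd : ℚ))) *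
      ∏ j ∈ (Finset.Icc 1 (t / 2)).erase i,
        (1 / ((lam.diagram.littlewoodQuotient t j).hookProd : ℚ)) =
      ((lam.diagram.littlewoodQuotient t i).card : ℚ) * ∏ j ∈ Finset.Icc 1 (t / 2),
        (1 / ((lam.diagram.littlewoodQuotient t j).hookProd : ℚ)) := by
    intro i hi
    rw [← Finset.mul_prod_erase _ _ hi, YoungDiagram.sum_isCover_down (hV i)]
    ring
  rw [Finset.sum_congr rfl h2, ← Finset.sum_mul, weight]
  push_cast
  ring

/-! ### Partitions above a core -/

/-- A partition of weight zero has empty quotient, so only the core matters above it. -/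
theorem geT_iff_of_weight_eq_zero {lam mu : DoubledDistinct} (h : mu.weight t = 0) :
    lam.GeT t mu ↔ lam.diagram.littlewoodCore t = mu.diagram.littlewoodCore t := by
  rw [weight, Nat.add_eq_zero_iff, Finset.sum_eq_zero_iff] at h
  rw [GeT, and_iff_left]
  exact ⟨StrictPartition.contains_of_size_eq_zero h.1, fun i hi => by
    rw [YoungDiagram.eq_bot_of_card_eq_zero (h.2 i hi)]
    exact bot_le⟩

theorem eq_of_weight_eq_zero (ht : Odd t) {lam mu : DoubledDistinct} (h : mu.weight t = 0)
    (h' : lam.weight t = 0)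
    (hc : lam.diagram.littlewoodCore t = mu.diagram.littlewoodCore t) : lam = mu := by
  rw [weight, Nat.add_eq_zero_iff, Finset.sum_eq_zero_iff] at h h'
  refine eq_of_components ht hc ?_ fun i hi => ?_
  · exact (StrictPartition.contains_of_size_eq_zero h.1).eq_of_size_eq (h'.1.trans h.1.symm)
  · rw [YoungDiagram.eq_bot_of_card_eq_zero (h.2 i hi),
      YoungDiagram.eq_bot_of_card_eq_zero (h'.2 i hi)]

theorem G_mul_invHooks_of_weight_eq_zero {mu : DoubledDistinct} (h : mu.weight t = 0) :
    mu.G t * mu.invHooks t = 1 := by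
  have h' := h
  rw [weight, Nat.add_eq_zero_iff, Finset.sum_eq_zero_iff] at h'
  have h1 : ∀ i ∈ Finset.Icc 1 (t / 2), (mu.diagram.littlewoodQuotient t i).hookProd = 1 :=
    fun i hi => by
      rw [YoungDiagram.eq_bot_of_card_eq_zero (h'.2 i hi), YoungDiagram.hookProd_bot]
  rw [G, invHooks, h, StrictPartition.length_eq_zero h'.1, StrictPartition.hookProd_eq_one h'.1,
    Finset.prod_eq_one fun i hi => by rw [h1 i hi, Nat.cast_one],
    Finset.prod_eq_one fun i hi => by rw [h1 i hi, Nat.cast_one, div_one]]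
  norm_num

theorem sum_G_mul_invHooks (ht : Odd t) {mu : DoubledDistinct} (h : mu.weight t = 0) (n : ℕ) :
    ∑ lam ∈ mu.above t n, lam.G t * lam.invHooks t = 1 / (n.factorial : ℚ) := by
  induction n with
  | zero =>
    have : mu.above t 0 = {mu} := by
      ext lam
      rw [mem_above ht, geT_iff_of_weight_eq_zero h, Finset.mem_singleton]
      constructor
      · rintro ⟨h1, h2⟩
        exact eq_of_weight_eq_zero ht h (by omega) h1
      · rintro rfl
        exact ⟨rfl, rfl⟩
    rw [this, Finset.sum_singleton, G_mul_invHooks_of_weight_eq_zero h]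
    simp
  | succ n ih =>
    have h1 : ∑ lam ∈ mu.above t (n + 1), (((n + 1 : ℕ) : ℚ) * (lam.G t * lam.invHooks t)) =
        ∑ lam ∈ mu.above t (n + 1), ∑ ka ∈ lam.below t, lam.G t * ka.invHooks t := by
      refine Finset.sum_congr rfl fun lam hlam => ?_
      have hw := ((mem_above ht).mp hlam).2
      rw [h, zero_add] at hw
      rw [← Finset.mul_sum, sum_invHooks_below ht, hw]
      ring
    have h2 : ∑ lam ∈ mu.above t (n + 1), ∑ ka ∈ lam.below t, lam.G t * ka.invHooks t =
        ∑ ka ∈ mu.above t n, ∑ lam ∈ ka.above t 1, lam.G t * ka.invHooks t := by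
      refine Finset.sum_comm' fun lam ka => ?_
      simp only [mem_below, mem_above ht, geT_iff_of_weight_eq_zero h, h, zero_add]
      constructor
      · rintro ⟨⟨h1, h2⟩, h3, h4⟩
        exact ⟨⟨h3, h4⟩, h3.1.symm.trans h1, by omega⟩
      · rintro ⟨⟨h3, h4⟩, h1, h2⟩
        exact ⟨⟨h3.1.trans h1, by omega⟩, h3, h4⟩
    have h3 : ∀ ka ∈ mu.above t n, ∑ lam ∈ ka.above t 1, lam.G t * ka.invHooks t =
        ka.G t * ka.invHooks t := fun ka _ => by
      rw [← Finset.sum_mul, sum_G_above_one ht]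
    rw [← Finset.mul_sum, h2, Finset.sum_congr rfl h3, ih] at h1
    have h4 : (n.factorial : ℚ) ≠ 0 := by exact_mod_cast n.factorial_ne_zero
    have h5 : ((n + 1 : ℕ) : ℚ) ≠ 0 := by positivity
    rw [Nat.factorial_succ, Nat.cast_mul, ← div_div, eq_div_iff h4, eq_div_iff h5]
    field_simp at h1
    linarith

theorem sum_above (ht : Odd t) {mu : DoubledDistinct} (h : mu.weight t = 0) (n : ℕ) :
    ∑ lam ∈ mu.above t n,
      ((2 * t : ℚ) ^ n * (n.factorial : ℚ)) / (lam.diagram.hookProdMod t : ℚ) = 1 := by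
  have h1 : ∀ lam ∈ mu.above t n,
      ((2 * t : ℚ) ^ n * (n.factorial : ℚ)) / (lam.diagram.hookProdMod t : ℚ) =
        n.factorial * (lam.G t * lam.invHooks t) := by
    intro lam hlam
    have hw := ((mem_above ht).mp hlam).2
    rw [h, zero_add] at hw
    rw [← one_div_hookProdMod ht, hw]
    ring
  rw [Finset.sum_congr rfl h1, ← Finset.mul_sum, sum_G_mul_invHooks ht h]
  exact mul_one_div_cancel (by exact_mod_cast n.factorial_ne_zero)

end DoubledDistinct

/-- In a word with an inversion some letter `1` is followed by a letter `0`. -/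
theorem EdgeWord.exists_adjacent_of_inversion {w : EdgeWord} {p q : ℤ} (hp : p ∉ w.zeros)
    (hq : q ∈ w.zeros) (h : p < q) : ∃ r, r ∉ w.zeros ∧ r + 1 ∈ w.zeros := by
  by_contra hcon
  push Not at hcon
  have : ∀ n : ℕ, p + n ∉ w.zeros := fun n => by
    induction n with
    | zero => simpa using hp
    | succ n ih =>
      have := hcon _ ih
      push_cast
      rwa [← add_assoc]
  exact this (q - p).toNat (by rwa [Int.toNat_of_nonneg (by omega), add_sub_cancel])

theorem DoubledDistinct.weight_eq_zero_of_isCore {t : ℕ} [NeZero t] (ht : Odd t)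
    {mu : DoubledDistinct} (h : mu.diagram.IsCore t) : mu.weight t = 0 := by
  by_contra hcon
  have h1 := sum_card_littlewoodQuotient ht mu
  obtain ⟨k, hk, hne⟩ := Finset.exists_ne_zero_of_sum_ne_zero
    (h1.trans_ne (mul_ne_zero two_ne_zero hcon))
  rw [YoungDiagram.littlewoodQuotient, EdgeWord.card_diagram, Finset.card_ne_zero] at hne
  obtain ⟨⟨p, q⟩, hx⟩ := hne
  rw [EdgeWord.mem_inversions] at hx
  obtain ⟨r, hr, hr'⟩ := EdgeWord.exists_adjacent_of_inversion hx.1 hx.2.1 hx.2.2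
  have htpos : 0 < t := Nat.pos_of_ne_zero (NeZero.ne t)
  refine h ?_
  rw [← mu.diagram.diagram_edgeWord, EdgeWord.hooks_diagram, Multiset.mem_map]
  refine ⟨((t : ℤ) * r + k, (t : ℤ) * (r + 1) + k), EdgeWord.mem_inversions.mpr ⟨hr, hr', ?_⟩, ?_⟩
  · simp only [mul_add]
    omega
  · simp only [mul_add]
    omega

/-- The empty doubled distinct partition. -/
def DoubledDistinct.empty : DoubledDistinct := 
  ⟨⊥, ⟨[], List.Pairwise.nil.sortedGT, by simp⟩, rfl⟩

theorem mainTheorem12 (t : ℕ) [NeZero t] (ht : Odd t) :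
    (∀ lam : DoubledDistinct,
      DoubledDistinct.diffOp t (fun nu => nu.G t) lam = 0) ∧
    (∀ mu : DoubledDistinct, mu.diagram.IsCore t → ∀ n : ℕ,
      ∑ lam ∈ mu.above t n,
        ((2 * t : ℚ) ^ n * (n.factorial : ℚ)) / (lam.diagram.hookProdMod t : ℚ) = 1) ∧
    (∀ n : ℕ,
      ∑ lam ∈ (DoubledDistinct.ofSize (2 * n * t)).filter
          (fun lam => (lam.diagram.hooksMod t).card = 2 * n),
        1 / (lam.diagram.hookProdMod t : ℚ) = 1 / ((2 * t : ℚ) ^ n * (n.factorial : ℚ))) := by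
  refine ⟨fun lam => ?_, fun mu hmu n => ?_, fun n => ?_⟩
  · rw [DoubledDistinct.diffOp, DoubledDistinct.sum_G_above_one ht, sub_self]
  · exact DoubledDistinct.sum_above ht (DoubledDistinct.weight_eq_zero_of_isCore ht hmu) n
  · have hcard := DoubledDistinct.card_eq ht DoubledDistinct.empty
    rw [show DoubledDistinct.empty.diagram.card = 0 from rfl] at hcard
    have htpos : 0 < t := Nat.pos_of_ne_zero (NeZero.ne t)
    have hw : DoubledDistinct.empty.weight t = 0 := by
      by_contra hcon
      have : 0 < 2 * DoubledDistinct.empty.weight t * t := by positivity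
      omega
    have hset : (DoubledDistinct.ofSize (2 * n * t)).filter
        (fun lam => (lam.diagram.hooksMod t).card = 2 * n) = DoubledDistinct.empty.above t n := by
      ext lam
      rw [Finset.mem_filter, DoubledDistinct.mem_ofSize, DoubledDistinct.mem_above ht,
        DoubledDistinct.card_hooksMod ht, DoubledDistinct.geT_iff_of_weight_eq_zero hw, hw,
        YoungDiagram.eq_bot_of_card_eq_zero
          (μ := DoubledDistinct.empty.diagram.littlewoodCore t) (by omega)]
      have h1 := DoubledDistinct.card_eq ht lam
      constructor
      · rintro ⟨h2, h3⟩
        have h4 : lam.weight t = n := by omega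
        rw [h4] at h1
        exact ⟨YoungDiagram.eq_bot_of_card_eq_zero (by omega), by omega⟩
      · rintro ⟨h2, h3⟩
        rw [zero_add] at h3
        rw [h2, h3, show (⊥ : YoungDiagram).card = 0 from rfl, zero_add] at h1
        exact ⟨h1, by omega⟩
    have h := DoubledDistinct.sum_above ht hw n
    rw [hset]
    have h0 : (2 * t : ℚ) ^ n * (n.factorial : ℚ) ≠ 0 :=
      mul_ne_zero (pow_ne_zero _ (mul_ne_zero two_ne_zero (by exact_mod_cast NeZero.ne t)))
        (by exact_mod_cast n.factorial_ne_zero)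
    simp only [div_eq_mul_inv, one_mul] at h ⊢
    rw [← Finset.mul_sum] at h
    exact eq_inv_of_mul_eq_one_right h
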